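/- Let $\mathbf k$ be an algebraically closed field of arbitrary characteristic, let $N\cong\mathbb Z^d$ be a lattice, and let $\Sigma$ be a smooth fan in $N$ (for instance the fan of a smooth projective toric variety; completeness is not needed). Let $X_\Sigma$ be the smooth toric variety over $\mathbf k$ of $\Sigma$, with its toric boundary $\Delta_\Sigma=\bigcup_\rho\Delta_\rho$, where $\rho$ runs through the rays of $\Sigma$, with primitive generators $u_\rho$, and with the divisorial log structure of $\Delta_\Sigma$. A contact order is a tuple $\mathbf c=(c_\rho)_\rho$ of non-negative integers such that the rays with $c_\rho\neq0$ span a cone of $\Sigma$; it is positive if some $c_\rho\ne0$, and it is identified with the lattice point $\sum_\rho c_\rho u_\rho\in|\Sigma|\cap N$. We write $\operatorname{char}\mathbf k\nmid\mathbf c$ if $\operatorname{char}\mathbf k\nmid c_\rho$ for some $\rho$ (for $\operatorname{char}\mathbf k=0$ this means $\mathbf c\neq 0$). Let $\varsigma=\{\mathbf c_1,\dots,\mathbf c_n\}$, $n\ge1$, be a non-empty collection of positive contact orders satisfying the balancing condition $\sum_k\mathbf c_k=0$ in $N$, and let $\mathbb Z\cdot\varsigma\subset N$ be the sublattice generated by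 $\varsigma$. A family of genus zero non-degenerate stable log maps with contact orders $\varsigma$, parametrized by a variety $W$ over $\mathbf k$, consists of pairwise disjoint sections $p_1,\dots,p_n$ of $W\times\mathbb P^1\to W$ and a $\mathbf k$-morphism $ev:W\times\mathbb P^1\to X_\Sigma$ that is a morphism of log schemes for the divisorial log structures of $\bigcup_k p_k(W)$ and $\Delta_\Sigma$, such that $ev^*\Delta_\rho=\sum_k c_{k,\rho}\,p_k(W)$ for every ray $\rho$, and such that on each fiber $\{w\}\times\mathbb P^1$ the map is non-constant or $n\ge3$. The variety $X_\Sigma$ is (separably) $\varsigma$-uniruled if there is such a family with $\dim W=\dim X_\Sigma-1$ and $ev$ dominant (and separable); it is (separably) $\varsigma$-rationally connected if there is such a family for which $ev^{(2)}:(W\times\mathbb P^1)\times_W(W\times\mathbb P^1)\to X_\Sigma\times X_\Sigma$ is dominant (and separable). Here a dominant morphism is separable if it induces a separable (not necessarily algebraic) extension of function fields. Then: 1. $X_\Sigma$ is $\varsigma$-uniruled, and it is separably $\varsigma$-uniruled if $\operatorname{char}\mathbf k\nmid\mathbf c_k$ for some $k$ (in characteristic $0$ this always holds). 2. If $\mathbb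 Z\cdot\varsigma$ has rank $d$, then $X_\Sigma$ is $\varsigma$-rationally connected. 3. If $\mathbb Z\cdot\varsigma$ has rank $d$ and, in case $\operatorname{char}\mathbf k=p>0$, the group $N/(\mathbb Z\cdot\varsigma)$ has no $p$-torsion, then $X_\Sigma$ is separably $\varsigma$-rationally connected. -/

import Mathlib

open AlgebraicGeometry CategoryTheory Limits TopologicalSpace

universe u

noncomputable section

/-! ### Smooth fans -/

/-- A smooth fan in the lattice `N`. A smooth cone is recorded by the (finite) set of primitive
generators of its rays: the cone itself is the cone spanned by that set in `N ⊗ ℝ`, its faces are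
spanned by the subsets, and its lattice points form the submonoid of `N` generated by that set. -/
structure SmoothFan (N : Type) [AddCommGroup N] where
  /-- The cones of the fan, each given by the primitive generators of its rays. -/
  cones : Finset (Finset N)
  /-- The zero cone belongs to the fan. -/
  empty_mem : ∅ ∈ cones
  /-- Every face of a cone of the fan belongs to the fan. -/
  face_mem : ∀ σ ∈ cones, ∀ τ : Finset N, τ ⊆ σ → τ ∈ cones
  /-- Every cone is smooth: its ray generators are part of a `ℤ`-basis of `N`. -/
  smooth : ∀ σ ∈ cones, ∃ (ι : Type) (b : Module.Basis ι ℤ N), (σ : Set N) ⊆ Set.range b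
  /-- Two cones meet in a common face. As all cones are rational, it suffices to say this for the
  lattice points. -/
  inter : ∀ σ ∈ cones, ∀ τ ∈ cones,
    AddSubmonoid.closure (σ : Set N) ⊓ AddSubmonoid.closure (τ : Set N) ≤
      AddSubmonoid.closure ((σ : Set N) ∩ (τ : Set N))

namespace SmoothFan

variable {N : Type} [AddCommGroup N] (F : SmoothFan N)

/-- The partially ordered set of cones of the fan. -/
abbrev Cone : Type := {σ : Finset N // σ ∈ F.cones}

open Classical in
/-- The set of primitive generators of the rays of the fan. -/
def rays : Finset N := F.cones.biUnion id

/-- The rays of the fan, each given by its primitive generator. -/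
abbrev Ray : Type := {v : N // v ∈ F.rays}

/-! ### The toric variety of a smooth fan -/

/-- The monoid `σ^∨ ∩ M` of the characters that are non-negative on the cone `σ`. -/
def dualMonoid (σ : Finset N) : AddSubmonoid (Module.Dual ℤ N) where
  carrier := {m | ∀ v ∈ σ, 0 ≤ m v}
  add_mem' := fun ha hb v hv => add_nonneg (ha v hv) (hb v hv)
  zero_mem' := fun _ _ => le_rfl

lemma dualMonoid_anti {σ τ : Finset N} (h : σ ⊆ τ) : dualMonoid τ ≤ dualMonoid σ :=
  fun _ hm v hv => hm v (h hv)

variable (k : Type u) [Field k]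

/-- The coordinate ring `k[σ^∨ ∩ M]` of the affine toric variety of the cone `σ`. -/
abbrev ChartRing (σ : Finset N) : Type u := AddMonoidAlgebra k (dualMonoid σ)

/-- The inclusion `k[τ^∨ ∩ M] → k[σ^∨ ∩ M]` for a face `σ` of `τ`. -/
def chartMap {σ τ : Finset N} (h : σ ⊆ τ) : ChartRing k τ →+* ChartRing k σ :=
  AddMonoidAlgebra.mapDomainRingHom k (AddSubmonoid.inclusion (dualMonoid_anti h))

lemma chartMap_single {σ τ : Finset N} (h : σ ⊆ τ) (m : dualMonoid τ) (r : k) :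
    chartMap k h (AddMonoidAlgebra.single m r) =
      AddMonoidAlgebra.single (AddSubmonoid.inclusion (dualMonoid_anti h) m) r := by
  simp [chartMap]

lemma chartMap_injective {σ τ : Finset N} (h : σ ⊆ τ) : Function.Injective (chartMap k h) :=
  AddMonoidAlgebra.mapDomain_injective (AddSubmonoid.inclusion_injective _)

lemma chartMap_refl (σ : Finset N) : chartMap k (Finset.Subset.refl σ) = RingHom.id _ := by
  ext <;> simp [chartMap_single]; rfl

lemma chartMap_comp {σ τ υ : Finset N} (h : σ ⊆ τ) (h' : τ ⊆ υ) :
    (chartMap k h).comp (chartMap k h') = chartMap k (h.trans h') := by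
  ext <;> simp [chartMap_single]; rfl

/-- If the character `m` is non-negative on `τ` and vanishes exactly on the face `σ`, then
`k[σ^∨ ∩ M]` is the localization of `k[τ^∨ ∩ M]` at `χ^m`. -/
lemma isLocalization_chartMap {σ τ : Finset N} (h : σ ⊆ τ) (m : dualMonoid τ)
    (hm : ∀ v ∈ τ, m.1 v = 0 ↔ v ∈ σ) :
    letI := (chartMap k h).toAlgebra
    IsLocalization.Away (AddMonoidAlgebra.single m (1 : k)) (ChartRing k σ) := by
  let := (chartMap k h).toAlgebra
  have hneg : -m.1 ∈ dualMonoid σ := fun v hv => by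
    have := (hm v (h hv)).2 hv
    simp [this]
  apply IsLocalization.Away.mk
  · change IsUnit (chartMap k h _)
    rw [chartMap_single]
    refine IsUnit.of_mul_eq_one (AddMonoidAlgebra.single (⟨-m.1, hneg⟩ : dualMonoid σ) (1 : k)) ?_
    rw [AddMonoidAlgebra.single_mul_single, AddMonoidAlgebra.one_def]
    congr 1
    · ext; simp
    · simp
  · intro s
    change ∃ n a, s * chartMap k h _ ^ n = chartMap k h a
    induction s using AddMonoidAlgebra.induction_on with
    | of m' =>
      let n : ℕ := ∑ v ∈ τ, (m'.1 v).natAbs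
      have hmem : m'.1 + n • m.1 ∈ dualMonoid τ := fun v hv => by
        by_cases hvσ : v ∈ σ
        · have h0 := (hm v hv).2 hvσ
          simpa [h0] using m'.2 v hvσ
        · have h0 : m.1 v ≠ 0 := fun h0 => hvσ ((hm v hv).1 h0)
          have h1 : 0 ≤ m.1 v := m.2 v hv
          have h2 : (m'.1 v).natAbs ≤ n :=
            Finset.single_le_sum (f := fun v => (m'.1 v).natAbs) (fun _ _ => Nat.zero_le _) hv
          have h3 : (1 : ℤ) ≤ m.1 v := by omega
          have h4 : -(n : ℤ) ≤ m'.1 v := by omega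
          have h5 : (n : ℤ) * 1 ≤ n * m.1 v := by gcongr
          simp only [LinearMap.add_apply, LinearMap.smul_apply, nsmul_eq_mul]
          omega
      refine ⟨n, AddMonoidAlgebra.single ⟨_, hmem⟩ 1, ?_⟩
      rw [chartMap_single, chartMap_single, AddMonoidAlgebra.single_pow, AddMonoidAlgebra.of_apply,
        AddMonoidAlgebra.single_mul_single]
      congr 1
      simp
    | add x y hx hy =>
      obtain ⟨n, a, ha⟩ := hx
      obtain ⟨n', b, hb⟩ := hy
      refine ⟨n + n', a * AddMonoidAlgebra.single m (1 : k) ^ n' +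
        b * AddMonoidAlgebra.single m (1 : k) ^ n, ?_⟩
      rw [map_add, map_mul, map_mul, ← ha, ← hb, map_pow, map_pow]
      ring
    | smul r x hx =>
      obtain ⟨n, a, ha⟩ := hx
      refine ⟨n, algebraMap k _ r * a, ?_⟩
      have hr : chartMap k h (algebraMap k _ r) = algebraMap k _ r := by
        simp [chartMap_single]
      rw [map_mul, ← ha, hr, Algebra.smul_def, mul_assoc]
  · intro a b hab
    exact ⟨0, by rw [chartMap_injective k h hab]⟩

lemma exists_supporting {σ τ : Finset N} (hτ : τ ∈ F.cones) :
    ∃ m : dualMonoid τ, ∀ v ∈ τ, m.1 v = 0 ↔ v ∈ σ := by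
  classical
  obtain ⟨ι, b, hb⟩ := F.smooth τ hτ
  have key : ∀ v ∈ τ, b.constr ℤ (fun i => if b i ∈ σ then (0 : ℤ) else 1) v =
      if v ∈ σ then 0 else 1 := by
    intro v hv
    obtain ⟨i, rfl⟩ := hb hv
    simp
  refine ⟨⟨b.constr ℤ (fun i => if b i ∈ σ then (0 : ℤ) else 1), fun v hv => ?_⟩, fun v hv => ?_⟩
  · rw [key v hv]; split_ifs <;> simp
  · simp only [key v hv]; split_ifs with h <;> simp [h]

/-- The diagram of the affine toric varieties of the cones of the fan. -/
def chart : F.Cone ⥤ Scheme.{u} where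
  obj σ := Spec (.of (ChartRing k σ.1))
  map f := Spec.map (CommRingCat.ofHom (chartMap k (leOfHom f)))
  map_id σ := by
    rw [show chartMap k (leOfHom (𝟙 σ)) = RingHom.id _ from chartMap_refl k σ.1]
    simp
  map_comp f g := by
    rw [← Spec.map_comp, ← CommRingCat.ofHom_comp]
    congr 2
    exact (chartMap_comp k (leOfHom f) (leOfHom g)).symm

lemma range_chart_map {σ τ : F.Cone} (f : σ ⟶ τ) (m : dualMonoid τ.1)
    (hm : ∀ v ∈ τ.1, m.1 v = 0 ↔ v ∈ σ.1) :
    Set.range ((F.chart k).map f) =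
      (PrimeSpectrum.basicOpen (AddMonoidAlgebra.single m (1 : k)) :
        Set (PrimeSpectrum (ChartRing k τ.1))) := by
  let := (chartMap k (leOfHom f)).toAlgebra
  have := isLocalization_chartMap k (leOfHom f) m hm
  exact PrimeSpectrum.localization_away_comap_range (ChartRing k σ.1)
    (AddMonoidAlgebra.single m (1 : k))

instance isOpenImmersion_chart_map {σ τ : F.Cone} (f : σ ⟶ τ) :
    IsOpenImmersion ((F.chart k).map f) := by
  obtain ⟨m, hm⟩ := F.exists_supporting (σ := σ.1) τ.2
  let := (chartMap k (leOfHom f)).toAlgebra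
  have := isLocalization_chartMap k (leOfHom f) m hm
  exact IsOpenImmersion.of_isLocalization (S := ChartRing k σ.1)
    (AddMonoidAlgebra.single m (1 : k))

instance isLocallyDirected_chart : (F.chart k ⋙ Scheme.forget).IsLocallyDirected where
  cond := by
    classical
    intro σ τ υ f g x y hxy
    change (F.chart k).map f x = (F.chart k).map g y at hxy
    obtain ⟨m, hm⟩ := F.exists_supporting (σ := σ.1) υ.2
    obtain ⟨n, hn⟩ := F.exists_supporting (σ := τ.1) υ.2
    let ρ : F.Cone := ⟨σ.1 ∩ τ.1, F.face_mem σ.1 σ.2 _ Finset.inter_subset_left⟩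
    have hρσ : ρ ≤ σ := Finset.inter_subset_left
    have hρτ : ρ ≤ τ := Finset.inter_subset_right
    have hmn : ∀ v ∈ υ.1, (m + n).1 v = 0 ↔ v ∈ ρ.1 := by
      intro v hv
      have h1 : 0 ≤ m.1 v := m.2 v hv
      have h2 : 0 ≤ n.1 v := n.2 v hv
      have h3 : (m + n).1 v = m.1 v + n.1 v := rfl
      rw [Finset.mem_inter, ← hm v hv, ← hn v hv, h3]
      omega
    have hx : (F.chart k).map f x ∈ Set.range ((F.chart k).map f) := ⟨x, rfl⟩
    have hy : (F.chart k).map f x ∈ Set.range ((F.chart k).map g) := ⟨y, hxy.symm⟩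
    rw [range_chart_map F k f m hm] at hx
    rw [range_chart_map F k g n hn] at hy
    have hz : (F.chart k).map f x ∈ Set.range ((F.chart k).map (homOfLE hρσ ≫ f)) := by
      rw [range_chart_map F k (homOfLE hρσ ≫ f) (m + n) hmn,
        show AddMonoidAlgebra.single (m + n) (1 : k) =
          AddMonoidAlgebra.single m 1 * AddMonoidAlgebra.single n 1 by
            rw [AddMonoidAlgebra.single_mul_single, one_mul], PrimeSpectrum.basicOpen_mul]
      exact ⟨hx, hy⟩
    obtain ⟨z, hz⟩ := hz
    refine ⟨ρ, homOfLE hρσ, homOfLE hρτ, z, ?_, ?_⟩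
    · apply ((F.chart k).map f).isOpenEmbedding.injective
      rw [← hz, Functor.map_comp]
      rfl
    · apply ((F.chart k).map g).isOpenEmbedding.injective
      rw [← hxy, ← hz, show homOfLE hρσ ≫ f = homOfLE hρτ ≫ g from rfl, Functor.map_comp]
      rfl

/-- The toric variety `X_Σ`, glued from the affine toric varieties `Spec k[σ^∨ ∩ M]`. -/
def toricVariety : Scheme.{u} := colimit (F.chart k)

/-- The affine chart of the toric variety that belongs to a cone. -/
def chartι (σ : F.Cone) : Spec (.of (ChartRing k σ.1)) ⟶ F.toricVariety k :=
  colimit.ι (F.chart k) σ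

instance isOpenImmersion_chartι (σ : F.Cone) : IsOpenImmersion (F.chartι k σ) :=
  inferInstanceAs (IsOpenImmersion (colimit.ι (F.chart k) σ))

/-- The structure morphism of the toric variety. -/
def toricStructure : F.toricVariety k ⟶ Spec (.of k) :=
  colimit.desc (F.chart k)
    { pt := Spec (.of k)
      ι :=
        { app := fun σ => Spec.map (CommRingCat.ofHom (algebraMap k (ChartRing k σ.1)))
          naturality := fun σ τ f => by
            simp only [chart, Functor.const_obj_obj, Functor.const_obj_map, Category.comp_id]
            rw [← Spec.map_comp, ← CommRingCat.ofHom_comp]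
            congr 2
            ext r
            simp [chartMap_single] } }

/-- The torus invariant prime divisor `Δ_ρ`, as a closed subset. It is the union of the torus orbits
that belong to the cones containing `ρ`, so its complement is the union of the charts of the cones
that do not contain `ρ`. -/
def toricDivisor (ρ : F.Ray) : Closeds (F.toricVariety k) :=
  (⨆ σ : {σ : F.Cone // ρ.1 ∉ σ.1}, (F.chartι k σ.1).opensRange).compl

/-! ### Contact orders on the toric variety -/

/-- A contact order on the toric variety: a non-negative multiplicity along each `Δ_ρ`, such that the
rays with non-zero multiplicity span a cone of the fan, i.e., the corresponding divisors meet. -/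
structure ContactOrder where
  /-- The multiplicity along `Δ_ρ`. -/
  mult : F.Ray → ℕ
  /-- The rays with non-zero multiplicity span a cone of the fan. -/
  mem_cones : ∃ σ ∈ F.cones, ∀ ρ : F.Ray, ρ.1 ∈ σ ↔ mult ρ ≠ 0

variable {F}

/-- A contact order is positive if some multiplicity is not zero. -/
def ContactOrder.IsPositive (c : F.ContactOrder) : Prop := ∃ ρ, c.mult ρ ≠ 0

/-- The lattice point `∑ c_ρ u_ρ` in the support of the fan that belongs to a contact order. -/
def ContactOrder.latticePoint (c : F.ContactOrder) : N := ∑ ρ, c.mult ρ • ρ.1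

end SmoothFan

/-! ### The projective line -/

/-- The projective line over `k`. -/
def projLine (k : Type u) [Field k] : Scheme.{u} :=
  letI := MvPolynomial.gradedAlgebra (σ := Fin 2) (R := k)
  Proj (MvPolynomial.homogeneousSubmodule (Fin 2) k)

/-- The structure morphism of the projective line. -/
def projLineStructure (k : Type u) [Field k] : projLine k ⟶ Spec (.of k) :=
  letI := MvPolynomial.gradedAlgebra (σ := Fin 2) (R := k)
  Proj.toSpecZero (MvPolynomial.homogeneousSubmodule (Fin 2) k) ≫
    Spec.map (CommRingCat.ofHom
      (algebraMap k (MvPolynomial.homogeneousSubmodule (Fin 2) k 0)))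

/-! ### Divisorial log structures and non-degenerate log maps -/

/-- The sections over `U` of the divisorial log structure of the closed subset `D`: the functions on
`U` that are invertible on `U \ D`. -/
def logSections {X : Scheme.{u}} (D : Closeds X) (U : X.Opens) : Submonoid Γ(X, U) :=
  (IsUnit.submonoid Γ(X, U ⊓ D.compl)).comap
    (X.presheaf.map (homOfLE (inf_le_left : U ⊓ D.compl ≤ U)).op).hom

/-- The morphism `f` is a morphism of log schemes for the divisorial log structures of `E` and `D`.
As these are sheaves of submonoids of the structure sheaves, a map of log structures over `f` is
unique, and exists if and only if the pull-back of functions respects the submonoids. -/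
def IsLogMorphism {Y X : Scheme.{u}} (E : Closeds Y) (D : Closeds X) (f : Y ⟶ X) : Prop :=
  ∀ (U : X.Opens), ∀ s ∈ logSections D U, (f.app U).hom s ∈ logSections E (f ⁻¹ᵁ U)

/-- A family of genus zero non-degenerate stable log maps, with underlying family of curves
`W ×ₖ ℙ¹ → W` over a variety `W`, to the log scheme of a `k`-scheme `X` with boundary
components `Δ i`; the `j`-th marking has contact order `c j i` along `Δ i`. -/
structure LogMapFamily {k : Type u} [Field k] {X : Scheme.{u}} (π : X ⟶ Spec (.of k))
    {I : Type} (Δ : I → Closeds X) {n : ℕ} (c : Fin n → I → ℕ) where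
  /-- The base of the family. -/
  W : Scheme.{u}
  /-- The structure morphism of the base. -/
  str : W ⟶ Spec (.of k)
  isIntegral : IsIntegral W
  isSeparated : IsSeparated str
  locallyOfFiniteType : LocallyOfFiniteType str
  quasiCompact : QuasiCompact str
  /-- The markings, as sections of the family. -/
  marking : Fin n → (W ⟶ pullback str (projLineStructure k))
  marking_fst : ∀ j, marking j ≫ pullback.fst str (projLineStructure k) = 𝟙 W
  marking_disjoint : ∀ i j, i ≠ j → Disjoint (Set.range (marking i)) (Set.range (marking j))
  /-- The evaluation map. -/
  ev : pullback str (projLineStructure k) ⟶ X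
  ev_over : ev ≫ π = pullback.fst str (projLineStructure k) ≫ str
  /-- The evaluation map is a map of log schemes, for the log structure of the markings on the family
  of curves, and that of the boundary on `X`. -/
  ev_log : IsLogMorphism (∏ j, (marking j).ker).support (⨆ i, Δ i) ev
  /-- The contact orders: the pull-back of `Δ i` is the divisor `∑ j, c j i • (marking j)`. -/
  contact : ∀ i, (Scheme.IdealSheafData.vanishingIdeal (Δ i)).comap ev =
    ∏ j, (marking j).ker ^ c j i
  /-- Stability: a member of the family is non-constant or has at least three markings. -/
  stable : ∀ w : W,
    ¬ (ev '' (pullback.fst str (projLineStructure k) ⁻¹' {w})).Subsingleton ∨ 3 ≤ n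

namespace LogMapFamily

variable {k : Type u} [Field k] {X : Scheme.{u}} {π : X ⟶ Spec (.of k)}
  {I : Type} {Δ : I → Closeds X} {n : ℕ} {c : Fin n → I → ℕ}

/-- The total space `W ×ₖ ℙ¹` of the family of curves. -/
abbrev total (f : LogMapFamily π Δ c) : Scheme.{u} := pullback f.str (projLineStructure k)

/-- The projection of the family of curves to its base. -/
abbrev proj (f : LogMapFamily π Δ c) : f.total ⟶ f.W := pullback.fst f.str (projLineStructure k)

/-- The evaluation map at two points of a member of the family. -/
def ev₂ (f : LogMapFamily π Δ c) : pullback f.proj f.proj ⟶ pullback π π :=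
  pullback.lift (pullback.fst f.proj f.proj ≫ f.ev) (pullback.snd f.proj f.proj ≫ f.ev) (by
    rw [Category.assoc, Category.assoc, f.ev_over, ← Category.assoc, ← Category.assoc]
    exact congrArg (· ≫ f.str) pullback.condition)

end LogMapFamily

/-! ### Uniruledness and rational connectedness -/

/-- A dominant morphism of integral schemes is separable if the extension of function fields is
separable (not necessarily algebraic), i.e., geometrically reduced. The function fields are the local
rings at the generic points. -/
def IsDominantSeparable {Y X : Scheme.{u}} (f : Y ⟶ X) : Prop :=
  IsDominant f ∧ ∃ η : Y, IsGenericPoint η Set.univ ∧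
    letI := (f.stalkMap η).hom.toAlgebra
    Algebra.IsGeometricallyReduced (X.presheaf.stalk (f η)) (Y.presheaf.stalk η)

section

variable {k : Type u} [Field k] {X : Scheme.{u}} (π : X ⟶ Spec (.of k))
  {I : Type} (Δ : I → Closeds X) {n : ℕ} (c : Fin n → I → ℕ)

/-- Uniruledness by rational log curves with contact orders `c`. -/
def IsLogUniruled : Prop :=
  ∃ f : LogMapFamily π Δ c,
    topologicalKrullDim f.W + 1 = topologicalKrullDim X ∧ IsDominant f.ev

/-- Separable uniruledness by rational log curves with contact orders `c`. -/
def IsSeparablyLogUniruled : Prop :=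
  ∃ f : LogMapFamily π Δ c,
    topologicalKrullDim f.W + 1 = topologicalKrullDim X ∧ IsDominantSeparable f.ev

/-- Rational connectedness by rational log curves with contact orders `c`. -/
def IsLogRationallyConnected : Prop :=
  ∃ f : LogMapFamily π Δ c, IsDominant f.ev₂

/-- Separable rational connectedness by rational log curves with contact orders `c`. -/
def IsSeparablyLogRationallyConnected : Prop :=
  ∃ f : LogMapFamily π Δ c, IsDominantSeparable f.ev₂

end

end

noncomputable section

/-! ### Geometrically reduced field extensions -/

section GeometricallyReduced

open TensorProduct

lemma injective_lift_tensorProduct_mvPolynomial {K P Ka κ : Type*} [Field K] [CommRing P]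
    [Algebra K P] [Field Ka] [Algebra K Ka] (e₀ : P ≃ₐ[K] MvPolynomial κ K)
    (j : P ⊗[K] Ka →+* FractionRing (MvPolynomial κ Ka))
    (h₁ : ∀ p, j (p ⊗ₜ 1) =
      algebraMap (MvPolynomial κ Ka) _ (MvPolynomial.map (algebraMap K Ka) (e₀ p)))
    (h₂ : ∀ x, j (1 ⊗ₜ x) = algebraMap (MvPolynomial κ Ka) _ (MvPolynomial.C x)) :
    Function.Injective j := by
  let e : P ⊗[K] Ka ≃ₐ[K] MvPolynomial κ Ka :=
    (Algebra.TensorProduct.comm K P Ka).trans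
      ((Algebra.TensorProduct.congr AlgEquiv.refl e₀).trans
        ((MvPolynomial.algebraTensorAlgEquiv K Ka).restrictScalars K))
  have he : ∀ x y, e (x ⊗ₜ y) = y • MvPolynomial.map (algebraMap K Ka) (e₀ x) :=
    fun x y => by
      have h := MvPolynomial.algebraTensorAlgEquiv_tmul (R := K) (σ := κ) (A := Ka) y (e₀ x)
      rw [← h]
      rfl
  have hje : ∀ x, j x = algebraMap (MvPolynomial κ Ka) _ (e x) := by
    intro x
    induction x with
    | zero => simp
    | add x y hx hy => rw [map_add, map_add, map_add, hx, hy]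
    | tmul x y =>
      rw [he, MvPolynomial.smul_eq_C_mul, map_mul, mul_comm, ← h₁, ← h₂, ← map_mul,
        Algebra.TensorProduct.tmul_mul_tmul, mul_one, one_mul]
  intro x y hxy
  rw [hje, hje] at hxy
  exact e.injective (IsFractionRing.injective _ _ hxy)

open scoped IntermediateField.algebraAdjoinAdjoin in
/-- A finitely generated field extension that is separable over a purely transcendental one is
geometrically reduced. -/
theorem isGeometricallyReduced_of_algebraicIndependent_of_isSeparable
    {K L κ : Type*} [Field K] [Field L] [Algebra K L] [Algebra.EssFiniteType K L]
    {y : κ → L} (hy : AlgebraicIndependent K y)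
    [Algebra.IsSeparable (IntermediateField.adjoin K (Set.range y)) L] :
    Algebra.IsGeometricallyReduced K L := by
  rw [Algebra.isGeometricallyReduced_field_iff]
  let Ka := AlgebraicClosure K
  let P := Algebra.adjoin K (Set.range y)
  let K1 := IntermediateField.adjoin K (Set.range y)
  let E := FractionRing (MvPolynomial κ Ka)
  let φ : P →ₐ[K] E :=
    (IsScalarTower.toAlgHom K (MvPolynomial κ Ka) E).comp
      ((MvPolynomial.mapAlgHom (Algebra.ofId K Ka)).comp hy.aevalEquiv.symm.toAlgHom)
  let : Algebra P E := φ.toAlgebra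
  have : IsScalarTower K P E := IsScalarTower.of_algebraMap_eq fun r => (φ.commutes r).symm
  have : Algebra.FormallyUnramified P K1 :=
    .of_isLocalization (nonZeroDivisors P)
  have : Algebra.FormallyUnramified K1 L := .of_isSeparable _ _
  have : Algebra.FormallyUnramified P L := .comp P K1 L
  have : Algebra.EssFiniteType P L := .of_comp K P L
  have : Module.Flat P K1 := IsLocalization.flat K1 (nonZeroDivisors P)
  have : Module.Flat P L := .trans P K1 L
  have hred : IsReduced (E ⊗[P] L) := Algebra.FormallyUnramified.isReduced_of_field E _
  let j : P ⊗[K] Ka →ₐ[P] E :=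
    Algebra.TensorProduct.lift (Algebra.ofId P E) (IsScalarTower.toAlgHom K Ka E)
      fun _ _ => .all _ _
  have hj : Function.Injective j := by
    refine injective_lift_tensorProduct_mvPolynomial hy.aevalEquiv.symm j.toRingHom
      (fun p => ?_) (fun x => ?_)
    · exact (Algebra.TensorProduct.lift_tmul ..).trans (by rw [map_one, mul_one]; rfl)
    · exact (Algebra.TensorProduct.lift_tmul ..).trans (by rw [map_one, one_mul]; rfl)
  have hinj : Function.Injective (j.toLinearMap.lTensor L) :=
    Module.Flat.lTensor_preserves_injective_linearMap _ hj
  have h1 : IsReduced (L ⊗[P] (P ⊗[K] Ka)) := by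
    have : IsReduced (L ⊗[P] E) :=
      isReduced_of_injective (Algebra.TensorProduct.comm P L E) (AlgEquiv.injective _)
    exact isReduced_of_injective (Algebra.TensorProduct.map (AlgHom.id P L) j) hinj
  have h2 : IsReduced (L ⊗[K] Ka) :=
    isReduced_of_injective (Algebra.TensorProduct.cancelBaseChange K P P L Ka).symm
      (AlgEquiv.injective _)
  exact isReduced_of_injective (Algebra.TensorProduct.comm K Ka L) (AlgEquiv.injective _)

open scoped IntermediateField.algebraAdjoinAdjoin in
lemma isAlgebraic_adjoin_of_isAlgebraic_adjoin {k L : Type*} [Field k] [Field L] [Algebra k L]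
    (s : Set L) [Algebra.IsAlgebraic (IntermediateField.adjoin k s) L] :
    Algebra.IsAlgebraic (Algebra.adjoin k s) L :=
  have : Algebra.IsAlgebraic (Algebra.adjoin k s) (IntermediateField.adjoin k s) :=
    IsLocalization.isAlgebraic _ (nonZeroDivisors _)
  .trans _ (IntermediateField.adjoin k s) _

lemma IsTranscendenceBasis.trdeg_eq_natCard {k L : Type*} {ι' : Type*} [Field k] [Field L]
    [Algebra k L] [Finite ι'] {u : ι' → L} (hu : IsTranscendenceBasis k u) :
    Algebra.trdeg k L = Nat.card ι' := by
  have htr := hu.lift_cardinalMk_eq_trdeg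
  rw [← Nat.cast_card, Cardinal.lift_natCast] at htr
  exact Cardinal.lift_eq_nat_iff.1 htr.symm

/-- A family that generates `L` up to algebraic elements and is not longer than a transcendence
basis is algebraically independent. -/
lemma IsTranscendenceBasis.algebraicIndependent_of_card_le {k L ι' ι : Type*} [Field k] [Field L]
    [Algebra k L] [Finite ι] [Finite ι'] {u : ι' → L} (hu : IsTranscendenceBasis k u) {x : ι → L}
    (hcard : Nat.card ι ≤ Nat.card ι')
    [Algebra.IsAlgebraic (IntermediateField.adjoin k (Set.range x)) L] :
    AlgebraicIndependent k x := by
  have := isAlgebraic_adjoin_of_isAlgebraic_adjoin (k := k) (Set.range x)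
  refine (Algebra.IsAlgebraic.isTranscendenceBasis_of_lift_le_trdeg_of_finite k x ?_).1
  rw [hu.trdeg_eq_natCard, ← Nat.cast_card, Cardinal.lift_natCast, Cardinal.lift_natCast]
  exact_mod_cast hcard

theorem isGeometricallyReduced_of_card_eq {k : Type*} {K L : Type u} {ι ι' κ : Type*}
    [Field k] [Field K] [Field L] [Algebra k K] [Algebra k L] [Algebra K L] [IsScalarTower k K L]
    [Algebra.EssFiniteType K L] [Finite ι] [Finite ι'] [Finite κ]
    {u : ι' → L} (hu : IsTranscendenceBasis k u)
    {x : ι → K} (hx : IntermediateField.adjoin k (Set.range x) = ⊤) {y : κ → L}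
    (hcard : Nat.card ι + Nat.card κ = Nat.card ι')
    [Algebra.IsSeparable (IntermediateField.adjoin K (Set.range y)) L] :
    Algebra.IsGeometricallyReduced K L := by
  have h1 : Algebra.IsAlgebraic (IntermediateField.adjoin k (Set.range x)) K := by
    rw [hx]
    exact ⟨fun a => isAlgebraic_algebraMap (⟨a, trivial⟩ : (⊤ : IntermediateField k K))⟩
  have h2 := isAlgebraic_adjoin_of_isAlgebraic_adjoin (k := k) (Set.range x)
  have h3 := isAlgebraic_adjoin_of_isAlgebraic_adjoin (k := K) (Set.range y)
  have hK : Algebra.trdeg k K ≤ Nat.card ι := by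
    refine (Algebra.IsAlgebraic.trdeg_le_cardinalMk k (Set.range x)).trans ?_
    rw [← Nat.cast_card]
    exact_mod_cast Finite.card_range_le x
  have hadd := trdeg_add_eq k K (A := L)
  rw [hu.trdeg_eq_natCard, ← hcard] at hadd
  have hy : AlgebraicIndependent K y := by
    refine (Algebra.IsAlgebraic.isTranscendenceBasis_of_lift_le_trdeg_of_finite K y ?_).1
    rw [← Nat.cast_card, Cardinal.lift_natCast, Cardinal.nat_le_lift_iff]
    by_contra! hlt
    have hlt' : Algebra.trdeg K L < Cardinal.aleph0 := hlt.trans (Cardinal.natCast_lt_aleph0)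
    have hlt'' : Algebra.trdeg k K < Cardinal.aleph0 := hK.trans_lt (Cardinal.natCast_lt_aleph0)
    obtain ⟨a, ha⟩ := Cardinal.lt_aleph0.1 hlt'
    obtain ⟨b, hb⟩ := Cardinal.lt_aleph0.1 hlt''
    rw [ha] at hadd hlt
    rw [hb] at hadd hK
    norm_cast at hadd hlt hK
    omega
  exact isGeometricallyReduced_of_algebraicIndependent_of_isSeparable hy

end GeometricallyReduced

/-! ### Laurent monomials in algebraically independent elements -/

/-- An algebra map out of a Laurent polynomial ring is injective if it maps the variables to
algebraically independent elements. -/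
theorem AddMonoidAlgebra.algHom_injective_of_algebraicIndependent {k Λ L ι : Type*} [Field k]
    [Field L] [Algebra k L] [AddCommMonoid Λ] (β : (ι →₀ ℕ) →+ Λ)
    (hneg : ∀ c, ∃ m, m + β c = 0) (hgen : ∀ m, ∃ c c', m + β c = β c')
    (Φ : AddMonoidAlgebra k Λ →ₐ[k] L)
    (h : AlgebraicIndependent k fun i => Φ (.single (β (Finsupp.single i 1)) 1)) :
    Function.Injective Φ := by
  let ψ : MvPolynomial ι k →ₐ[k] AddMonoidAlgebra k Λ := AddMonoidAlgebra.mapDomainAlgHom k k β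
  have hψm : ∀ c r, ψ (MvPolynomial.monomial c r) = .single (β c) r := fun c r => by
    simp [ψ, MvPolynomial.monomial, AddMonoidAlgebra.mapDomainAlgHom]
  have hψ : Φ.comp ψ = MvPolynomial.aeval fun i => Φ (.single (β (Finsupp.single i 1)) 1) := by
    ext i
    rw [MvPolynomial.aeval_X, AlgHom.comp_apply, MvPolynomial.X, hψm]
  have hψΦ : Function.Injective (Φ.comp ψ) := by
    rw [hψ]; exact h
  have key : ∀ f : AddMonoidAlgebra k Λ, ∃ c g, f * ψ (MvPolynomial.monomial c 1) = ψ g := by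
    intro f
    induction f using AddMonoidAlgebra.induction_on with
    | of m =>
      obtain ⟨c, c', hc⟩ := hgen m
      refine ⟨c, MvPolynomial.monomial c' 1, ?_⟩
      rw [hψm, hψm, AddMonoidAlgebra.of_apply, AddMonoidAlgebra.single_mul_single, one_mul]
      exact congrArg (AddMonoidAlgebra.single · 1) hc
    | add x y hx hy =>
      obtain ⟨c, g, h1⟩ := hx
      obtain ⟨c', g', h2⟩ := hy
      refine ⟨c + c', g * MvPolynomial.monomial c' 1 + g' * MvPolynomial.monomial c 1, ?_⟩
      rw [map_add, map_mul, map_mul, ← h1, ← h2,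
        show MvPolynomial.monomial (c + c') (1 : k) = MvPolynomial.monomial c 1 *
          MvPolynomial.monomial c' 1 by simp [MvPolynomial.monomial_mul], map_mul]
      ring
    | smul r x hx =>
      obtain ⟨c, g, h1⟩ := hx
      exact ⟨c, r • g, by rw [map_smul, ← h1, smul_mul_assoc]⟩
  rw [injective_iff_map_eq_zero]
  intro f hf
  obtain ⟨c, g, hg⟩ := key f
  have hg0 : g = 0 := by
    apply hψΦ
    rw [AlgHom.comp_apply, ← hg]
    simp [hf]
  obtain ⟨m, hm⟩ := hneg c
  rw [hg0, map_zero, hψm] at hg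
  calc f = f * .single (β c) 1 * .single m 1 := by
        rw [mul_assoc, AddMonoidAlgebra.single_mul_single, add_comm, hm, one_mul]
        exact (mul_one f).symm
    _ = 0 := by rw [hg, zero_mul]

/-! ### Separability of the parameter of a rational curve -/

section Separability

open Polynomial

variable {K L : Type*} [Field K] [Field L] [Algebra K L]

lemma isSeparable_of_aeval_derivative_ne_zero {z : L} (P : K[X]) (h0 : aeval z P = 0)
    (h1 : aeval z (derivative P) ≠ 0) : IsSeparable K z := by
  have hP : P ≠ 0 := by
    rintro rfl
    simp at h1
  have hint : IsIntegral K z := (isAlgebraic_iff_isIntegral (K := K)).1 ⟨P, hP, h0⟩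
  obtain ⟨R, hR⟩ := minpoly.dvd K z h0
  have hd : derivative (minpoly K z) ≠ 0 := by
    intro h
    apply h1
    rw [hR, derivative_mul, h, map_add, map_mul, map_mul, minpoly.aeval]
    simp
  exact (separable_iff_derivative_ne_zero (minpoly.irreducible hint)).2 hd

lemma aeval_derivative_prod_X_sub_C_pow {ι : Type*} (s : Finset ι) (a : ι → K) (m : ι → ℕ) {z : L}
    (hz : ∀ j, z - algebraMap K L (a j) ≠ 0) :
    aeval z (derivative (∏ j ∈ s, (X - C (a j)) ^ m j)) =
      aeval z (∏ j ∈ s, (X - C (a j)) ^ m j) *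
        ∑ j ∈ s, (m j : L) / (z - algebraMap K L (a j)) := by
  classical
  induction s using Finset.induction_on with
  | empty => simp
  | insert i s hi ih =>
    rw [Finset.prod_insert hi, Finset.sum_insert hi, derivative_mul, map_add, map_mul, map_mul, ih,
      map_mul]
    have h1 : aeval z (derivative ((X - C (a i)) ^ m i)) =
        aeval z ((X - C (a i)) ^ m i) * ((m i : L) / (z - algebraMap K L (a i))) := by
      rcases Nat.eq_zero_or_pos (m i) with h | h
      · simp [h]
      · obtain ⟨r, hr⟩ := Nat.exists_eq_succ_of_ne_zero h.ne'
        rw [hr]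
        simp only [derivative_X_sub_C_pow, Nat.succ_eq_add_one, Nat.add_sub_cancel, map_mul,
          map_pow, map_sub, aeval_X, aeval_C, map_natCast]
        have := hz i
        field_simp
        ring
    rw [h1]
    ring

variable {n : ℕ} {a : Fin n → K} {m : Fin n → ℤ} {x : K} {z : L}

/-- The polynomial equation of `z` over a field containing `∏ (z - a j) ^ m j`. -/
def contactPolynomial (a : Fin n → K) (m : Fin n → ℤ) (x : K) : K[X] :=
  ∏ j, (X - C (a j)) ^ (m j).toNat - C x * ∏ j, (X - C (a j)) ^ (-m j).toNat

lemma aeval_prod_X_sub_C_pow (a : Fin n → K) (l : Fin n → ℕ) (z : L) :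
    aeval z (∏ j, (X - C (a j)) ^ l j) = ∏ j, (z - algebraMap K L (a j)) ^ l j := by
  simp

lemma prod_zpow_mul_prod_toNat (hz : ∀ j, z - algebraMap K L (a j) ≠ 0) :
    (∏ j, (z - algebraMap K L (a j)) ^ m j) * ∏ j, (z - algebraMap K L (a j)) ^ (-m j).toNat =
      ∏ j, (z - algebraMap K L (a j)) ^ (m j).toNat := by
  rw [← Finset.prod_mul_distrib]
  refine Finset.prod_congr rfl fun j _ => ?_
  rw [← zpow_natCast, ← zpow_natCast, ← zpow_add₀ (hz j)]
  congr 1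
  omega

lemma aeval_contactPolynomial (hz : ∀ j, z - algebraMap K L (a j) ≠ 0)
    (hx : algebraMap K L x = ∏ j, (z - algebraMap K L (a j)) ^ m j) :
    aeval z (contactPolynomial a m x) = 0 := by
  rw [contactPolynomial, map_sub, map_mul, aeval_prod_X_sub_C_pow, aeval_prod_X_sub_C_pow, aeval_C,
    hx, prod_zpow_mul_prod_toNat hz, sub_self]

lemma isAlgebraic_of_prod_zpow_eq (ha : Function.Injective a)
    (hz : ∀ j, z - algebraMap K L (a j) ≠ 0)
    (hx : algebraMap K L x = ∏ j, (z - algebraMap K L (a j)) ^ m j) (hm : ∃ j, m j ≠ 0) :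
    IsAlgebraic K z := by
  obtain ⟨j, hj⟩ := hm
  refine ⟨contactPolynomial a m x, fun h => ?_, aeval_contactPolynomial hz hx⟩
  have hx0 : x ≠ 0 := by
    rintro rfl
    rw [map_zero, eq_comm, Finset.prod_eq_zero_iff] at hx
    obtain ⟨i, -, hi⟩ := hx
    exact zpow_ne_zero _ (hz i) hi
  have h0 := congrArg (eval (a j)) h
  rw [contactPolynomial, eval_sub, eval_mul, eval_C, eval_zero, eval_prod, eval_prod] at h0
  simp only [eval_pow, eval_sub, eval_X, eval_C] at h0
  have hne : ∀ l : Fin n → ℕ, l j = 0 → ∏ i, (a j - a i) ^ l i ≠ 0 := fun l hl =>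
    Finset.prod_ne_zero_iff.2 fun i _ => by
      by_cases hi : i = j
      · subst hi; simp [hl]
      · exact pow_ne_zero _ (sub_ne_zero.2 fun h => hi (ha h).symm)
  have hzero : ∀ l : Fin n → ℕ, l j ≠ 0 → ∏ i, (a j - a i) ^ l i = 0 := fun l hl =>
    Finset.prod_eq_zero (Finset.mem_univ j) (by simp [hl])
  rcases lt_or_gt_of_ne hj with hlt | hlt
  · rw [hzero (fun i => (-m i).toNat) (by omega), mul_zero, sub_zero] at h0
    exact hne (fun i => (m i).toNat) (by omega) h0
  · rw [hzero (fun i => (m i).toNat) (by omega), zero_sub, neg_eq_zero] at h0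
    exact mul_ne_zero hx0 (hne (fun i => (-m i).toNat) (by omega)) h0

lemma isSeparable_of_prod_zpow_eq (hz : ∀ j, z - algebraMap K L (a j) ≠ 0)
    (hx : algebraMap K L x = ∏ j, (z - algebraMap K L (a j)) ^ m j)
    (hm : ∑ j, (m j : L) / (z - algebraMap K L (a j)) ≠ 0) :
    IsSeparable K z := by
  refine isSeparable_of_aeval_derivative_ne_zero _ (aeval_contactPolynomial hz hx) ?_
  rw [contactPolynomial, derivative_sub, derivative_mul, derivative_C, zero_mul, zero_add, map_sub,
    map_mul, aeval_derivative_prod_X_sub_C_pow _ _ _ hz, aeval_derivative_prod_X_sub_C_pow _ _ _ hz,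
    aeval_prod_X_sub_C_pow, aeval_prod_X_sub_C_pow, aeval_C, hx, ← mul_assoc,
    prod_zpow_mul_prod_toNat hz, ← mul_sub, ← Finset.sum_sub_distrib]
  refine mul_ne_zero (Finset.prod_ne_zero_iff.2 fun j _ => pow_ne_zero _ (hz j)) ?_
  convert hm using 2 with j
  rw [← sub_div]
  congr 1
  have h : (m j : ℤ) = ((m j).toNat : ℤ) - ((-m j).toNat : ℤ) := by omega
  conv_rhs => rw [h]
  push_cast
  rfl

lemma sum_div_sub_ne_zero {k : Type*} [Field k] [Algebra k L] {a : Fin n → k}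
    (ha : Function.Injective a) (hz : Transcendental k z) {j : Fin n} (hm : (m j : k) ≠ 0) :
    ∑ j, (m j : L) / (z - algebraMap k L (a j)) ≠ 0 := by
  classical
  have hne : ∀ i, z - algebraMap k L (a i) ≠ 0 := fun i h =>
    hz (sub_eq_zero.1 h ▸ isAlgebraic_algebraMap (a i))
  let Q : k[X] := ∑ i, C (m i : k) * ∏ l ∈ Finset.univ.erase i, (X - C (a l))
  have hQ : Q ≠ 0 := by
    intro h
    have h0 := congrArg (eval (a j)) h
    rw [eval_zero, eval_finsetSum, Finset.sum_eq_single j] at h0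
    · rw [eval_mul, eval_C, eval_prod] at h0
      refine mul_ne_zero hm (Finset.prod_ne_zero_iff.2 fun l hl => ?_) h0
      simp only [eval_sub, eval_X, eval_C]
      exact sub_ne_zero.2 fun h => (Finset.mem_erase.1 hl).1 (ha h).symm
    · intro i _ hi
      rw [eval_mul, eval_prod, Finset.prod_eq_zero (i := j), mul_zero]
      · exact Finset.mem_erase.2 ⟨hi.symm, Finset.mem_univ _⟩
      · simp
    · simp
  have hQz : aeval z Q = (∏ l, (z - algebraMap k L (a l))) *
      ∑ j, (m j : L) / (z - algebraMap k L (a j)) := by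
    simp only [Q, map_sum, map_mul, map_prod, map_sub, aeval_X, aeval_C, Finset.mul_sum]
    refine Finset.sum_congr rfl fun i _ => ?_
    rw [← Finset.mul_prod_erase _ _ (Finset.mem_univ i), map_intCast]
    have := hne i
    field_simp
  intro h
  rw [h, mul_zero] at hQz
  exact hz ⟨Q, hQ, hQz⟩

lemma isSeparable_of_pow_mem {s : L} {q : ℕ} (hq : (q : K) ≠ 0) (hs0 : s ≠ 0)
    (hs : s ^ q ∈ Set.range (algebraMap K L)) : IsSeparable K s := by
  obtain ⟨r, hr⟩ := hs
  refine isSeparable_of_aeval_derivative_ne_zero (X ^ q - C r) (by simp [hr]) ?_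
  have hq' : (q : L) ≠ 0 := by
    rw [← map_natCast (algebraMap K L)]
    exact (_root_.map_ne_zero _).2 hq
  simp [derivative_X_pow, hq', hs0]

end Separability

/-! ### Fields of moduli of the curves -/

/-- A subfield that contains the coordinates of two points of the curve with parameters `t`, `a`, and
is closed under taking `q`-th roots, contains the parameters. -/
theorem eq_top_of_two_points {k L ι : Type*} [Field k] [Field L] [Algebra k L] [Fintype ι]
    [DecidableEq ι] {n : ℕ}
    (S : IntermediateField k L) (e : ι ↪ Fin n) (a : Fin n → L) (t : ι → L) (z w : L)
    (ha : ∀ j, j ∉ Set.range e → a j ∈ S) (hza : ∀ j, z - a j ≠ 0) (hwa : ∀ j, w - a j ≠ 0)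
    (hzw : z ≠ w) (hz : z ∈ S) (hw : w ∈ S) (ht : ∀ i, t i ≠ 0)
    (m : ι → Fin n → ℤ) (hx : ∀ i, t i * ∏ j, (z - a j) ^ m i j ∈ S)
    (hx' : ∀ i, t i * ∏ j, (w - a j) ^ m i j ∈ S)
    (q : ℕ) (μ : ι → ι → ℤ) (hμ : ∀ i l, ∑ i', μ i i' * m i' (e l) = if i = l then (q : ℤ) else 0)
    (hq : ∀ s : L, s ≠ 0 → s ^ q ∈ S → s ∈ S)
    (htop : IntermediateField.adjoin k (Set.range t ∪ Set.range (a ∘ e) ∪ {z, w}) = ⊤) : S = ⊤ := by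
  set s : Fin n → L := fun j => (w - a j) / (z - a j) with hs
  have hs0 : ∀ j, s j ≠ 0 := fun j => div_ne_zero (hwa j) (hza j)
  have hsS : ∀ j, j ∉ Set.range e → s j ∈ S := fun j hj =>
    S.div_mem (S.sub_mem hw (ha j hj)) (S.sub_mem hz (ha j hj))
  have hratio : ∀ i, ∏ j, s j ^ m i j ∈ S := fun i => by
    have : ∏ j, s j ^ m i j =
        (t i * ∏ j, (w - a j) ^ m i j) / (t i * ∏ j, (z - a j) ^ m i j) := by
      rw [mul_div_mul_left _ _ (ht i), ← Finset.prod_div_distrib]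
      exact Finset.prod_congr rfl fun j _ => div_zpow _ _ _
    rw [this]
    exact S.div_mem (hx' i) (hx i)
  have hse : ∀ i, s (e i) ∈ S := by
    intro i
    apply hq _ (hs0 _)
    have h1 : ∏ j, s j ^ (∑ i', μ i i' * m i' j) ∈ S := by
      have : ∏ j, s j ^ (∑ i', μ i i' * m i' j) = ∏ i', (∏ j, s j ^ m i' j) ^ μ i i' := by
        simp_rw [← Finset.prod_zpow]
        rw [Finset.prod_comm]
        refine Finset.prod_congr rfl fun j _ => ?_
        simp_rw [← zpow_mul, mul_comm (μ i _)]
        have hsum : ∀ (T : Finset ι) (f : ι → ℤ), s j ^ (∑ i' ∈ T, f i') = ∏ i' ∈ T, s j ^ f i' := by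
          intro T f
          induction T using Finset.induction_on with
          | empty => simp
          | insert i T hi ih => rw [Finset.sum_insert hi, Finset.prod_insert hi, zpow_add₀ (hs0 j), ih]
        exact hsum _ _
      rw [this]
      exact S.prod_mem fun i' _ => zpow_mem (hratio i') _
    rw [← Finset.mul_prod_erase _ _ (Finset.mem_univ (e i)), hμ, if_pos rfl, zpow_natCast] at h1
    have h2 : ∏ j ∈ Finset.univ.erase (e i), s j ^ (∑ i', μ i i' * m i' j) ∈ S := by
      refine S.prod_mem fun j hj => ?_
      by_cases hje : j ∈ Set.range e
      · obtain ⟨l, rfl⟩ := hje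
        rw [hμ, if_neg]
        · simp
        · rintro rfl
          simp at hj
      · exact zpow_mem (hsS j hje) _
    have h3 : ∏ j ∈ Finset.univ.erase (e i), s j ^ (∑ i', μ i i' * m i' j) ≠ 0 :=
      Finset.prod_ne_zero_iff.2 fun j _ => zpow_ne_zero _ (hs0 j)
    rw [← mul_div_cancel_right₀ (s (e i) ^ q) h3]
    exact S.div_mem h1 h2
  have hp : ∀ i, a (e i) ∈ S := by
    intro i
    have hs1 : s (e i) - 1 ≠ 0 := by
      rw [hs, div_sub_one (hza _)]
      exact div_ne_zero (by simpa [sub_eq_zero] using hzw.symm) (hza _)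
    have : a (e i) = (s (e i) * z - w) / (s (e i) - 1) := by
      rw [eq_div_iff hs1]
      have := div_mul_cancel₀ (w - a (e i)) (hza (e i))
      change s (e i) * (z - a (e i)) = _ at this
      linear_combination -this
    rw [this]
    exact S.div_mem (S.sub_mem (S.mul_mem (hse i) hz) hw) (S.sub_mem (hse i) S.one_mem)
  have haS : ∀ j, a j ∈ S := fun j => by
    by_cases hj : j ∈ Set.range e
    · obtain ⟨i, rfl⟩ := hj
      exact hp i
    · exact ha j hj
  have htS : ∀ i, t i ∈ S := fun i => by
    have h3 : ∏ j, (z - a j) ^ m i j ≠ 0 :=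
      Finset.prod_ne_zero_iff.2 fun j _ => zpow_ne_zero _ (hza j)
    rw [← mul_div_cancel_right₀ (t i) h3]
    exact S.div_mem (hx i) (S.prod_mem fun j _ => zpow_mem (S.sub_mem hz (haS j)) _)
  rw [eq_top_iff, ← htop, IntermediateField.adjoin_le_iff]
  rintro y ((⟨i, rfl⟩ | ⟨i, rfl⟩) | rfl | rfl)
  · exact htS i
  · exact hp i
  · exact hz
  · exact hw

/-! ### Ideal sheaves on affine charts -/

namespace AlgebraicGeometry.Scheme.IdealSheafData

/-- The ideal of `R` that belongs to an ideal sheaf on `Spec R`. -/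
def specIdeal {R : CommRingCat.{u}} : (Spec R).IdealSheafData →* Ideal R where
  toFun I := (I.ideal ⟨⊤, isAffineOpen_top _⟩).map (ΓSpecIso R).hom.hom
  map_one' := by
    rw [one_eq_top, ideal_top, Ideal.one_eq_top]
    exact Ideal.map_top (ΓSpecIso R).hom.hom
  map_mul' I J := by
    rw [ideal_mul, Pi.mul_apply, Ideal.map_mul]

variable {R S : CommRingCat.{u}}

lemma specIdeal_eq_comap (I : (Spec R).IdealSheafData) :
    specIdeal I = (I.ideal ⟨⊤, isAffineOpen_top _⟩).comap (ΓSpecIso R).inv.hom :=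
  Ideal.map_comap_of_equiv (ΓSpecIso R).commRingCatIsoToRingEquiv

lemma mem_specIdeal {I : (Spec R).IdealSheafData} {r : R} :
    r ∈ specIdeal I ↔ (ΓSpecIso R).inv.hom r ∈ I.ideal ⟨⊤, isAffineOpen_top _⟩ := by
  rw [specIdeal_eq_comap, Ideal.mem_comap]

lemma ideal_top_eq_map_specIdeal (I : (Spec R).IdealSheafData) :
    I.ideal ⟨⊤, isAffineOpen_top _⟩ = (specIdeal I).comap (ΓSpecIso R).hom.hom := by
  rw [specIdeal_eq_comap, Ideal.comap_comap, ← CommRingCat.hom_comp, Iso.hom_inv_id]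
  exact (Ideal.comap_id _).symm

lemma specIdeal_injective : Function.Injective (specIdeal (R := R)) := fun I J h => by
  apply ext_of_isAffine
  rw [ideal_top_eq_map_specIdeal, h, ideal_top_eq_map_specIdeal]

@[simp]
lemma specIdeal_top : specIdeal (⊤ : (Spec R).IdealSheafData) = ⊤ :=
  (map_one specIdeal).trans Ideal.one_eq_top

lemma specIdeal_le_iff {I J : (Spec R).IdealSheafData} : specIdeal I ≤ specIdeal J ↔ I ≤ J := by
  refine ⟨fun h => le_of_isAffine ?_, fun h => Ideal.map_mono (h _)⟩
  rw [ideal_top_eq_map_specIdeal, ideal_top_eq_map_specIdeal]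
  exact Ideal.comap_mono h

lemma exists_specIdeal_eq (J : Ideal R) : ∃ I : (Spec R).IdealSheafData, specIdeal I = J := by
  refine ⟨ofIdealTop (J.comap (ΓSpecIso R).hom.hom), ?_⟩
  rw [specIdeal_eq_comap, ofIdealTop_ideal]
  have h : Ideal.map ((Spec R).presheaf.map (homOfLE (le_refl (⊤ : (Spec R).Opens))).op).hom
      (J.comap (ΓSpecIso R).hom.hom) = J.comap (ΓSpecIso R).hom.hom := by
    rw [show homOfLE (le_refl (⊤ : (Spec R).Opens)) = 𝟙 _ from rfl, op_id,
      CategoryTheory.Functor.map_id]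
    exact Ideal.map_id _
  refine (congrArg (Ideal.comap _) h).trans ?_
  rw [Ideal.comap_comap, ← CommRingCat.hom_comp, Iso.inv_hom_id]
  exact Ideal.comap_id _

lemma specIdeal_map (I : (Spec S).IdealSheafData) (φ : R ⟶ S) :
    specIdeal (I.map (Spec.map φ)) = (specIdeal I).comap φ.hom := by
  rw [specIdeal_eq_comap, specIdeal_eq_comap, ideal_map_of_isAffineHom, Ideal.comap_comap,
    Ideal.comap_comap]
  congr 1
  exact congrArg CommRingCat.Hom.hom (ΓSpecIso_inv_naturality φ).symm

lemma specIdeal_comap (I : (Spec R).IdealSheafData) (φ : R ⟶ S) :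
    specIdeal (I.comap (Spec.map φ)) = (specIdeal I).map φ.hom := by
  refine le_antisymm ?_ ?_
  · obtain ⟨J, hJ⟩ := exists_specIdeal_eq ((specIdeal I).map φ.hom)
    rw [← hJ, specIdeal_le_iff, ← le_map_iff_comap_le, ← specIdeal_le_iff, specIdeal_map, hJ]
    exact Ideal.le_comap_map
  · rw [Ideal.map_le_iff_le_comap, ← specIdeal_map, specIdeal_le_iff]
    exact le_map_comap _ _

lemma specIdeal_ker (φ : R ⟶ S) : specIdeal (Spec.map φ).ker = RingHom.ker φ.hom := by
  rw [← map_bot, specIdeal_map]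
  have : specIdeal (⊥ : (Spec S).IdealSheafData) = ⊥ := by
    rw [specIdeal_eq_comap, ideal_bot, eq_bot_iff]
    intro x hx
    have hx' : (ΓSpecIso S).inv.hom x = 0 := hx
    exact (map_eq_zero_iff _ (ConcreteCategory.bijective_of_isIso (ΓSpecIso S).inv).1).1 hx'
  rw [this]
  rfl

lemma mem_specIdeal_vanishingIdeal {Z : Closeds (Spec R)} {r : R} :
    r ∈ specIdeal (vanishingIdeal Z) ↔ ∀ p ∈ Z, r ∈ PrimeSpectrum.asIdeal p := by
  rw [mem_specIdeal, vanishingIdeal_ideal, PrimeSpectrum.mem_vanishingIdeal]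
  have hfrom : (isAffineOpen_top (Spec R)).fromSpec = Spec.map (ΓSpecIso R).inv := by
    rw [IsAffineOpen.fromSpec_top, isoSpec_Spec_inv]
  constructor
  · intro h p hp
    have hp' : (Spec.map (ΓSpecIso R).inv) (Spec.map (ΓSpecIso R).hom p) = p := by
      rw [← Scheme.Hom.comp_apply, ← Spec.map_comp, Iso.inv_hom_id, Spec.map_id]
      rfl
    have := h (Spec.map (ΓSpecIso R).hom p) (by
      change (isAffineOpen_top (Spec R)).fromSpec _ ∈ Z
      rw [hfrom, hp']
      exact hp)
    rw [← hp']
    exact this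
  · intro h p hp
    change (isAffineOpen_top (Spec R)).fromSpec p ∈ Z at hp
    rw [hfrom] at hp
    exact h _ hp

lemma comap_vanishingIdeal {X Y : Scheme.{u}} (f : X ⟶ Y) [IsOpenImmersion f] (Z : Closeds Y) :
    (vanishingIdeal Z).comap f = vanishingIdeal (Z.preimage f.continuous) := by
  have h1 : ((vanishingIdeal Z).comap f).support = Z.preimage f.continuous := by
    rw [support_comap]
    ext1
    simp
  rw [← h1, vanishingIdeal_support]
  refine (le_radical _).antisymm fun U => ?_
  rw [radical_ideal, ideal_comap_of_isOpenImmersion]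
  exact ((PrimeSpectrum.isRadical_vanishingIdeal _).comap _).radical_le_iff.2 le_rfl

lemma comap_mul_of_isOpenImmersion {X Y : Scheme.{u}} (f : X ⟶ Y) [IsOpenImmersion f]
    (I J : Y.IdealSheafData) : (I * J).comap f = I.comap f * J.comap f := by
  ext U : 2
  rw [ideal_comap_of_isOpenImmersion, ideal_mul, ideal_mul, Pi.mul_apply, Pi.mul_apply,
    ideal_comap_of_isOpenImmersion, ideal_comap_of_isOpenImmersion]
  let e := (f.appIso U).commRingCatIsoToRingEquiv
  have h : ∀ K, Ideal.comap (f.appIso U).inv.hom K = Ideal.map e K :=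
    fun K => (Ideal.map_comap_of_equiv e).symm
  rw [h, h, h, Ideal.map_mul]

/-- Pulling back ideal sheaves along an open immersion, as a monoid homomorphism. -/
def comapHom {X Y : Scheme.{u}} (f : X ⟶ Y) [IsOpenImmersion f] :
    Y.IdealSheafData →* X.IdealSheafData where
  toFun I := I.comap f
  map_one' := comap_top f
  map_mul' := comap_mul_of_isOpenImmersion f

/-- Ideal sheaves can be compared on the charts of an affine cover. -/
lemma ext_of_comap_eq {Y : Scheme.{u}} {J : Type*} {B : J → CommRingCat.{u}}
    (v : ∀ j, Spec (B j) ⟶ Y) [∀ j, IsOpenImmersion (v j)] (hv : ∀ y, ∃ j, y ∈ Set.range (v j))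
    {I I' : Y.IdealSheafData} (h : ∀ j, I.comap (v j) = I'.comap (v j)) : I = I' := by
  refine ext_of_iSup_eq_top
    (fun j => ⟨v j ''ᵁ ⊤, (isAffineOpen_top _).image_of_isOpenImmersion (v j)⟩) ?_ fun j => ?_
  · rw [eq_top_iff]
    intro y _
    obtain ⟨j, x, rfl⟩ := hv y
    exact Opens.mem_iSup.2 ⟨j, x, trivial, rfl⟩
  · have := congrArg (fun K => K.ideal ⟨⊤, isAffineOpen_top _⟩) (h j)
    simp only [ideal_comap_of_isOpenImmersion] at this
    exact Ideal.comap_injective_of_surjective _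
      (ConcreteCategory.bijective_of_isIso ((v j).appIso ⊤).inv).2 this

end AlgebraicGeometry.Scheme.IdealSheafData

/-! ### Charts of the toric variety -/

namespace SmoothFan

variable {N : Type} [AddCommGroup N] (F : SmoothFan N) (k : Type u) [Field k]

/-- The zero cone. -/
def zeroCone : F.Cone := ⟨∅, F.empty_mem⟩

lemma zeroCone_le (σ : F.Cone) : F.zeroCone ≤ σ := Finset.empty_subset σ.1

lemma chart_map_chartι {σ τ : F.Cone} (h : σ ≤ τ) :
    Spec.map (CommRingCat.ofHom (chartMap k h)) ≫ F.chartι k τ = F.chartι k σ :=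
  colimit.w (F.chart k) (homOfLE h)

lemma exists_chartι_eq (x : F.toricVariety k) : ∃ σ y, F.chartι k σ y = x :=
  Scheme.IsLocallyDirected.ι_jointly_surjective (F.chart k) x

lemma exists_of_chartι_eq {σ τ : F.Cone} {x : Spec (.of (ChartRing k σ.1))}
    {y : Spec (.of (ChartRing k τ.1))} (h : F.chartι k σ x = F.chartι k τ y) :
    ∃ (υ : F.Cone) (hσ : υ ≤ σ) (_ : υ ≤ τ) (z : Spec (.of (ChartRing k υ.1))),
      Spec.map (CommRingCat.ofHom (chartMap k hσ)) z = x := by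
  obtain ⟨υ, f, g, z, hz, -⟩ := (Scheme.IsLocallyDirected.ι_eq_ι_iff (F.chart k)).1 h
  exact ⟨υ, leOfHom f, leOfHom g, z, hz⟩

lemma chartι_toricStructure (σ : F.Cone) :
    F.chartι k σ ≫ F.toricStructure k =
      Spec.map (CommRingCat.ofHom (algebraMap k (ChartRing k σ.1))) :=
  colimit.ι_desc _ _

instance isDomain_chartRing [Module.Free ℤ N] (σ : Finset N) :
    IsDomain (ChartRing k σ) := by
  let b := Module.Free.chooseBasis ℤ N
  let f : dualMonoid σ →ₙ+ (Module.Free.ChooseBasisIndex ℤ N → ℤ) :=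
    { toFun := fun m i => m.1 (b i)
      map_add' := fun m m' => rfl }
  have hf : Function.Injective f := fun m m' h =>
    Subtype.ext (b.ext fun i => congrFun h i)
  have : TwoUniqueSums (dualMonoid σ) := TwoUniqueSums.of_injective_addHom f hf inferInstance
  infer_instance

/-- The torus is dense in the toric variety. -/
lemma isDominant_chartι_zeroCone : IsDominant (F.chartι k F.zeroCone) := by
  refine ⟨fun x => ?_⟩
  obtain ⟨σ, y, rfl⟩ := F.exists_chartι_eq k x
  have h := F.chart_map_chartι k (F.zeroCone_le σ)
  have hd : DenseRange (Spec.map (CommRingCat.ofHom (chartMap k (F.zeroCone_le σ)))) := by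
    exact (PrimeSpectrum.denseRange_comap_iff_ker_le_nilRadical _).2
      (((RingHom.injective_iff_ker_eq_bot _).1
        (chartMap_injective k (F.zeroCone_le σ))).le.trans bot_le)
  rw [← h]
  have := image_closure_subset_closure_image (F.chartι k σ).continuous ⟨y, hd y, rfl⟩
  rwa [← Set.range_comp] at this

lemma chartι_mem_toricDivisor {σ : F.Cone} {ρ : F.Ray} {x : Spec (.of (ChartRing k σ.1))} :
    F.chartι k σ x ∈ F.toricDivisor k ρ ↔
      ∀ (υ : F.Cone) (hυ : υ ≤ σ), ρ.1 ∉ υ.1 →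
        x ∉ Set.range (Spec.map (CommRingCat.ofHom (chartMap k hυ))) := by
  have h : F.chartι k σ x ∈ F.toricDivisor k ρ ↔
      ¬ F.chartι k σ x ∈ ⨆ σ : {σ : F.Cone // ρ.1 ∉ σ.1}, (F.chartι k σ.1).opensRange := Iff.rfl
  rw [h, not_iff_comm, Opens.mem_iSup]
  push Not
  constructor
  · rintro ⟨υ, hυ, hρ, z, rfl⟩
    exact ⟨⟨υ, hρ⟩, z, by rw [← F.chart_map_chartι k hυ]; rfl⟩
  · rintro ⟨⟨τ, hτ⟩, y, hy⟩
    obtain ⟨υ, h1, h2, z, hz⟩ := F.exists_of_chartι_eq k hy.symm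
    exact ⟨υ, h1, fun h => hτ (h2 h), z, hz⟩

lemma preimage_toricDivisor_of_notMem {σ : F.Cone} {ρ : F.Ray} (h : ρ.1 ∉ σ.1) :
    (F.toricDivisor k ρ).preimage (F.chartι k σ).continuous = ⊥ := by
  ext x
  change F.chartι k σ x ∈ F.toricDivisor k ρ ↔ x ∈ (∅ : Set _)
  rw [chartι_mem_toricDivisor]
  simp only [Set.mem_empty_iff_false, iff_false, not_forall, not_not]
  refine ⟨σ, le_rfl, h, x, ?_⟩
  rw [chartMap_refl]
  change Spec.map (𝟙 _) x = x
  simp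

lemma chartι_mem_toricDivisor_iff {σ : F.Cone} {ρ : F.Ray} (m : dualMonoid σ.1)
    (hm : ∀ v ∈ σ.1, m.1 v = 0 ↔ v ≠ ρ.1) {x : Spec (.of (ChartRing k σ.1))} :
    F.chartι k σ x ∈ F.toricDivisor k ρ ↔
      AddMonoidAlgebra.single m (1 : k) ∈ PrimeSpectrum.asIdeal x := by
  classical
  rw [chartι_mem_toricDivisor, ← not_iff_not]
  push Not
  let τ : F.Cone := ⟨σ.1.erase ρ.1, F.face_mem _ σ.2 _ (Finset.erase_subset _ _)⟩
  have hτσ : τ ≤ σ := Finset.erase_subset _ _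
  have hr := F.range_chart_map k (homOfLE hτσ) m (fun v hv => by
    rw [hm v hv]; simp [τ, hv])
  have hmem : AddMonoidAlgebra.single m (1 : k) ∉ PrimeSpectrum.asIdeal x ↔
      x ∈ Set.range ((F.chart k).map (homOfLE hτσ)) := by
    rw [hr]; rfl
  rw [hmem]
  constructor
  · rintro ⟨υ, hυ, hρ, z, rfl⟩
    have hυτ : υ ≤ τ := fun v hv => Finset.mem_erase.2 ⟨fun h => hρ (h ▸ hv), hυ hv⟩
    refine ⟨Spec.map (CommRingCat.ofHom (chartMap k hυτ)) z, ?_⟩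
    change (Spec.map _ ≫ Spec.map _) z = _
    rw [← Spec.map_comp, ← CommRingCat.ofHom_comp, chartMap_comp]
  · rintro h
    exact ⟨τ, hτσ, by simp [τ], h⟩

/-- The ideal of the prime divisor `Δ_ρ` in the chart of a cone containing `ρ` is generated by a
character. -/
lemma mem_span_single_of_forall_prime [Module.Free ℤ N] {σ : Finset N} {ρ : N} (hρ : ρ ∈ σ)
    (m : dualMonoid σ) (hmρ : m.1 ρ = 1) (hm : ∀ v ∈ σ, v ≠ ρ → m.1 v = 0) (r : ChartRing k σ)
    (hr : ∀ p : Ideal (ChartRing k σ), p.IsPrime →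
      AddMonoidAlgebra.single m (1 : k) ∈ p → r ∈ p) :
    r ∈ Ideal.span {AddMonoidAlgebra.single m (1 : k)} := by
  classical
  let H : AddSubmonoid (dualMonoid σ) :=
    { carrier := {m' | m'.1 ρ = 0}
      add_mem' := fun {a b} ha hb => by
        change a.1 ρ + b.1 ρ = 0
        rw [show a.1 ρ = 0 from ha, show b.1 ρ = 0 from hb, add_zero]
      zero_mem' := rfl }
  let i : AddMonoidAlgebra k H →ₐ[k] ChartRing k σ := AddMonoidAlgebra.mapDomainAlgHom k k H.subtype
  have hi : ∀ h c, i (.single h c) = .single h.1 c := fun h c => by simp [i]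
  have hnn : ∀ m' : dualMonoid σ, 0 ≤ m'.1 ρ := fun m' => m'.2 ρ hρ
  let Φ₀ : Multiplicative (dualMonoid σ) →* ChartRing k σ :=
    { toFun := fun m' => if m'.toAdd.1 ρ = 0 then .single m'.toAdd 1 else 0
      map_one' := if_pos rfl
      map_mul' := fun a b => by
        have ha := hnn a.toAdd
        have hb := hnn b.toAdd
        have hab : (a * b).toAdd.1 ρ = a.toAdd.1 ρ + b.toAdd.1 ρ := rfl
        by_cases ha0 : a.toAdd.1 ρ = 0
        · by_cases hb0 : b.toAdd.1 ρ = 0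
          · rw [if_pos (by rw [hab, ha0, hb0, add_zero]), if_pos ha0, if_pos hb0,
              AddMonoidAlgebra.single_mul_single, one_mul]
            rfl
          · rw [if_neg (by rw [hab]; omega), if_neg hb0, mul_zero]
        · rw [if_neg (by rw [hab]; omega), if_neg ha0, zero_mul] }
  let Φ : ChartRing k σ →ₐ[k] ChartRing k σ := AddMonoidAlgebra.lift k _ _ Φ₀
  have hΦ : ∀ m', Φ (.single m' 1) = if m'.1 ρ = 0 then .single m' 1 else 0 := fun m' => by
    simp [Φ, Φ₀, AddMonoidAlgebra.lift_single]
  have hΦi : Φ.comp i = i := by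
    refine AddMonoidAlgebra.algHom_ext (fun h => ?_) (Subsingleton.elim _ _)
    rw [AlgHom.comp_apply, hi, hΦ, if_pos (show h.1.1 ρ = 0 from h.2)]
  have hdec : ∀ r : ChartRing k σ, ∃ s r₁, r = i s + .single m 1 * r₁ := by
    intro r
    induction r using AddMonoidAlgebra.induction_on with
    | of m' =>
      by_cases h0 : m'.1 ρ = 0
      · exact ⟨.single ⟨m', h0⟩ 1, 0, by rw [hi, mul_zero, add_zero]; rfl⟩
      · have hmem : m'.1 - m.1 ∈ dualMonoid σ := fun v hv => by
          rw [LinearMap.sub_apply]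
          by_cases hvρ : v = ρ
          · subst hvρ
            have := hnn m'
            omega
          · rw [hm v hv hvρ, sub_zero]
            exact m'.2 v hv
        refine ⟨0, .single ⟨_, hmem⟩ 1, ?_⟩
        rw [map_zero, zero_add, AddMonoidAlgebra.single_mul_single, one_mul]
        refine congrArg (AddMonoidAlgebra.single · 1) (Subtype.ext ?_)
        exact (add_sub_cancel m.1 m'.1).symm
    | add x y hx hy =>
      obtain ⟨s, r, h1⟩ := hx
      obtain ⟨s', r', h2⟩ := hy
      exact ⟨s + s', r + r', by rw [map_add, mul_add, h1, h2]; ring⟩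
    | smul c x hx =>
      obtain ⟨s, r, h1⟩ := hx
      exact ⟨c • s, c • r, by rw [map_smul, mul_smul_comm, h1, smul_add]⟩
  obtain ⟨s, r₁, hs⟩ := hdec r
  have hker : AddMonoidAlgebra.single m (1 : k) ∈ RingHom.ker Φ := by
    rw [RingHom.mem_ker, hΦ, if_neg (by omega)]
  have hr0 := hr (RingHom.ker Φ) (RingHom.ker_isPrime Φ) hker
  rw [hs, RingHom.mem_ker, map_add, map_mul, (RingHom.mem_ker).1 hker, zero_mul, add_zero,
    ← AlgHom.comp_apply, hΦi] at hr0
  rw [hs, hr0, zero_add]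
  exact Ideal.mul_mem_right _ _ (Ideal.mem_span_singleton_self _)

open Scheme.IdealSheafData in
lemma specIdeal_comap_toricDivisor [Module.Free ℤ N] {σ : F.Cone} {ρ : F.Ray} (hρ : ρ.1 ∈ σ.1)
    (m : dualMonoid σ.1) (hmρ : m.1 ρ.1 = 1) (hm : ∀ v ∈ σ.1, v ≠ ρ.1 → m.1 v = 0) :
    specIdeal ((vanishingIdeal (F.toricDivisor k ρ)).comap (F.chartι k σ)) =
      Ideal.span {AddMonoidAlgebra.single m (1 : k)} := by
  have hm' : ∀ v ∈ σ.1, m.1 v = 0 ↔ v ≠ ρ.1 := fun v hv =>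
    ⟨fun h0 h => by rw [h, hmρ] at h0; exact one_ne_zero h0, hm v hv⟩
  rw [comap_vanishingIdeal]
  ext r
  rw [mem_specIdeal_vanishingIdeal]
  constructor
  · intro h
    refine mem_span_single_of_forall_prime k hρ m hmρ hm r fun p hp hmp => ?_
    exact h ⟨p, hp⟩ ((F.chartι_mem_toricDivisor_iff k m hm' (x := ⟨p, hp⟩)).2 hmp)
  · intro h p hp
    refine (Ideal.span_singleton_le_iff_mem _).2 ?_ h
    exact (F.chartι_mem_toricDivisor_iff k m hm').1 hp

open Scheme.IdealSheafData in
lemma comap_toricDivisor_of_notMem {σ : F.Cone} {ρ : F.Ray} (h : ρ.1 ∉ σ.1) :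
    (vanishingIdeal (F.toricDivisor k ρ)).comap (F.chartι k σ) = ⊤ := by
  rw [comap_vanishingIdeal, F.preimage_toricDivisor_of_notMem k h, vanishingIdeal_bot]

/-! ### The dimension of the toric variety -/

lemma _root_.AddMonoidAlgebra.mapDomainRingHom_surjective {Λ Λ' : Type*} [AddCommMonoid Λ]
    [AddCommMonoid Λ'] {g : Λ →+ Λ'} (hg : Function.Surjective g) :
    Function.Surjective (AddMonoidAlgebra.mapDomainRingHom k g) := by
  intro f
  induction f using AddMonoidAlgebra.induction_linear with
  | zero => exact ⟨0, map_zero _⟩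
  | add x y hx hy =>
    obtain ⟨x', rfl⟩ := hx
    obtain ⟨y', rfl⟩ := hy
    exact ⟨x' + y', map_add _ _ _⟩
  | single m r =>
    obtain ⟨m', rfl⟩ := hg m
    exact ⟨.single m' r, by simp⟩

lemma le_ringKrullDim_laurent (r : ℕ) :
    (r : WithBot ℕ∞) ≤ ringKrullDim (AddMonoidAlgebra k (Fin r → ℤ)) := by
  induction r with
  | zero => exact ringKrullDim_nonneg_of_nontrivial
  | succ r ih =>
    let g : (Fin (r + 1) → ℤ) →+ (Fin r → ℤ) :=
      { toFun := Fin.tail, map_zero' := rfl, map_add' := fun _ _ => rfl }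
    have hg : Function.Surjective g := fun v =>
      ⟨Fin.cons (0 : ℤ) v, funext fun i => rfl⟩
    let φ := AddMonoidAlgebra.mapDomainRingHom k g
    have hφ : Function.Surjective φ := AddMonoidAlgebra.mapDomainRingHom_surjective k hg
    let x : AddMonoidAlgebra k (Fin (r + 1) → ℤ) := .single (Pi.single 0 1) 1 - 1
    have hx : x ≠ 0 := by
      intro h
      rw [sub_eq_zero, AddMonoidAlgebra.one_def] at h
      have := (AddMonoidAlgebra.single_left_inj one_ne_zero).1 h
      simpa using congrFun this 0
    have hφx : φ x = 0 := by
      have hgx : g (Pi.single 0 1) = 0 := by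
        funext i
        change (Pi.single 0 1 : Fin (r + 1) → ℤ) i.succ = 0
        simp
      have h1 : φ (.single (Pi.single 0 1) 1) = 1 := by
        simp only [φ, AddMonoidAlgebra.mapDomainRingHom_apply, AddMonoidAlgebra.mapDomain_single, hgx]
        rfl
      rw [map_sub, h1, map_one, sub_self]
    have := ringKrullDim_succ_le_of_surjective φ hφ (mem_nonZeroDivisors_of_ne_zero hx) hφx
    refine le_trans ?_ this
    push_cast
    gcongr

variable {k} in
lemma ringKrullDim_le_of_isLocalization {R S : Type*} [CommRing R] [CommRing S] [Algebra R S]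
    (M : Submonoid R) [IsLocalization M S] : ringKrullDim S ≤ ringKrullDim R := by
  rw [← PrimeSpectrum.topologicalKrullDim_eq_ringKrullDim,
    ← PrimeSpectrum.topologicalKrullDim_eq_ringKrullDim]
  exact (PrimeSpectrum.localization_comap_isInducing S M).topologicalKrullDim_le

lemma ringKrullDim_chartRing_le [Module.Finite ℤ N] {σ : Finset N} {ι : Type} (b : Module.Basis ι ℤ N)
    (hσ : (σ : Set N) ⊆ Set.range b) :
    ringKrullDim (ChartRing k σ) ≤ Module.finrank ℤ N := by
  classical
  have : Finite ι := Module.Finite.finite_basis b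
  have := Fintype.ofFinite ι
  let τ : Finset N := Finset.univ.image b
  have hστ : σ ⊆ τ := fun v hv => by
    obtain ⟨i, rfl⟩ := hσ hv
    exact Finset.mem_image_of_mem _ (Finset.mem_univ i)
  let g : (ι →₀ ℕ) →+ dualMonoid τ :=
    { toFun := fun c => ⟨b.constr ℤ fun i => (c i : ℤ), fun v hv => by
        obtain ⟨i, -, rfl⟩ := Finset.mem_image.1 hv
        simp⟩
      map_zero' := Subtype.ext (b.ext fun i => by simp)
      map_add' := fun c c' => Subtype.ext (b.ext fun i => by simp) }
  have hg : Function.Surjective g := fun m => by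
    refine ⟨Finsupp.equivFunOnFinite.symm fun i => (m.1 (b i)).toNat,
      Subtype.ext (b.ext fun i => ?_)⟩
    have : 0 ≤ m.1 (b i) := m.2 _ (Finset.mem_image_of_mem _ (Finset.mem_univ i))
    simp [g, this]
  have h1 : ringKrullDim (ChartRing k τ) ≤ Module.finrank ℤ N := by
    have h2 : ringKrullDim (MvPolynomial ι k) = Module.finrank ℤ N := by
      rw [MvPolynomial.ringKrullDim_of_isNoetherianRing, ringKrullDim_eq_zero_of_field, zero_add,
        Module.finrank_eq_nat_card_basis b]
    rw [← h2]
    exact ringKrullDim_le_of_surjective (AddMonoidAlgebra.mapDomainRingHom k g)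
      (AddMonoidAlgebra.mapDomainRingHom_surjective k hg)
  have hsupp : b.constr ℤ (fun i => if b i ∈ σ then (0 : ℤ) else 1) ∈ dualMonoid τ := fun v hv => by
    obtain ⟨i, -, rfl⟩ := Finset.mem_image.1 hv
    rw [Module.Basis.constr_basis]
    split_ifs <;> simp
  let := (chartMap k hστ).toAlgebra
  have := isLocalization_chartMap k hστ ⟨_, hsupp⟩ fun v hv => by
    obtain ⟨i, -, rfl⟩ := Finset.mem_image.1 hv
    simp only [Module.Basis.constr_basis]
    split_ifs with h <;> simp [h]
  exact (ringKrullDim_le_of_isLocalization (R := ChartRing k τ) (S := ChartRing k σ)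
    (Submonoid.powers (AddMonoidAlgebra.single ⟨_, hsupp⟩ (1 : k)))).trans h1

variable [Module.Free ℤ N] [Module.Finite ℤ N]

lemma le_ringKrullDim_chartRing_empty :
    (Module.finrank ℤ N : WithBot ℕ∞) ≤ ringKrullDim (ChartRing k (∅ : Finset N)) := by
  let b := Module.finBasis ℤ N
  let g : dualMonoid (∅ : Finset N) →+ (Fin (Module.finrank ℤ N) → ℤ) :=
    { toFun := fun m i => m.1 (b i), map_zero' := rfl, map_add' := fun _ _ => rfl }
  have hg : Function.Surjective g := fun v =>
    ⟨⟨b.constr ℤ v, by simp [dualMonoid]⟩, funext fun i => by simp [g]⟩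
  exact (le_ringKrullDim_laurent k _).trans
    (ringKrullDim_le_of_surjective (AddMonoidAlgebra.mapDomainRingHom k g)
      (AddMonoidAlgebra.mapDomainRingHom_surjective k hg))

lemma ringKrullDim_chartRing_empty :
    ringKrullDim (ChartRing k (∅ : Finset N)) = Module.finrank ℤ N :=
  le_antisymm (ringKrullDim_chartRing_le k (Module.finBasis ℤ N) (by simp))
    (le_ringKrullDim_chartRing_empty k)

lemma topologicalKrullDim_toricVariety :
    topologicalKrullDim (F.toricVariety k) = Module.finrank ℤ N := by
  apply le_antisymm
  · rw [topologicalKrullDim, Order.krullDim_eq_iSup_coheight]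
    refine iSup_le fun Z => ?_
    obtain ⟨x, hx⟩ := Z.2.nonempty
    obtain ⟨σ, y, rfl⟩ := F.exists_chartι_eq k x
    have hemb := (F.chartι k σ).isOpenEmbedding
    let Z' := IrreducibleCloseds.orderIsoOfIsOpenEmbedding _ hemb |>.symm ⟨Z, ⟨y, hx⟩⟩
    have hZ' : IrreducibleCloseds.map _ hemb.continuous Z' = Z :=
      congrArg Subtype.val (OrderIso.apply_symm_apply
        (IrreducibleCloseds.orderIsoOfIsOpenEmbedding _ hemb) ⟨Z, ⟨y, hx⟩⟩)
    rw [← hZ', hemb.coheight_map]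
    obtain ⟨ι, b, hb⟩ := F.smooth σ.1 σ.2
    refine le_trans ?_ (ringKrullDim_chartRing_le k b hb)
    rw [← PrimeSpectrum.topologicalKrullDim_eq_ringKrullDim]
    exact Order.coheight_le_krullDim Z'
  · rw [← ringKrullDim_chartRing_empty k, ← PrimeSpectrum.topologicalKrullDim_eq_ringKrullDim]
    exact (F.chartι k F.zeroCone).isOpenEmbedding.isInducing.topologicalKrullDim_le

end SmoothFan

/-! ### Points and charts of the projective line -/

namespace ProjLine

attribute [local instance] MvPolynomial.gradedAlgebra

variable {k : Type u} [Field k] {S : Type u} [CommRing S] [Algebra k S]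

lemma X_mem (i : Fin 2) :
    MvPolynomial.X i ∈ MvPolynomial.homogeneousSubmodule (Fin 2) k 1 :=
  MvPolynomial.isHomogeneous_X k i

/-- Evaluation of homogeneous fractions with denominators powers of `f` at a tuple `s` at which `f` is
invertible. -/
def evalAway (s : Fin 2 → S) (f : MvPolynomial (Fin 2) k) (h : IsUnit (MvPolynomial.aeval s f)) :
    HomogeneousLocalization.Away (MvPolynomial.homogeneousSubmodule (Fin 2) k) f →+* S :=
  (Localization.awayLift (MvPolynomial.aeval s).toRingHom f h).comp
    (algebraMap _ (Localization.Away f))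

lemma evalAway_mul_pow (s : Fin 2 → S) (f : MvPolynomial (Fin 2) k)
    (h : IsUnit (MvPolynomial.aeval s f)) {d : ℕ}
    (hf : f ∈ MvPolynomial.homogeneousSubmodule (Fin 2) k d) (m : ℕ) (x : MvPolynomial (Fin 2) k)
    (hx : x ∈ MvPolynomial.homogeneousSubmodule (Fin 2) k (m • d)) :
    evalAway s f h (HomogeneousLocalization.Away.mk _ hf m x hx) * MvPolynomial.aeval s f ^ m =
      MvPolynomial.aeval s x := by
  simp only [evalAway, RingHom.comp_apply, HomogeneousLocalization.algebraMap_apply,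
    HomogeneousLocalization.Away.val_mk, Localization.awayLift]
  have h2 := congrArg (IsLocalization.Away.lift (S := Localization.Away f) f
    (g := (MvPolynomial.aeval s).toRingHom) h)
    (IsLocalization.mk'_spec (Localization.Away f) x (⟨f ^ m, m, rfl⟩ : Submonoid.powers f))
  rw [map_mul, IsLocalization.Away.lift_eq, IsLocalization.Away.lift_eq] at h2
  rw [Localization.mk_eq_mk']
  simpa using h2

lemma evalAway_comp_awayMap (s : Fin 2 → S) {f g x : MvPolynomial (Fin 2) k} {d d' : ℕ}
    (hf : f ∈ MvPolynomial.homogeneousSubmodule (Fin 2) k d)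
    (hg : g ∈ MvPolynomial.homogeneousSubmodule (Fin 2) k d') (hx : x = f * g)
    (h : IsUnit (MvPolynomial.aeval s f)) (h' : IsUnit (MvPolynomial.aeval s x)) :
    (evalAway s x h').comp (HomogeneousLocalization.awayMap _ hg hx) = evalAway s f h := by
  ext y
  obtain ⟨m, y, hy, rfl⟩ := HomogeneousLocalization.Away.mk_surjective _ hf y
  have h3 : IsUnit (MvPolynomial.aeval s g) := by
    subst hx; rw [map_mul] at h'; exact isUnit_of_mul_isUnit_right h'
  have h4 := evalAway_mul_pow s x h' (hx ▸ SetLike.mul_mem_graded hf hg) m (y * g ^ m)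
    (by rw [smul_add]; exact SetLike.mul_mem_graded hy (SetLike.pow_mem_graded _ hg))
  rw [RingHom.comp_apply, HomogeneousLocalization.awayMap_mk]
  apply (h.pow m).mul_left_injective
  apply (h3.pow m).mul_left_injective
  dsimp only
  have h5 : MvPolynomial.aeval s x = MvPolynomial.aeval s f * MvPolynomial.aeval s g := by
    rw [hx, map_mul]
  rw [evalAway_mul_pow, ← map_pow _ g, ← map_mul, ← h4, h5, mul_pow]
  simp only [map_pow, mul_assoc]

/-- The open immersion of the complement of the zeros of a form `f` of positive degree. -/
def away (f : MvPolynomial (Fin 2) k) {d : ℕ}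
    (hf : f ∈ MvPolynomial.homogeneousSubmodule (Fin 2) k d) (hd : 0 < d) :
    Spec (.of (HomogeneousLocalization.Away (MvPolynomial.homogeneousSubmodule (Fin 2) k) f)) ⟶
      projLine k :=
  Proj.awayι (MvPolynomial.homogeneousSubmodule (Fin 2) k) f hf hd

instance (f : MvPolynomial (Fin 2) k) {d : ℕ}
    (hf : f ∈ MvPolynomial.homogeneousSubmodule (Fin 2) k d) (hd : 0 < d) :
    IsOpenImmersion (away f hf hd) :=
  inferInstanceAs (IsOpenImmersion (Proj.awayι _ f hf hd))

lemma map_away {f g x : MvPolynomial (Fin 2) k} {d d' : ℕ}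
    (hf : f ∈ MvPolynomial.homogeneousSubmodule (Fin 2) k d) (hd : 0 < d)
    (hg : g ∈ MvPolynomial.homogeneousSubmodule (Fin 2) k d') (hx : x = f * g)
    (hx' : x ∈ MvPolynomial.homogeneousSubmodule (Fin 2) k (d + d')) (hd' : 0 < d + d') :
    Spec.map (CommRingCat.ofHom (HomogeneousLocalization.awayMap _ hg hx)) ≫ away f hf hd =
      away x hx' hd' :=
  Proj.SpecMap_awayMap_awayι _ hf hd hg hx

lemma away_structure {f : MvPolynomial (Fin 2) k} {d : ℕ}
    (hf : f ∈ MvPolynomial.homogeneousSubmodule (Fin 2) k d) (hd : 0 < d) :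
    away f hf hd ≫ projLineStructure k =
      Spec.map (CommRingCat.ofHom ((HomogeneousLocalization.fromZeroRingHom _ _).comp
        (algebraMap k (MvPolynomial.homogeneousSubmodule (Fin 2) k 0)))) := by
  rw [CommRingCat.ofHom_comp, Spec.map_comp]
  exact Proj.awayι_toSpecZero_assoc (MvPolynomial.homogeneousSubmodule (Fin 2) k) f hf hd _

lemma exists_away_X_eq (y : projLine k) :
    ∃ i, y ∈ Set.range (away (MvPolynomial.X (R := k) i) (X_mem i)
      one_pos) := by
  have h := Proj.iSup_basicOpen_eq_top' (MvPolynomial.homogeneousSubmodule (Fin 2) k)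
    (fun i : Fin 2 => MvPolynomial.X i) (fun i => ⟨1, X_mem i⟩) (by
      rw [eq_top_iff]
      rintro x -
      induction x using MvPolynomial.induction_on with
      | C a => exact Subalgebra.algebraMap_mem _ (⟨_, MvPolynomial.isHomogeneous_C _ a⟩ :
          MvPolynomial.homogeneousSubmodule (Fin 2) k 0)
      | add p q hp hq => exact add_mem hp hq
      | mul_X p i hp => exact mul_mem hp (Algebra.subset_adjoin ⟨i, rfl⟩))
  obtain ⟨i, hi⟩ := Opens.mem_iSup.mp (h.ge (Set.mem_univ y))
  refine ⟨i, ?_⟩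
  rw [← Proj.opensRange_awayι _ _ (X_mem i) one_pos] at hi
  exact hi

/-- The point of the projective line with homogeneous coordinates `s`, at which the form `f` of
positive degree is invertible. -/
def point (s : Fin 2 → S) {f : MvPolynomial (Fin 2) k} {d : ℕ}
    (hf : f ∈ MvPolynomial.homogeneousSubmodule (Fin 2) k d) (hd : 0 < d)
    (h : IsUnit (MvPolynomial.aeval s f)) : Spec (.of S) ⟶ projLine k :=
  Spec.map (CommRingCat.ofHom (evalAway s f h)) ≫ away f hf hd

lemma point_mul (s : Fin 2 → S) {f g x : MvPolynomial (Fin 2) k} {d d' : ℕ}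
    (hf : f ∈ MvPolynomial.homogeneousSubmodule (Fin 2) k d) (hd : 0 < d)
    (hg : g ∈ MvPolynomial.homogeneousSubmodule (Fin 2) k d') (hx : x = f * g)
    (hx' : x ∈ MvPolynomial.homogeneousSubmodule (Fin 2) k (d + d')) (hd' : 0 < d + d')
    (h : IsUnit (MvPolynomial.aeval s f)) (h' : IsUnit (MvPolynomial.aeval s x)) :
    point s hf hd h = point s hx' hd' h' := by
  rw [point, point, ← map_away hf hd hg hx, ← Category.assoc,
    ← Spec.map_comp, ← CommRingCat.ofHom_comp, evalAway_comp_awayMap s hf hg hx h h']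

lemma map_point {S' : Type u} [CommRing S'] [Algebra k S'] (φ : S →ₐ[k] S') (s : Fin 2 → S)
    {f : MvPolynomial (Fin 2) k} {d : ℕ}
    (hf : f ∈ MvPolynomial.homogeneousSubmodule (Fin 2) k d) (hd : 0 < d)
    (h : IsUnit (MvPolynomial.aeval s f)) (h' : IsUnit (MvPolynomial.aeval (φ ∘ s) f)) :
    Spec.map (CommRingCat.ofHom φ.toRingHom) ≫ point s hf hd h = point (φ ∘ s) hf hd h' := by
  rw [point, point, ← Category.assoc, ← Spec.map_comp, ← CommRingCat.ofHom_comp]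
  congr 3
  ext y
  obtain ⟨m, y, hy, rfl⟩ := HomogeneousLocalization.Away.mk_surjective _ hf y
  have h2 (z : MvPolynomial (Fin 2) k) :
      MvPolynomial.aeval (φ ∘ s) z = φ (MvPolynomial.aeval s z) :=
    (MvPolynomial.comp_aeval_apply s φ z).symm
  apply (h'.pow m).mul_left_injective
  dsimp only
  rw [evalAway_mul_pow, h2, h2, ← map_pow, RingHom.comp_apply]
  change φ _ * φ _ = _
  rw [← map_mul, evalAway_mul_pow]

lemma evalAway_fromZeroRingHom (s : Fin 2 → S) (f : MvPolynomial (Fin 2) k)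
    (h : IsUnit (MvPolynomial.aeval s f)) (r : k) :
    evalAway s f h (HomogeneousLocalization.fromZeroRingHom _ _
      (algebraMap k (MvPolynomial.homogeneousSubmodule (Fin 2) k 0) r)) = algebraMap k S r := by
  have h1 : algebraMap (HomogeneousLocalization.Away (MvPolynomial.homogeneousSubmodule (Fin 2) k) f)
      (Localization.Away f) (HomogeneousLocalization.fromZeroRingHom _ _
        (algebraMap k (MvPolynomial.homogeneousSubmodule (Fin 2) k 0) r)) =
      algebraMap (MvPolynomial (Fin 2) k) _ (MvPolynomial.C r) := by
    rw [← HomogeneousLocalization.algebraMap_eq, ← IsScalarTower.algebraMap_apply]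
    rfl
  rw [evalAway, RingHom.comp_apply, h1, Localization.awayLift, IsLocalization.Away.lift_eq]
  exact MvPolynomial.aeval_C _ _

lemma point_structure (s : Fin 2 → S) {f : MvPolynomial (Fin 2) k} {d : ℕ}
    (hf : f ∈ MvPolynomial.homogeneousSubmodule (Fin 2) k d) (hd : 0 < d)
    (h : IsUnit (MvPolynomial.aeval s f)) :
    point s hf hd h ≫ projLineStructure k = Spec.map (CommRingCat.ofHom (algebraMap k S)) := by
  rw [point, Category.assoc, away_structure, ← Spec.map_comp, ← CommRingCat.ofHom_comp]
  congr 2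
  ext r
  exact evalAway_fromZeroRingHom s f h r

lemma aeval_mul_of_isHomogeneous {m : ℕ} {x : MvPolynomial (Fin 2) k} (hx : x.IsHomogeneous m)
    (s : Fin 2 → S) (c : S) :
    MvPolynomial.aeval (fun i => c * s i) x = c ^ m * MvPolynomial.aeval s x := by
  rw [MvPolynomial.aeval_def, MvPolynomial.eval₂_eq, MvPolynomial.aeval_def, MvPolynomial.eval₂_eq,
    Finset.mul_sum]
  refine Finset.sum_congr rfl fun d hd => ?_
  have h1 : ∑ i ∈ d.support, d i = m := by
    rw [← hx (MvPolynomial.mem_support_iff.mp hd)]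
    simp [Finsupp.weight_apply, Finsupp.sum]
  simp only [mul_pow, Finset.prod_mul_distrib, Finset.prod_pow_eq_pow_sum]
  rw [h1]
  ring

lemma point_smul (s s' : Fin 2 → S) (c : S) (hs : ∀ i, s' i = c * s i)
    {f : MvPolynomial (Fin 2) k} {d : ℕ}
    (hf : f ∈ MvPolynomial.homogeneousSubmodule (Fin 2) k d) (hd : 0 < d)
    (h : IsUnit (MvPolynomial.aeval s f)) (h' : IsUnit (MvPolynomial.aeval s' f)) :
    point s' hf hd h' = point s hf hd h := by
  obtain rfl : s' = fun i => c * s i := funext hs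
  rw [point, point]
  congr 3
  ext y
  obtain ⟨m, y, hy, rfl⟩ := HomogeneousLocalization.Away.mk_surjective _ hf y
  apply (h'.pow m).mul_left_injective
  dsimp only
  rw [evalAway_mul_pow, aeval_mul_of_isHomogeneous hy, aeval_mul_of_isHomogeneous hf, mul_pow,
    mul_left_comm, evalAway_mul_pow, ← pow_mul, smul_eq_mul, mul_comm m d]

/-- Homogeneous coordinates of the point with coordinate `z` in the `i`-th standard affine chart. -/
def coord (i : Fin 2) (z : S) : Fin 2 → S := fun j => if j = i then 1 else z

variable (k) in
lemma isUnit_aeval_coord (i : Fin 2) (z : S) :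
    IsUnit (MvPolynomial.aeval (R := k) (coord i z) (MvPolynomial.X i)) := by
  simp [coord]

variable (k) in
/-- The point of the projective line with coordinate `z` in the `i`-th standard affine chart. -/
def affinePoint (i : Fin 2) (z : S) : Spec (.of S) ⟶ projLine k :=
  point (coord i z) (X_mem i) one_pos (isUnit_aeval_coord k i z)

lemma map_affinePoint {S' : Type u} [CommRing S'] [Algebra k S'] (φ : S →ₐ[k] S') (i : Fin 2)
    (z : S) : Spec.map (CommRingCat.ofHom φ.toRingHom) ≫ affinePoint k i z =
      affinePoint k i (φ z) := by
  have h : φ ∘ coord i z = coord i (φ z) := by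
    ext j; simp only [coord, Function.comp]; split_ifs <;> simp
  rw [affinePoint, map_point φ _ _ _ _ (h ▸ isUnit_aeval_coord k i _)]
  simp only [h]
  rfl

lemma affinePoint_structure (i : Fin 2) (z : S) :
    affinePoint k i z ≫ projLineStructure k = Spec.map (CommRingCat.ofHom (algebraMap k S)) :=
  point_structure _ _ _ _

lemma affinePoint_eq_of_mul_eq_one {i j : Fin 2} (hij : i ≠ j) {z z' : S} (h : z * z' = 1) :
    affinePoint k i z = affinePoint k j z' := by
  have hz : IsUnit z := .of_mul_eq_one _ h
  have hz' : IsUnit z' := .of_mul_eq_one _ (mul_comm z z' ▸ h)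
  have hh : (MvPolynomial.X i * MvPolynomial.X j : MvPolynomial (Fin 2) k) ∈
      MvPolynomial.homogeneousSubmodule (Fin 2) k (1 + 1) :=
    SetLike.mul_mem_graded (X_mem i) (X_mem j)
  have h1 : IsUnit (MvPolynomial.aeval (R := k) (coord i z) (MvPolynomial.X i * MvPolynomial.X j)) := by
    simpa [coord, hij.symm] using hz
  have h2 : IsUnit (MvPolynomial.aeval (R := k) (coord j z') (MvPolynomial.X i * MvPolynomial.X j)) := by
    simpa [coord, hij] using hz'
  rw [affinePoint, affinePoint, point_mul _ _ _ (X_mem j) rfl hh two_pos _ h1,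
    point_mul _ _ _ (X_mem i) (mul_comm _ _) hh two_pos _ h2]
  refine point_smul _ _ z (fun l => ?_) _ _ _ _
  by_cases hl : l = i
  · subst hl; simp [coord, hij, h]
  · have : l = j := by omega
    subst this; simp [coord, hij.symm]

lemma evalAway_coord_bijective (i : Fin 2) :
    Function.Bijective (evalAway (k := k) (coord i (Polynomial.X : Polynomial k))
      (MvPolynomial.X i) (isUnit_aeval_coord k i _)) := by
  constructor
  · rw [injective_iff_map_eq_zero]
    intro y hy
    obtain ⟨m, x, hx, rfl⟩ := HomogeneousLocalization.Away.mk_surjective _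
      (X_mem i) y
    have h1 := evalAway_mul_pow (coord i (Polynomial.X : Polynomial k)) (MvPolynomial.X i)
      (isUnit_aeval_coord k i _) (X_mem i) m x hx
    rw [hy, zero_mul] at h1
    let Q := FractionRing (MvPolynomial (Fin 2) k)
    let v : Fin 2 → Q := fun j => algebraMap (MvPolynomial (Fin 2) k) Q (MvPolynomial.X j)
    have hv (j) : v j ≠ 0 := by
      simp only [v, ne_eq, FaithfulSMul.algebraMap_eq_zero_iff]
      exact MvPolynomial.X_ne_zero j
    let φ : Polynomial k →ₐ[k] Q := Polynomial.aeval (v (1 - i) / v i)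
    have h2 := MvPolynomial.comp_aeval_apply (coord i (Polynomial.X : Polynomial k)) φ x
    rw [← h1, map_zero] at h2
    have h3 := aeval_mul_of_isHomogeneous hx
      (fun j => φ (coord i (Polynomial.X : Polynomial k) j)) (v i)
    have h4 : (fun j => v i * φ (coord i (Polynomial.X : Polynomial k) j)) = v := by
      ext j
      by_cases hj : j = i
      · subst hj; simp [coord]
      · obtain rfl : j = 1 - i := by omega
        simp only [coord, hj, if_false, φ, Polynomial.aeval_X]
        exact mul_div_cancel₀ _ (hv i)
    rw [h4, ← h2, mul_zero] at h3
    have h5 : MvPolynomial.aeval v x = algebraMap (MvPolynomial (Fin 2) k) Q x := by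
      exact (MvPolynomial.aeval_algebraMap_apply Q MvPolynomial.X x).trans (by simp)
    rw [h5, FaithfulSMul.algebraMap_eq_zero_iff] at h3
    apply HomogeneousLocalization.val_injective
    rw [HomogeneousLocalization.Away.val_mk, h3, Localization.mk_zero,
      HomogeneousLocalization.val_zero]
  · intro p
    have hX : ∃ y, evalAway (k := k) (coord i (Polynomial.X : Polynomial k))
      (MvPolynomial.X i) (isUnit_aeval_coord k i _) y = Polynomial.X := by
      refine ⟨HomogeneousLocalization.Away.mk _ (X_mem i) 1
        (MvPolynomial.X (1 - i)) (X_mem _), ?_⟩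
      have h1 := evalAway_mul_pow (coord i (Polynomial.X : Polynomial k)) (MvPolynomial.X i)
        (isUnit_aeval_coord k i _) (X_mem i) 1 (MvPolynomial.X (1 - i))
        (X_mem _)
      have h2 : 1 - i ≠ i := by omega
      simpa [coord, h2] using h1
    have hC (r : k) : ∃ y, evalAway (k := k) (coord i (Polynomial.X : Polynomial k))
      (MvPolynomial.X i) (isUnit_aeval_coord k i _) y = Polynomial.C r :=
      ⟨_, evalAway_fromZeroRingHom _ _ _ r⟩
    induction p using Polynomial.induction_on with
    | C a => exact hC a
    | add p q hp hq =>
      obtain ⟨y, hy⟩ := hp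
      obtain ⟨z, hz⟩ := hq
      exact ⟨y + z, by rw [map_add, hy, hz]⟩
    | monomial n a h =>
      obtain ⟨y, hy⟩ := h
      obtain ⟨z, hz⟩ := hX
      exact ⟨y * z, by rw [map_mul, hy, hz, pow_succ, mul_assoc]⟩

instance isIso_evalAway_coord (i : Fin 2) :
    IsIso (CommRingCat.ofHom (evalAway (k := k) (coord i (Polynomial.X : Polynomial k))
      (MvPolynomial.X i) (isUnit_aeval_coord k i _))) :=
  (RingEquiv.ofBijective _ (evalAway_coord_bijective i)).toCommRingCatIso.isIso_hom

instance isOpenImmersion_affinePoint_X (i : Fin 2) :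
    IsOpenImmersion (affinePoint k i (Polynomial.X : Polynomial k)) := by
  unfold affinePoint point
  infer_instance

lemma exists_affinePoint_X_eq (y : projLine k) :
    ∃ i, y ∈ Set.range (affinePoint k i (Polynomial.X : Polynomial k)) := by
  obtain ⟨i, x, hx⟩ := exists_away_X_eq y
  refine ⟨i, (inv (Spec.map (CommRingCat.ofHom (evalAway (k := k)
    (coord i (Polynomial.X : Polynomial k)) (MvPolynomial.X i)
      (isUnit_aeval_coord k i _))))) x, ?_⟩
  rw [← hx, affinePoint, point, ← Scheme.Hom.comp_apply, IsIso.inv_hom_id_assoc]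

end ProjLine

/-! ### The projective line over an affine base -/

namespace ProjLine

variable (k : Type u) [Field k] (A : Type u) [CommRing A] [Algebra k A]

/-- The structure morphism of the spectrum of a `k`-algebra. -/
abbrev specStr : Spec (.of A) ⟶ Spec (.of k) := Spec.map (CommRingCat.ofHom (algebraMap k A))

section

variable {S : Type u} [CommRing S] [Algebra k S] [Algebra A S] [IsScalarTower k A S]

/-- The point of the projective line over `A` with coordinate `z` in the `i`-th standard chart. -/
def relPoint (i : Fin 2) (z : S) : Spec (.of S) ⟶ pullback (specStr k A) (projLineStructure k) :=
  pullback.lift (Spec.map (CommRingCat.ofHom (algebraMap A S))) (affinePoint k i z) (by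
    rw [affinePoint_structure, ← Spec.map_comp, ← CommRingCat.ofHom_comp,
      ← IsScalarTower.algebraMap_eq])

lemma relPoint_fst (i : Fin 2) (z : S) :
    relPoint k A i z ≫ pullback.fst (specStr k A) (projLineStructure k) =
      Spec.map (CommRingCat.ofHom (algebraMap A S)) :=
  pullback.lift_fst _ _ _

lemma relPoint_snd (i : Fin 2) (z : S) :
    relPoint k A i z ≫ pullback.snd (specStr k A) (projLineStructure k) = affinePoint k i z :=
  pullback.lift_snd _ _ _

lemma map_relPoint {S' : Type u} [CommRing S'] [Algebra k S'] [Algebra A S'] [IsScalarTower k A S']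
    (φ : S →ₐ[A] S') (i : Fin 2) (z : S) :
    Spec.map (CommRingCat.ofHom φ.toRingHom) ≫ relPoint k A i z = relPoint k A i (φ z) := by
  apply pullback.hom_ext
  · rw [Category.assoc, relPoint_fst, relPoint_fst, ← Spec.map_comp, ← CommRingCat.ofHom_comp]
    congr 2
    exact φ.comp_algebraMap
  · rw [Category.assoc, relPoint_snd, relPoint_snd]
    exact map_affinePoint (φ.restrictScalars k) i z

lemma relPoint_eq_of_mul_eq_one {i j : Fin 2} (hij : i ≠ j) {z z' : S} (h : z * z' = 1) :
    relPoint k A i z = relPoint k A j z' := by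
  apply pullback.hom_ext
  · rw [relPoint_fst, relPoint_fst]
  · rw [relPoint_snd, relPoint_snd, affinePoint_eq_of_mul_eq_one hij h]

end

/-- The `i`-th standard chart of the projective line over `A`. -/
abbrev line (i : Fin 2) : Spec (.of (Polynomial A)) ⟶
    pullback (specStr k A) (projLineStructure k) := relPoint k A i (Polynomial.X : Polynomial A)

lemma isPullback_line (i : Fin 2) :
    IsPullback (Spec.map (CommRingCat.ofHom (Polynomial.mapRingHom (algebraMap k A))))
      (line k A i) (affinePoint k i (Polynomial.X : Polynomial k))
      (pullback.snd (specStr k A) (projLineStructure k)) := by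
  let := (Polynomial.mapRingHom (algebraMap k A)).toAlgebra
  have : IsScalarTower k (Polynomial k) (Polynomial A) :=
    .of_algebraMap_eq fun r => by
      rw [RingHom.algebraMap_toAlgebra]; simp [Polynomial.algebraMap_apply]
  have : Algebra.IsPushout k A (Polynomial k) (Polynomial A) := by
    infer_instance
  have h1 := IsPullback.of_hasPullback (specStr k A) (projLineStructure k)
  have h2 := isPullback_SpecMap_of_isPushout _ _ _ _
    (CommRingCat.isPushout_of_isPushout k A (Polynomial k) (Polynomial A))
  refine IsPullback.of_bot (h₃₁ := specStr k A) (v₂₂ := projLineStructure k) ?_ ?_ h1.flip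
  · rw [relPoint_fst, affinePoint_structure]
    exact h2.flip
  · rw [relPoint_snd]
    exact (map_affinePoint (Polynomial.mapAlgHom (Algebra.ofId k A)) i Polynomial.X).trans
      (by simp)

instance isOpenImmersion_line (i : Fin 2) : IsOpenImmersion (line k A i) :=
  MorphismProperty.of_isPullback (isPullback_line k A i) inferInstance

lemma exists_line_eq (y : ↥(pullback (specStr k A) (projLineStructure k))) :
    ∃ i, y ∈ Set.range (line k A i) := by
  obtain ⟨i, hi⟩ := exists_affinePoint_X_eq
    (pullback.snd (specStr k A) (projLineStructure k) y)
  refine ⟨i, ?_⟩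
  have h1 : y ∈ Set.range (pullback.snd (affinePoint k i (Polynomial.X : Polynomial k))
      (pullback.snd (specStr k A) (projLineStructure k))) := by
    rw [Scheme.Pullback.range_snd]
    exact hi
  obtain ⟨x, rfl⟩ := h1
  refine ⟨(isPullback_line k A i).isoPullback.inv x, ?_⟩
  rw [← Scheme.Hom.comp_apply, IsPullback.isoPullback_inv_snd]

/-- The open subscheme of the `i`-th standard chart on which `f` is invertible. -/
def lineAway (i : Fin 2) (f : Polynomial A) : Spec (.of (Localization.Away f)) ⟶
    pullback (specStr k A) (projLineStructure k) :=
  relPoint k A i (algebraMap (Polynomial A) (Localization.Away f) Polynomial.X)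

lemma lineAway_eq (i : Fin 2) (f : Polynomial A) :
    lineAway k A i f =
      Spec.map (CommRingCat.ofHom (algebraMap (Polynomial A) (Localization.Away f))) ≫
        line k A i :=
  (map_relPoint k A (IsScalarTower.toAlgHom A (Polynomial A) (Localization.Away f)) i
    Polynomial.X).symm

instance isOpenImmersion_lineAway (i : Fin 2) (f : Polynomial A) :
    IsOpenImmersion (lineAway k A i f) := by
  rw [lineAway_eq]
  have : IsOpenImmersion (Spec.map (CommRingCat.ofHom
    (algebraMap (Polynomial A) (Localization.Away f)))) := IsOpenImmersion.of_isLocalization f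
  infer_instance

lemma line_mem_range_lineAway {i : Fin 2} {f : Polynomial A} {p : Spec (.of (Polynomial A))}
    (hp : f ∉ p.asIdeal) : line k A i p ∈ Set.range (lineAway k A i f) := by
  have h1 : p ∈ Set.range (Spec.map (CommRingCat.ofHom
      (algebraMap (Polynomial A) (Localization.Away f)))) := by
    have h2 := PrimeSpectrum.localization_away_comap_range (Localization.Away f) f
    exact h2.ge hp
  obtain ⟨q, rfl⟩ := h1
  exact ⟨q, by rw [lineAway_eq]; rfl⟩

lemma line_mem_range_line {i j : Fin 2} (hij : i ≠ j) {p : Spec (.of (Polynomial A))}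
    (hp : Polynomial.X ∉ p.asIdeal) : line k A i p ∈ Set.range (line k A j) := by
  obtain ⟨q, hq⟩ := line_mem_range_lineAway k A (i := i) hp
  let u : (Localization.Away (Polynomial.X : Polynomial A)) :=
    IsLocalization.Away.invSelf (Polynomial.X : Polynomial A)
  have hu : algebraMap (Polynomial A) (Localization.Away (Polynomial.X : Polynomial A))
      Polynomial.X * u = 1 := IsLocalization.Away.mul_invSelf (Polynomial.X : Polynomial A)
  have h1 := map_relPoint k A (Polynomial.aeval u) j (Polynomial.X : Polynomial A)
  rw [Polynomial.aeval_X, ← relPoint_eq_of_mul_eq_one k A hij hu] at h1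
  exact ⟨_, (congrArg (fun φ => φ q) h1).trans hq⟩

lemma dense_range_line [IsDomain A] (i : Fin 2) : DenseRange (line k A i) := by
  intro y
  rw [mem_closure_iff]
  intro U hU hy
  obtain ⟨j, p, rfl⟩ := exists_line_eq k A y
  by_cases hij : i = j
  · subst hij; exact ⟨_, hy, p, rfl⟩
  have hd : Dense (PrimeSpectrum.basicOpen (Polynomial.X : Polynomial A) :
      Set (PrimeSpectrum (Polynomial A))) := by
    refine IsOpen.dense (PrimeSpectrum.basicOpen (Polynomial.X : Polynomial A)).2 ?_
    refine ⟨⊥, ?_⟩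
    exact Polynomial.X_ne_zero
  obtain ⟨q, hq, hq'⟩ := hd.inter_open_nonempty _ (hU.preimage (line k A j).continuous) ⟨p, hy⟩
  exact ⟨_, hq, line_mem_range_line k A (Ne.symm hij) hq'⟩

end ProjLine

/-! ### Gluing morphisms to the toric variety -/

namespace SmoothFan

variable {N : Type} [AddCommGroup N] (F : SmoothFan N) (k : Type u) [Field k]

/-- Morphisms from affine charts of a scheme to charts of the toric variety glue if they agree at a
generic point, and if the overlaps of different charts are mapped to the torus. -/
lemma exists_glue {Y : Scheme.{u}} {J : Type} (B : J → Type u) [∀ j, CommRing (B j)]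
    [∀ j, IsDomain (B j)] (V : ∀ j, Spec (.of (B j)) ⟶ Y) [∀ j, IsOpenImmersion (V j)]
    (hV : ∀ y, ∃ j, y ∈ Set.range (V j)) (σ : J → F.Cone)
    (g : ∀ j, ChartRing k (σ j).1 →+* B j) {L : Type u} [CommRing L] (ξ : Spec (.of L) ⟶ Y)
    (e : ∀ j, B j →+* L) (he : ∀ j, Function.Injective (e j))
    (hξ : ∀ j, Spec.map (CommRingCat.ofHom (e j)) ≫ V j = ξ)
    (G : ChartRing k F.zeroCone.1 →+* L)
    (hG : ∀ j, (e j).comp (g j) = G.comp (chartMap k (F.zeroCone_le (σ j))))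
    (hT : ∀ j j', j ≠ j' → ∀ p, V j p ∈ Set.range (V j') →
      Spec.map (CommRingCat.ofHom (g j)) p ∈
        Set.range (Spec.map (CommRingCat.ofHom (chartMap k (F.zeroCone_le (σ j)))))) :
    ∃ ev : Y ⟶ F.toricVariety k,
      ∀ j, V j ≫ ev = Spec.map (CommRingCat.ofHom (g j)) ≫ F.chartι k (σ j) := by
  let f : ∀ j, Spec (.of (B j)) ⟶ F.toricVariety k :=
    fun j => Spec.map (CommRingCat.ofHom (g j)) ≫ F.chartι k (σ j)
  have hξf (j) : Spec.map (CommRingCat.ofHom (e j)) ≫ f j =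
      Spec.map (CommRingCat.ofHom G) ≫ F.chartι k F.zeroCone := by
    dsimp only [f]
    rw [← Category.assoc, ← Spec.map_comp, ← CommRingCat.ofHom_comp, hG, CommRingCat.ofHom_comp,
      Spec.map_comp, Category.assoc, F.chart_map_chartι]
  have hTf (j j') (h : j ≠ j') (p) (hp : V j p ∈ Set.range (V j')) :
      f j p ∈ Set.range (F.chartι k F.zeroCone) := by
    obtain ⟨q, hq⟩ := hT j j' h p hp
    refine ⟨q, ?_⟩
    rw [← F.chart_map_chartι k (F.zeroCone_le (σ j)), Scheme.Hom.comp_apply, hq]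
    rfl
  suffices H : ∀ j j' : J, pullback.fst (V j) (V j') ≫ f j = pullback.snd (V j) (V j') ≫ f j' by
    let 𝒰 : Y.OpenCover := Scheme.Cover.mkOfCovers J (fun j => Spec (.of (B j))) V hV
    exact ⟨𝒰.glueMorphisms f H, fun j => 𝒰.ι_glueMorphisms f H j⟩
  intro j j'
  by_cases hjj : j = j'
  · subst hjj
    congr 1
    rw [← cancel_mono (V j), pullback.condition]
  have h1 : Set.range (pullback.fst (V j) (V j') ≫ f j) ⊆ Set.range (F.chartι k F.zeroCone) := by
    rintro - ⟨x, rfl⟩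
    refine hTf j j' hjj _ ⟨pullback.snd (V j) (V j') x, ?_⟩
    rw [← Scheme.Hom.comp_apply, ← pullback.condition]; rfl
  have h2 : Set.range (pullback.snd (V j) (V j') ≫ f j') ⊆ Set.range (F.chartι k F.zeroCone) := by
    rintro - ⟨x, rfl⟩
    refine hTf j' j (Ne.symm hjj) _ ⟨pullback.fst (V j) (V j') x, ?_⟩
    rw [← Scheme.Hom.comp_apply, pullback.condition]; rfl
  rw [← IsOpenImmersion.lift_fac (F.chartι k F.zeroCone) _ h1,
    ← IsOpenImmersion.lift_fac (F.chartι k F.zeroCone) _ h2]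
  congr 1
  let δ : Spec (.of L) ⟶ pullback (V j) (V j') :=
    pullback.lift (Spec.map (CommRingCat.ofHom (e j))) (Spec.map (CommRingCat.ofHom (e j')))
      (by rw [hξ, hξ])
  have hδ : IsDominant δ := by
    have h3 : IsDominant (δ ≫ pullback.fst (V j) (V j')) := by
      rw [pullback.lift_fst]
      refine ⟨(PrimeSpectrum.denseRange_comap_iff_ker_le_nilRadical _).2
        (((RingHom.injective_iff_ker_eq_bot _).1 (he j)).le.trans bot_le)⟩
    exact IsDominant.of_comp_of_isOpenImmersion δ (pullback.fst (V j) (V j'))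
  have : IsReduced (pullback (V j) (V j')) :=
    isReduced_of_isOpenImmersion (pullback.fst (V j) (V j'))
  refine ext_of_isDominant δ ?_
  rw [← cancel_mono (F.chartι k F.zeroCone)]
  simp only [Category.assoc, IsOpenImmersion.lift_fac]
  rw [pullback.lift_fst_assoc, pullback.lift_snd_assoc, hξf, hξf]

end SmoothFan

/-! ### Sections of the projective line -/

namespace ProjLine

section

attribute [local instance] MvPolynomial.gradedAlgebra

variable {k : Type u} [Field k]

lemma range_affinePoint_X (i : Fin 2) :
    Set.range (affinePoint k i (Polynomial.X : Polynomial k)) =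
      Set.range (away (MvPolynomial.X (R := k) i) (X_mem i) one_pos) := by
  rw [affinePoint, point, Scheme.Hom.comp_base, TopCat.coe_comp,
    Set.range_comp, Set.range_eq_univ.2, Set.image_univ]
  exact (inferInstance : Surjective (Spec.map (CommRingCat.ofHom (evalAway (k := k)
    (coord i (Polynomial.X : Polynomial k)) (MvPolynomial.X i)
      (isUnit_aeval_coord k i _))))).surj

lemma X_notMem_of_affinePoint_mem {i j : Fin 2} (hij : i ≠ j) {p : Spec (.of (Polynomial k))}
    (hp : affinePoint k i (Polynomial.X : Polynomial k) p ∈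
      Set.range (affinePoint k j (Polynomial.X : Polynomial k))) :
    Polynomial.X ∉ p.asIdeal := by
  rw [range_affinePoint_X] at hp
  have h1 : Set.range (away (MvPolynomial.X (R := k) j) (X_mem j) one_pos) =
      (Proj.basicOpen (MvPolynomial.homogeneousSubmodule (Fin 2) k) (MvPolynomial.X j)).1 := by
    rw [← Proj.opensRange_awayι _ _ (X_mem j) one_pos]
    rfl
  rw [h1] at hp
  let q := Spec.map (CommRingCat.ofHom (evalAway (k := k)
    (coord i (Polynomial.X : Polynomial k)) (MvPolynomial.X i) (isUnit_aeval_coord k i _))) p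
  have h2 : q ∈ Proj.awayι (MvPolynomial.homogeneousSubmodule (Fin 2) k) (MvPolynomial.X i)
      (X_mem i) one_pos ⁻¹ᵁ Proj.basicOpen _ (MvPolynomial.X j) := hp
  rw [Proj.awayι_preimage_basicOpen _ (X_mem i) one_pos (X_mem j) one_pos] at h2
  intro h3
  apply h2
  change evalAway _ _ _ _ ∈ p.asIdeal
  have h4 := evalAway_mul_pow (coord i (Polynomial.X : Polynomial k)) (MvPolynomial.X i)
    (isUnit_aeval_coord k i _) (X_mem i) 1 (MvPolynomial.X j ^ 1) (by simpa using X_mem j)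
  simp only [MvPolynomial.aeval_X, coord, if_true, mul_one, pow_one, hij.symm, if_false]
    at h4
  have h5 : HomogeneousLocalization.Away.isLocalizationElem (X_mem (k := k) i) (X_mem j) =
      HomogeneousLocalization.Away.mk _ (X_mem i) 1 (MvPolynomial.X j)
        (by simpa using X_mem j) := by
    unfold HomogeneousLocalization.Away.isLocalizationElem
    congr 1
    exact pow_one _
  rw [h5, h4]
  exact h3

instance isSeparated_projLineStructure : IsSeparated (projLineStructure k) := by
  have : IsSeparated (Proj.toSpecZero (MvPolynomial.homogeneousSubmodule (Fin 2) k)) :=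
    Proj.isSeparated _
  have h : IsSeparated (Proj.toSpecZero (MvPolynomial.homogeneousSubmodule (Fin 2) k) ≫
    Spec.map (CommRingCat.ofHom
      (algebraMap k (MvPolynomial.homogeneousSubmodule (Fin 2) k 0)))) := inferInstance
  exact h

end

variable (k : Type u) [Field k] {A : Type u} [CommRing A] [Algebra k A]

lemma X_notMem_of_line_mem {i j : Fin 2} (hij : i ≠ j) {p : Spec (.of (Polynomial A))}
    (hp : line k A i p ∈ Set.range (line k A j)) : Polynomial.X ∉ p.asIdeal := by
  obtain ⟨q, hq⟩ := hp
  have h (i : Fin 2) (p : Spec (.of (Polynomial A))) :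
      pullback.snd (specStr k A) (projLineStructure k) (line k A i p) =
        affinePoint k i (Polynomial.X : Polynomial k)
          (Spec.map (CommRingCat.ofHom (Polynomial.mapRingHom (algebraMap k A))) p) := by
    rw [← Scheme.Hom.comp_apply, ← (isPullback_line k A i).w, Scheme.Hom.comp_apply]
  have h1 := X_notMem_of_affinePoint_mem hij (p :=
    Spec.map (CommRingCat.ofHom (Polynomial.mapRingHom (algebraMap k A))) p) ⟨_, by
      rw [← h i, ← hq, h j]⟩
  intro h2
  apply h1
  change Polynomial.mapRingHom (algebraMap k A) Polynomial.X ∈ p.asIdeal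
  simpa using h2

lemma relPoint_eq_map_line (i : Fin 2) (a : A) : relPoint k A i a =
    Spec.map (CommRingCat.ofHom (Polynomial.evalRingHom a)) ≫ line k A i := by
  have h := map_relPoint k A (Polynomial.aeval a) i (Polynomial.X : Polynomial A)
  rw [Polynomial.aeval_X] at h
  rw [← h]
  rfl

instance isClosedImmersion_relPoint (i : Fin 2) (a : A) :
    IsClosedImmersion (relPoint k A i a) := by
  have h : IsClosedImmersion (relPoint k A i a ≫
      pullback.fst (specStr k A) (projLineStructure k)) := by
    rw [relPoint_fst, Algebra.algebraMap_self, CommRingCat.ofHom_id, Spec.map_id]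
    infer_instance
  exact IsClosedImmersion.of_comp _ (pullback.fst (specStr k A) (projLineStructure k))

open Scheme.IdealSheafData in
lemma specIdeal_comap_line_ker_relPoint (i : Fin 2) (a : A) :
    specIdeal ((relPoint k A i a).ker.comap (line k A i)) =
      Ideal.span {Polynomial.X - Polynomial.C a} := by
  have h1 : IsPullback (Spec.map (CommRingCat.ofHom (Polynomial.evalRingHom a))) (𝟙 _)
      (line k A i) (relPoint k A i a) := by
    have h2 : Set.range (relPoint k A i a) ⊆ Set.range (line k A i) := by
      rw [relPoint_eq_map_line]
      rintro - ⟨x, rfl⟩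
      exact ⟨_, rfl⟩
    have h3 := IsOpenImmersion.isPullback_lift_id _ (line k A i) h2
    rwa [← IsOpenImmersion.lift_uniq (line k A i) _ h2 _ (relPoint_eq_map_line k i a).symm] at h3
  rw [← ker_fst_of_isClosedImmersion, ← h1.isoPullback_inv_fst, Scheme.Hom.ker_comp_of_isIso,
    specIdeal_ker]
  exact Polynomial.ker_evalRingHom a

lemma line_mem_range_relPoint {i : Fin 2} {a : A} {p : Spec (.of (Polynomial A))}
    (hp : Polynomial.X - Polynomial.C a ∈ p.asIdeal) :
    line k A i p ∈ Set.range (relPoint k A i a) := by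
  have h1 : p ∈ Set.range (Spec.map (CommRingCat.ofHom (Polynomial.evalRingHom a))) := by
    have h2 := range_comap_of_surjective _ (Polynomial.evalRingHom a)
      (fun r => ⟨Polynomial.C r, by simp⟩)
    refine h2.ge ?_
    rw [Polynomial.ker_evalRingHom]
    exact (Ideal.span_singleton_le_iff_mem _).2 hp
  obtain ⟨q, rfl⟩ := h1
  exact ⟨q, by rw [relPoint_eq_map_line]; rfl⟩

lemma sub_mem_of_relPoint_eq {i : Fin 2} {a : A} {w : Spec (.of A)}
    {p : Spec (.of (Polynomial A))} (h : relPoint k A i a w = line k A i p) :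
    Polynomial.X - Polynomial.C a ∈ p.asIdeal := by
  rw [relPoint_eq_map_line] at h
  rw [← (line k A i).isOpenEmbedding.injective h]
  change Polynomial.evalRingHom a _ ∈ w.asIdeal
  simp

lemma one_sub_mem_of_relPoint_eq {i j : Fin 2} (hij : i ≠ j) {a : A} {w : Spec (.of A)}
    {p : Spec (.of (Polynomial A))} (h : relPoint k A i a w = line k A j p) :
    1 - Polynomial.C a * Polynomial.X ∈ p.asIdeal := by
  by_cases ha : a ∈ w.asIdeal
  · exfalso
    rw [relPoint_eq_map_line] at h
    refine X_notMem_of_line_mem k hij ⟨p, h.symm⟩ ?_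
    change Polynomial.evalRingHom a _ ∈ w.asIdeal
    simpa using ha
  · obtain ⟨w', rfl⟩ : w ∈ Set.range (Spec.map (CommRingCat.ofHom
        (algebraMap A (Localization.Away a)))) :=
      (PrimeSpectrum.localization_away_comap_range (Localization.Away a) a).ge ha
    have hu : algebraMap A (Localization.Away a) a * IsLocalization.Away.invSelf a = 1 :=
      IsLocalization.Away.mul_invSelf a
    have h1 := map_relPoint k A (Algebra.ofId A (Localization.Away a)) i a
    rw [relPoint_eq_of_mul_eq_one k A hij (z := Algebra.ofId A (Localization.Away a) a) hu] at h1
    have h2 := map_relPoint k A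
      (Polynomial.aeval (IsLocalization.Away.invSelf a : Localization.Away a)) j
        (Polynomial.X : Polynomial A)
    rw [Polynomial.aeval_X, ← h1] at h2
    have h3 := (congrArg (fun φ => φ w') h2).trans h
    rw [← (line k A j).isOpenEmbedding.injective h3]
    change Polynomial.aeval (IsLocalization.Away.invSelf a : Localization.Away a)
      (1 - Polynomial.C a * Polynomial.X) ∈ w'.asIdeal
    rw [map_sub, map_one, map_mul, Polynomial.aeval_C, Polynomial.aeval_X, hu, sub_self]
    exact zero_mem _

lemma disjoint_range_relPoint (i : Fin 2) {a b : A} (h : IsUnit (a - b)) :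
    Disjoint (Set.range (relPoint k A i a)) (Set.range (relPoint k A i b)) := by
  rw [Set.disjoint_left]
  rintro y ⟨w, rfl⟩ ⟨w', hw⟩
  rw [relPoint_eq_map_line k i a] at hw
  have h1 := sub_mem_of_relPoint_eq k hw
  have h2 := sub_mem_of_relPoint_eq k (i := i) (a := a) (w := w)
    (p := Spec.map (CommRingCat.ofHom (Polynomial.evalRingHom a)) w)
    (by rw [relPoint_eq_map_line]; rfl)
  have h3 := sub_mem h1 h2
  rw [sub_sub_sub_cancel_left, ← map_sub] at h3
  exact (PrimeSpectrum.isPrime _).ne_top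
    (Ideal.eq_top_of_isUnit_mem _ h3 (h.map Polynomial.C))

variable {k}

lemma lineAway_apply (i : Fin 2) (f : Polynomial A) (p : Spec (.of (Localization.Away f))) :
    ∃ q : Spec (.of (Polynomial A)), f ∉ q.asIdeal ∧ lineAway k A i f p = line k A i q ∧
      ∀ g, g ∈ q.asIdeal ↔ algebraMap _ (Localization.Away f) g ∈ p.asIdeal := by
  refine ⟨Spec.map (CommRingCat.ofHom (algebraMap (Polynomial A) (Localization.Away f))) p,
    fun h => ?_, by rw [lineAway_eq]; rfl, fun g => Iff.rfl⟩
  exact (PrimeSpectrum.isPrime p).ne_top (Ideal.eq_top_of_isUnit_mem _ h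
    (IsLocalization.Away.algebraMap_isUnit (S := Localization.Away f) f))

open Scheme.IdealSheafData in
lemma specIdeal_comap_lineAway_ker_relPoint (i : Fin 2) (a : A) (f : Polynomial A) :
    specIdeal ((relPoint k A i a).ker.comap (lineAway k A i f)) =
      Ideal.span {algebraMap _ (Localization.Away f) (Polynomial.X - Polynomial.C a)} := by
  rw [lineAway_eq, comap_comp, specIdeal_comap, specIdeal_comap_line_ker_relPoint,
    Ideal.map_span, Set.image_singleton]
  rfl

open Scheme.IdealSheafData in
lemma comap_lineAway_ker_relPoint_eq_top {i j : Fin 2} (hij : i ≠ j) {a : A} {f : Polynomial A}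
    (hf : 1 - Polynomial.C a * Polynomial.X ∣ f) :
    (relPoint k A i a).ker.comap (lineAway k A j f) = ⊤ := by
  rw [← support_eq_bot_iff, support_comap, ← SetLike.coe_set_eq, Closeds.coe_preimage,
    Scheme.Hom.support_ker, (relPoint k A i a).isClosedEmbedding.isClosed_range.closure_eq]
  refine Set.eq_empty_iff_forall_notMem.2 ?_
  rintro p ⟨w, hw⟩
  obtain ⟨q, hq, hpq, -⟩ := lineAway_apply (k := k) j f p
  rw [hpq] at hw
  exact hq (Ideal.mem_of_dvd _ hf (one_sub_mem_of_relPoint_eq k hij hw))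

end ProjLine

/-! ### Log morphisms and products of ideal sheaves -/

lemma AlgebraicGeometry.Scheme.IdealSheafData.mem_support_prod {X : Scheme.{u}} {ι : Type*}
    (s : Finset ι) (I : ι → X.IdealSheafData) (x : X) :
    x ∈ (∏ i ∈ s, I i).support ↔ ∃ i ∈ s, x ∈ (I i).support := by
  classical
  induction s using Finset.induction_on with
  | empty =>
    rw [Finset.prod_empty, one_eq_top, support_top]
    simp
    exact fun h => h
  | insert i s hi ih =>
    rw [Finset.prod_insert hi, support_mul, Finset.exists_mem_insert, ← ih]
    rw [← SetLike.mem_coe, Closeds.coe_sup]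
    rfl

lemma isLogMorphism_of_preimage_subset {Y X : Scheme.{u}} {E : Closeds Y} {D : Closeds X}
    {f : Y ⟶ X} (h : ∀ y, f y ∈ D → y ∈ E) : IsLogMorphism E D f := by
  intro U s hs
  simp only [logSections, Submonoid.mem_comap, IsUnit.mem_submonoid_iff] at hs ⊢
  have hle : f ⁻¹ᵁ U ⊓ E.compl ≤ f ⁻¹ᵁ (U ⊓ D.compl) := fun y hy => ⟨hy.1, fun hD => hy.2 (h y hD)⟩
  have h1 := (hs.map (f.app (U ⊓ D.compl)).hom).map (Y.presheaf.map (homOfLE hle).op).hom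
  convert h1 using 1
  simp only [← CommRingCat.comp_apply]
  congr 2
  rw [Scheme.Hom.naturality, Category.assoc, ← Functor.map_comp]
  rfl

set_option linter.unusedSectionVars false

/-! ### Rational curves in the torus -/

namespace RationalCurve

variable {k : Type u} [Field k] {A : Type u} [CommRing A] [Algebra k A]
  {N : Type} [AddCommGroup N] {n : ℕ} (a : Fin n → A) (v : Fin n → N)
  (θ : Multiplicative (Module.Dual ℤ N) →* Aˣ)
  {L : Type u} [Field L] [Algebra A L] [Algebra k L] [IsScalarTower k A L]

/-- The value at `z` of the rational curve in the torus with vanishing orders `v l` at the points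
`a l`, and with leading coefficient `θ`. -/
def character (z : L) (hz : ∀ l, z - algebraMap A L (a l) ≠ 0) :
    Multiplicative (Module.Dual ℤ N) →* L where
  toFun m := algebraMap A L (θ m) * ∏ l, (z - algebraMap A L (a l)) ^ (m.toAdd (v l))
  map_one' := by simp
  map_mul' m m' := by
    simp only [map_mul, Units.val_mul, toAdd_mul, LinearMap.add_apply]
    rw [Finset.prod_congr rfl fun l _ => zpow_add₀ (hz l) _ _, Finset.prod_mul_distrib]
    ring

variable (k) in
/-- The point of the torus with values in the field `L`, given by the characters. -/
def torusPoint (z : L) (hz : ∀ l, z - algebraMap A L (a l) ≠ 0) :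
    SmoothFan.ChartRing k (∅ : Finset N) →ₐ[k] L :=
  AddMonoidAlgebra.lift k L (SmoothFan.dualMonoid (∅ : Finset N))
    ((character a v θ z hz).comp (AddMonoidHom.toMultiplicative
      (SmoothFan.dualMonoid (∅ : Finset N)).subtype))

lemma torusPoint_single (z : L) (hz : ∀ l, z - algebraMap A L (a l) ≠ 0)
    (m : SmoothFan.dualMonoid (∅ : Finset N)) (r : k) :
    torusPoint k a v θ z hz (AddMonoidAlgebra.single m r) =
      algebraMap k L r * (algebraMap A L (θ (.ofAdd m.1)) *
        ∏ l, (z - algebraMap A L (a l)) ^ (m.1 (v l))) := by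
  rw [torusPoint, AddMonoidAlgebra.lift_single, Algebra.smul_def]
  rfl

lemma torusPoint_chartMap_single (z : L) (hz : ∀ l, z - algebraMap A L (a l) ≠ 0)
    {σ : Finset N} (m : SmoothFan.dualMonoid σ) (r : k) :
    torusPoint k a v θ z hz (SmoothFan.chartMap k (Finset.empty_subset σ)
      (AddMonoidAlgebra.single m r)) =
      algebraMap k L r * (algebraMap A L (θ (.ofAdd m.1)) *
        ∏ l, (z - algebraMap A L (a l)) ^ (m.1 (v l))) := by
  rw [SmoothFan.chartMap_single, torusPoint_single]
  rfl

lemma map_torusPoint {L' : Type u} [Field L'] [Algebra A L'] [Algebra k L'] [IsScalarTower k A L']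
    (φ : L →ₐ[A] L') (z : L) (hz : ∀ l, z - algebraMap A L (a l) ≠ 0)
    (hz' : ∀ l, φ z - algebraMap A L' (a l) ≠ 0) :
    φ.toRingHom.comp (torusPoint k a v θ z hz).toRingHom =
      (torusPoint k a v θ (φ z) hz').toRingHom := by
  refine AddMonoidAlgebra.ringHom_ext (fun r => ?_) (fun m => ?_)
  · change φ (torusPoint k a v θ z hz _) = torusPoint k a v θ (φ z) hz' _
    rw [torusPoint_single, torusPoint_single, map_mul, map_mul, map_prod]
    simp only [map_zpow₀, map_sub, AlgHom.commutes]
    rw [IsScalarTower.algebraMap_apply k A L, AlgHom.commutes, ← IsScalarTower.algebraMap_apply]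
  · change φ (torusPoint k a v θ z hz _) = torusPoint k a v θ (φ z) hz' _
    rw [torusPoint_single, torusPoint_single, map_mul, map_mul, map_prod]
    simp only [map_zpow₀, map_sub, AlgHom.commutes, map_one]

/-! ### Localizations of the affine line in its function field -/

/-- The extension of an embedding to the localization at a non-zero polynomial. -/
def awayEmb (ψ : Polynomial A →ₐ[A] L) (f : Polynomial A) (hf : ψ f ≠ 0) :
    Localization.Away f →ₐ[A] L :=
  IsLocalization.liftAlgHom (M := Submonoid.powers f) (f := ψ) (by
    rintro ⟨-, m, rfl⟩
    simpa using (pow_ne_zero m hf))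

lemma awayEmb_algebraMap (ψ : Polynomial A →ₐ[A] L) (f : Polynomial A) (hf : ψ f ≠ 0)
    (g : Polynomial A) : awayEmb ψ f hf (algebraMap _ _ g) = ψ g := by
  rw [awayEmb, IsLocalization.liftAlgHom_apply, IsLocalization.lift_eq]
  rfl

lemma awayEmb_injective {ψ : Polynomial A →ₐ[A] L} (hψ : Function.Injective ψ) (f : Polynomial A)
    (hf : ψ f ≠ 0) : Function.Injective (awayEmb ψ f hf) := by
  have h : ∀ y : Submonoid.powers f, IsUnit (ψ.toRingHom y) := by
    rintro ⟨-, m, rfl⟩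
    simpa using (pow_ne_zero m hf)
  have h1 : Function.Injective (IsLocalization.lift (S := Localization.Away f) h) := by
    rw [IsLocalization.lift_injective_iff]
    intro x y
    refine ⟨fun hxy => ?_, fun hxy => by rw [hψ hxy]⟩
    have := congrArg (IsLocalization.lift (S := Localization.Away f) h) hxy
    rwa [IsLocalization.lift_eq, IsLocalization.lift_eq] at this
  exact h1

lemma exists_unit_awayEmb_eq (ψ : Polynomial A →ₐ[A] L) (f : Polynomial A) (hf : ψ f ≠ 0)
    {ι : Type*} (s : Finset ι) (g : ι → Polynomial A) (hg : ∀ i ∈ s, g i ∣ f) (e : ι → ℤ) (r : Aˣ) :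
    ∃ u : (Localization.Away f)ˣ, awayEmb ψ f hf u = algebraMap A L r * ∏ i ∈ s, ψ (g i) ^ e i := by
  classical
  induction s using Finset.induction_on with
  | empty =>
    refine ⟨Units.map (algebraMap A (Localization.Away f)).toMonoidHom r, ?_⟩
    rw [Finset.prod_empty, mul_one]
    exact (awayEmb ψ f hf).commutes r
  | insert i s hi ih =>
    obtain ⟨u, hu⟩ := ih fun j hj => hg j (Finset.mem_insert_of_mem hj)
    have h1 : IsUnit (algebraMap (Polynomial A) (Localization.Away f) (g i)) :=
      isUnit_of_dvd_unit (map_dvd _ (hg i (Finset.mem_insert_self i s)))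
        (IsLocalization.Away.algebraMap_isUnit f)
    obtain ⟨w, hw⟩ := h1
    refine ⟨u * w ^ e i, ?_⟩
    have h2 : awayEmb ψ f hf ((w ^ e i : (Localization.Away f)ˣ) : Localization.Away f) =
        ψ (g i) ^ e i := by
      rw [← awayEmb_algebraMap ψ f hf, ← hw]
      have h3 := congrArg Units.val (map_zpow (Units.map (awayEmb ψ f hf : _ →* L)) w (e i))
      rw [Units.val_zpow_eq_zpow_val] at h3
      exact h3
    rw [Units.val_mul, map_mul, hu, h2, Finset.prod_insert hi]
    ring

lemma exists_comp_eq {R B K : Type*} [CommRing R] [CommRing B] [CommRing K] (φ : R →+* K)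
    (e : B →+* K) (he : Function.Injective e) (h : ∀ r, ∃ b, e b = φ r) :
    ∃ g : R →+* B, e.comp g = φ := by
  choose g hg using h
  exact ⟨{
    toFun := g
    map_one' := he (by simp [hg])
    map_mul' := fun x y => he (by simp [hg])
    map_zero' := he (by simp [hg])
    map_add' := fun x y => he (by simp [hg]) }, RingHom.ext hg⟩

lemma exists_chart_hom {σ : Finset N} (z : L) (hz : ∀ l, z - algebraMap A L (a l) ≠ 0)
    {B : Type u} [CommRing B] [Algebra A B] [Algebra k B] [IsScalarTower k A B]
    (e : B →ₐ[A] L) (he : Function.Injective e)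
    (h : ∀ m ∈ SmoothFan.dualMonoid σ, ∃ b, e b =
      algebraMap A L (θ (.ofAdd m)) * ∏ l, (z - algebraMap A L (a l)) ^ (m (v l))) :
    ∃ g : SmoothFan.ChartRing k σ →+* B, e.toRingHom.comp g =
      (torusPoint k a v θ z hz).toRingHom.comp (SmoothFan.chartMap k (Finset.empty_subset σ)) := by
  refine exists_comp_eq _ e.toRingHom he fun r => ?_
  change ∃ b, e b = torusPoint k a v θ z hz (SmoothFan.chartMap k (Finset.empty_subset σ) r)
  induction r using AddMonoidAlgebra.induction_on with
  | of m =>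
    obtain ⟨b, hb⟩ := h m.1 m.2
    refine ⟨b, ?_⟩
    rw [AddMonoidAlgebra.of_apply, torusPoint_chartMap_single, hb, map_one, one_mul]
    rfl
  | add x y hx hy =>
    obtain ⟨b, hb⟩ := hx
    obtain ⟨b', hb'⟩ := hy
    exact ⟨b + b', by rw [map_add, map_add, map_add, hb, hb']⟩
  | smul r x hx =>
    obtain ⟨b, hb⟩ := hx
    refine ⟨algebraMap k B r * b, ?_⟩
    have h1 : SmoothFan.chartMap k (Finset.empty_subset σ) (algebraMap k _ r) =
        algebraMap k _ r := by
      simp [SmoothFan.chartMap_single]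
    rw [map_mul, hb, Algebra.smul_def, map_mul, map_mul, h1, AlgHom.commutes,
      IsScalarTower.algebraMap_apply k A B, AlgHom.commutes, ← IsScalarTower.algebraMap_apply]

/-! ### The charts of the family -/

open Polynomial in
/-- The equation of the complement of a chart of the family: the charts avoid all the points `a l`
but one, and, in the chart at infinity, all of them. -/
def chartPoly : Option (Fin n) → Polynomial A
  | none => ∏ l, (1 - C (a l) * X)
  | some j => ∏ l ∈ Finset.univ.erase j, (X - C (a l))

/-- The index of the standard chart of the projective line that contains a chart of the family. -/
def chartIdx : Option (Fin n) → Fin 2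
  | none => 0
  | some _ => 1

variable (A) in
/-- The coordinate of the generic point `z` in a chart of the family. -/
def chartEmb (z : L) : Option (Fin n) → (Polynomial A →ₐ[A] L)
  | none => Polynomial.aeval z⁻¹
  | some _ => Polynomial.aeval z

lemma chartEmb_injective [IsDomain A] {z : L} (hz : Transcendental A z) (o : Option (Fin n)) :
    Function.Injective (chartEmb A z o) := by
  cases o with
  | none =>
    refine transcendental_iff_injective.1 ?_
    rwa [Transcendental, IsAlgebraic.inv_iff]
  | some j => exact transcendental_iff_injective.1 hz

lemma chartPoly_ne_zero [IsDomain A] (o : Option (Fin n)) : chartPoly a o ≠ 0 := by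
  cases o with
  | none =>
    refine Finset.prod_ne_zero_iff.2 fun l _ h => ?_
    simpa using congrArg (Polynomial.eval 0) h
  | some j => exact Finset.prod_ne_zero_iff.2 fun l _ => Polynomial.X_sub_C_ne_zero _

lemma chartEmb_chartPoly_ne_zero [IsDomain A] {z : L} (hz : Transcendental A z)
    (o : Option (Fin n)) : chartEmb A z o (chartPoly a o) ≠ 0 :=
  (map_ne_zero_iff _ (chartEmb_injective hz o)).2 (chartPoly_ne_zero a o)

open ProjLine in
lemma exists_mem_range_lineAway_chartPoly (hn : 0 < n) (ha : ∀ i j, i ≠ j → IsUnit (a i - a j))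
    (y : ↥(pullback (specStr k A) (projLineStructure k))) :
    ∃ o, y ∈ Set.range (lineAway k A (chartIdx o) (chartPoly a o)) := by
  have h1 (q : Spec (.of (Polynomial A))) :
      ∃ o, line k A 1 q ∈ Set.range (lineAway k A (chartIdx o) (chartPoly a o)) := by
    by_cases hq : ∃ j, Polynomial.X - Polynomial.C (a j) ∈ q.asIdeal
    · obtain ⟨j, hj⟩ := hq
      refine ⟨some j, line_mem_range_lineAway k A fun h => ?_⟩
      obtain ⟨l, hl, hlq⟩ := (Ideal.IsPrime.prod_mem_iff (hp := PrimeSpectrum.isPrime q)).1 h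
      have h2 := sub_mem hlq hj
      rw [sub_sub_sub_cancel_left, ← map_sub] at h2
      exact (PrimeSpectrum.isPrime q).ne_top (Ideal.eq_top_of_isUnit_mem _ h2
        ((ha j l (Finset.ne_of_mem_erase hl).symm).map Polynomial.C))
    · refine ⟨some ⟨0, hn⟩, line_mem_range_lineAway k A fun h => ?_⟩
      obtain ⟨l, hl, hlq⟩ := (Ideal.IsPrime.prod_mem_iff (hp := PrimeSpectrum.isPrime q)).1 h
      exact hq ⟨l, hlq⟩
  obtain ⟨i, q, rfl⟩ := exists_line_eq k A y
  obtain rfl | rfl : i = 0 ∨ i = 1 := by omega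
  · by_cases hX : Polynomial.X ∈ q.asIdeal
    · refine ⟨none, line_mem_range_lineAway k A fun h => ?_⟩
      obtain ⟨l, hl, hlq⟩ := (Ideal.IsPrime.prod_mem_iff (hp := PrimeSpectrum.isPrime q)).1 h
      have h2 := add_mem hlq (Ideal.mul_mem_left _ (Polynomial.C (a l)) hX)
      rw [sub_add_cancel] at h2
      exact (PrimeSpectrum.isPrime q).ne_top ((Ideal.eq_top_iff_one _).2 h2)
    · obtain ⟨q', hq'⟩ := line_mem_range_line k A (i := 0) (j := 1) (by omega) hX
      rw [← hq']
      exact h1 q'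
  · exact h1 q

open ProjLine in
lemma sub_notMem_of_mem_range_lineAway {j : Fin n} {o : Option (Fin n)} (ho : some j ≠ o)
    {q : Spec (.of (Polynomial A))}
    (hq : line k A 1 q ∈ Set.range (lineAway k A (chartIdx o) (chartPoly a o))) :
    Polynomial.X - Polynomial.C (a j) ∉ q.asIdeal := by
  intro h
  obtain ⟨p, hp⟩ := hq
  obtain ⟨q', hq', hpq, -⟩ := lineAway_apply (k := k) _ _ p
  rw [hpq] at hp
  cases o with
  | none =>
    obtain ⟨w, hw⟩ := line_mem_range_relPoint k (i := 1) h
    rw [← hp] at hw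
    exact hq' (Ideal.mem_of_dvd _ (Finset.dvd_prod_of_mem (fun l => 1 - _) (Finset.mem_univ j))
      (one_sub_mem_of_relPoint_eq k (by simp [chartIdx]) hw))
  | some i =>
    obtain rfl := (line k A 1).isOpenEmbedding.injective hp
    refine hq' (Ideal.mem_of_dvd _ (Finset.dvd_prod_of_mem _ (Finset.mem_erase.2
      ⟨fun hij => ho ?_, Finset.mem_univ j⟩)) h)
    rw [hij]

/-- The functions `θ(m) ∏ (z - a l) ^ m(v l)` in the chart around the point `a j`. -/
lemma exists_unit_mul_pow_eq [IsDomain A] {z : L} (hz : Transcendental A z) (j : Fin n)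
    {m : Module.Dual ℤ N} (hm : 0 ≤ m (v j)) :
    ∃ u : (Localization.Away (chartPoly a (some j)))ˣ,
      awayEmb (chartEmb A z (some j)) _ (chartEmb_chartPoly_ne_zero a hz (some j))
        (u * algebraMap _ _ (Polynomial.X - Polynomial.C (a j)) ^ (m (v j)).toNat) =
      algebraMap A L (θ (.ofAdd m)) * ∏ l, (z - algebraMap A L (a l)) ^ (m (v l)) := by
  obtain ⟨u, hu⟩ := exists_unit_awayEmb_eq (chartEmb A z (some j)) _
    (chartEmb_chartPoly_ne_zero a hz (some j)) (Finset.univ.erase j)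
    (fun l => Polynomial.X - Polynomial.C (a l)) (fun l hl => Finset.dvd_prod_of_mem _ hl)
    (fun l => m (v l)) (θ (.ofAdd m))
  refine ⟨u, ?_⟩
  have h1 (l : Fin n) : chartEmb A z (some j) (Polynomial.X - Polynomial.C (a l)) =
      z - algebraMap A L (a l) := by simp [chartEmb]
  rw [map_mul, map_pow, hu, awayEmb_algebraMap]
  simp only [h1]
  rw [mul_assoc, ← zpow_natCast, Int.toNat_of_nonneg hm,
    Finset.prod_erase_mul _ _ (Finset.mem_univ j)]

/-- The functions `θ(m) ∏ (z - a l) ^ m(v l)` in the chart at infinity. -/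
lemma exists_unit_eq [IsDomain A] {z : L} (hz : Transcendental A z) (hv : ∑ l, v l = 0)
    (m : Module.Dual ℤ N) :
    ∃ u : (Localization.Away (chartPoly a (none : Option (Fin n))))ˣ,
      awayEmb (chartEmb A z none) _ (chartEmb_chartPoly_ne_zero a hz none) u =
      algebraMap A L (θ (.ofAdd m)) * ∏ l, (z - algebraMap A L (a l)) ^ (m (v l)) := by
  obtain ⟨u, hu⟩ := exists_unit_awayEmb_eq (chartEmb A z none) _
    (chartEmb_chartPoly_ne_zero a hz none) Finset.univ
    (fun l => 1 - Polynomial.C (a l) * Polynomial.X) (fun l hl => Finset.dvd_prod_of_mem _ hl)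
    (fun l => m (v l)) (θ (.ofAdd m))
  refine ⟨u, ?_⟩
  have hz0 : z ≠ 0 := fun h => hz (h ▸ isAlgebraic_zero)
  have h1 (l : Fin n) : z - algebraMap A L (a l) =
      z * chartEmb A z (none : Option (Fin n)) (1 - Polynomial.C (a l) * Polynomial.X) := by
    simp only [chartEmb, map_sub, map_one, map_mul, Polynomial.aeval_C, Polynomial.aeval_X]
    field_simp
  rw [hu]
  simp only [h1, mul_zpow]
  have h2 (s : Finset (Fin n)) : ∏ l ∈ s, z ^ m (v l) = z ^ m (∑ l ∈ s, v l) := by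
    induction s using Finset.induction_on with
    | empty => simp
    | insert i s hi ih =>
      rw [Finset.prod_insert hi, Finset.sum_insert hi, map_add, zpow_add₀ hz0, ih]
  rw [Finset.prod_mul_distrib, h2, hv, map_zero, zpow_zero, one_mul]

end RationalCurve

lemma AlgebraicGeometry.Scheme.IdealSheafData.support_vanishingIdeal {X : Scheme.{u}}
    (Z : Closeds X) : (vanishingIdeal Z).support = Z := by
  ext1
  simp

/-! ### The family of log maps -/

namespace SmoothFan

variable {N : Type} [AddCommGroup N] {F : SmoothFan N}

namespace ContactOrder

/-- The cone spanned by the rays with non-zero multiplicity. -/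
def cone (c : F.ContactOrder) : F.Cone := ⟨c.mem_cones.choose, c.mem_cones.choose_spec.1⟩

lemma mem_cone (c : F.ContactOrder) (ρ : F.Ray) : ρ.1 ∈ c.cone.1 ↔ c.mult ρ ≠ 0 :=
  c.mem_cones.choose_spec.2 ρ

lemma apply_latticePoint (c : F.ContactOrder) (m : Module.Dual ℤ N) :
    m c.latticePoint = ∑ ρ, (c.mult ρ : ℤ) * m ρ.1 := by
  simp [latticePoint]

lemma apply_latticePoint_nonneg (c : F.ContactOrder) {m : Module.Dual ℤ N}
    (hm : m ∈ dualMonoid c.cone.1) : 0 ≤ m c.latticePoint := by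
  rw [apply_latticePoint]
  refine Finset.sum_nonneg fun ρ _ => ?_
  by_cases h : c.mult ρ = 0
  · simp [h]
  · exact mul_nonneg (Int.natCast_nonneg _) (hm _ ((c.mem_cone ρ).2 h))

lemma apply_latticePoint_eq (c : F.ContactOrder) {m : Module.Dual ℤ N} {ρ : F.Ray}
    (hmρ : m ρ.1 = 1) (hm : ∀ v ∈ c.cone.1, v ≠ ρ.1 → m v = 0) :
    m c.latticePoint = c.mult ρ := by
  rw [apply_latticePoint, Finset.sum_eq_single ρ]
  · simp [hmρ]
  · intro ρ' _ hρ'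
    by_cases h : c.mult ρ' = 0
    · simp [h]
    · rw [hm _ ((c.mem_cone ρ').2 h) fun h' => hρ' (Subtype.ext h'), mul_zero]
  · simp

end ContactOrder

lemma exists_dual_eq_one (F : SmoothFan N) {σ : F.Cone} {ρ : N} (hρ : ρ ∈ σ.1) :
    ∃ m : dualMonoid σ.1, m.1 ρ = 1 ∧ ∀ v ∈ σ.1, v ≠ ρ → m.1 v = 0 := by
  classical
  obtain ⟨ι, b, hb⟩ := F.smooth σ.1 σ.2
  have key : ∀ v ∈ σ.1, b.constr ℤ (fun i => if b i = ρ then (1 : ℤ) else 0) v =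
      if v = ρ then 1 else 0 := by
    intro v hv
    obtain ⟨i, rfl⟩ := hb hv
    simp
  refine ⟨⟨_, fun v hv => ?_⟩, by simpa using key ρ hρ, fun v hv hvρ => by
    simpa [hvρ] using key v hv⟩
  rw [key v hv]; split_ifs <;> simp

variable [Module.Free ℤ N] {k : Type u} [Field k] {A : Type u} [CommRing A] [IsDomain A]
  [Algebra k A] {n : ℕ}

open ProjLine RationalCurve Scheme.IdealSheafData in
/-- The rational curves in the torus extend to a family of morphisms from the projective line. -/
theorem exists_ev (hn : 0 < n) (c : Fin n → F.ContactOrder)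
    (hbal : ∑ j, (c j).latticePoint = 0) (a : Fin n → A) (ha : ∀ i j, i ≠ j → IsUnit (a i - a j))
    (θ : Multiplicative (Module.Dual ℤ N) →* Aˣ) {L : Type u} [Field L] [Algebra A L] [Algebra k L]
    [IsScalarTower k A L] (z : L) (hz : ∀ l, z - algebraMap A L (a l) ≠ 0)
    (hzt : Transcendental A z) :
    ∃ ev : pullback (specStr k A) (projLineStructure k) ⟶ F.toricVariety k,
      relPoint k A 1 z ≫ ev = Spec.map (CommRingCat.ofHom
        (torusPoint k a (fun j => (c j).latticePoint) θ z hz).toRingHom) ≫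
          F.chartι k F.zeroCone ∧
      ev ≫ F.toricStructure k =
        pullback.fst (specStr k A) (projLineStructure k) ≫ specStr k A ∧
      (∀ ρ, (vanishingIdeal (F.toricDivisor k ρ)).comap ev =
        ∏ j, (relPoint k A 1 (a j)).ker ^ (c j).mult ρ) ∧
      ∀ w ρ, ev (relPoint k A 0 (0 : A) w) ∉ F.toricDivisor k ρ := by
  let v : Fin n → N := fun j => (c j).latticePoint
  let σ : Option (Fin n) → F.Cone
    | none => F.zeroCone
    | some j => (c j).cone
  let B (o : Option (Fin n)) : Type u := Localization.Away (chartPoly a o)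
  have (o : Option (Fin n)) : IsDomain (B o) :=
    IsLocalization.isDomain_localization (powers_le_nonZeroDivisors_of_noZeroDivisors
      (chartPoly_ne_zero a o))
  let e (o : Option (Fin n)) : B o →ₐ[A] L :=
    awayEmb (chartEmb A z o) _ (chartEmb_chartPoly_ne_zero a hzt o)
  have he (o) : Function.Injective (e o) := awayEmb_injective (chartEmb_injective hzt o) _ _
  let V (o : Option (Fin n)) : Spec (.of (B o)) ⟶ pullback (specStr k A) (projLineStructure k) :=
    lineAway k A (chartIdx o) (chartPoly a o)
  have hV := exists_mem_range_lineAway_chartPoly (k := k) a hn ha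
  have hg (o : Option (Fin n)) : ∃ g : ChartRing k (σ o).1 →+* B o, (e o).toRingHom.comp g =
      (torusPoint k a v θ z hz).toRingHom.comp (chartMap k (F.zeroCone_le (σ o))) := by
    refine exists_chart_hom a v θ z hz (e o) (he o) fun m hm => ?_
    cases o with
    | none =>
      obtain ⟨u, hu⟩ := exists_unit_eq a v θ hzt hbal m
      exact ⟨u, hu⟩
    | some j =>
      obtain ⟨u, hu⟩ := exists_unit_mul_pow_eq a v θ hzt j
        ((c j).apply_latticePoint_nonneg hm)
      exact ⟨_, hu⟩
  choose g hg using hg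
  have hgj (j : Fin n) (m : dualMonoid (c j).cone.1) : ∃ u : (B (some j))ˣ,
      g (some j) (AddMonoidAlgebra.single m 1) = u * algebraMap (Polynomial A) (B (some j))
        (Polynomial.X - Polynomial.C (a j)) ^ (m.1 (v j)).toNat := by
    obtain ⟨u, hu⟩ := exists_unit_mul_pow_eq a v θ hzt j ((c j).apply_latticePoint_nonneg m.2)
    refine ⟨u, he (some j) ?_⟩
    refine ((congrArg (fun φ => φ (AddMonoidAlgebra.single m 1)) (hg (some j))).trans ?_).trans
      hu.symm
    refine (torusPoint_chartMap_single a v θ z hz m 1).trans ?_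
    rw [map_one, one_mul]
  have hξ (o) : Spec.map (CommRingCat.ofHom (e o).toRingHom) ≫ V o = relPoint k A 1 z := by
    refine (map_relPoint k A (e o) _ _).trans ?_
    rw [awayEmb_algebraMap]
    cases o with
    | none =>
      refine relPoint_eq_of_mul_eq_one k A (by simp [chartIdx]) ?_
      have hz0 : z ≠ 0 := fun h => hzt (h ▸ isAlgebraic_zero)
      simp [chartEmb, hz0]
    | some j => simp [chartEmb, chartIdx]
  have hT (o o') (ho : o ≠ o') (p) (hp : V o p ∈ Set.range (V o')) :
      Spec.map (CommRingCat.ofHom (g o)) p ∈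
        Set.range (Spec.map (CommRingCat.ofHom (chartMap k (F.zeroCone_le (σ o))))) := by
    cases o with
    | none =>
      have h1 : chartMap k (F.zeroCone_le (σ (none : Option (Fin n)))) = RingHom.id _ :=
        chartMap_refl k _
      rw [h1]
      exact ⟨_, by rw [CommRingCat.ofHom_id, Spec.map_id]; rfl⟩
    | some j =>
      obtain ⟨q, -, hq, hpq⟩ := lineAway_apply (k := k) _ _ p
      have h2 := sub_notMem_of_mem_range_lineAway (k := k) a ho (q := q) (hq ▸ hp)
      obtain ⟨m, hm⟩ := F.exists_supporting (σ := ∅) (c j).cone.2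
      obtain ⟨u, hu⟩ := hgj j m
      refine (F.range_chart_map k (homOfLE (F.zeroCone_le (c j).cone)) m hm).ge ?_
      change g (some j) _ ∉ p.asIdeal
      rw [hu]
      intro h3
      rw [Ideal.unit_mul_mem_iff_mem _ u.isUnit] at h3
      rw [hpq] at h2
      exact h2 ((PrimeSpectrum.isPrime p).mem_of_pow_mem _ h3)
  obtain ⟨ev, hev⟩ := F.exists_glue k B V hV σ g (relPoint k A 1 z) (fun o => (e o).toRingHom) he hξ
    (torusPoint k a v θ z hz).toRingHom hg hT
  refine ⟨ev, ?_, ?_, fun ρ => ?_, fun w ρ => ?_⟩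
  · rw [← hξ none, Category.assoc, hev none, ← Category.assoc, ← Spec.map_comp,
      ← CommRingCat.ofHom_comp, hg none, CommRingCat.ofHom_comp, Spec.map_comp, Category.assoc]
    exact congrArg (_ ≫ ·) (F.chart_map_chartι k (F.zeroCone_le (σ none)))
  · let 𝒰 : (pullback (specStr k A) (projLineStructure k)).OpenCover :=
      Scheme.Cover.mkOfCovers (Option (Fin n)) (fun o => Spec (.of (B o))) V hV
    refine 𝒰.hom_ext _ _ fun (o : Option (Fin n)) => ?_
    change V o ≫ _ = V o ≫ _
    have h0 : V o ≫ pullback.fst (specStr k A) (projLineStructure k) =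
        Spec.map (CommRingCat.ofHom (algebraMap A (B o))) := relPoint_fst k A _ _
    rw [← Category.assoc, hev, Category.assoc, chartι_toricStructure, ← Category.assoc, h0,
      ← Spec.map_comp, ← Spec.map_comp, ← CommRingCat.ofHom_comp, ← CommRingCat.ofHom_comp]
    congr 2
    ext r
    apply he o
    refine (congrArg (fun φ => φ (algebraMap k _ r)) (hg o)).trans ?_
    have h1 : chartMap k (F.zeroCone_le (σ o)) (algebraMap k _ r) = algebraMap k _ r := by
      simp [chartMap_single]
    change torusPoint k a v θ z hz (chartMap k (F.zeroCone_le (σ o)) (algebraMap k _ r)) =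
      e o (algebraMap A (B o) (algebraMap k A r))
    rw [h1, AlgHom.commutes, ← IsScalarTower.algebraMap_apply]
    exact AlgHom.commutes _ r
  · have hRHS (o) : (∏ j, (relPoint k A 1 (a j)).ker ^ (c j).mult ρ).comap (V o) =
        ∏ j, ((relPoint k A 1 (a j)).ker.comap (V o)) ^ (c j).mult ρ := by
      change comapHom (V o) _ = ∏ j, (comapHom (V o) _) ^ _
      rw [map_prod]
      simp only [map_pow]
    refine ext_of_comap_eq V hV fun o => ?_
    rw [hRHS, ← comap_comp, hev, comap_comp]
    cases o with
    | none =>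
      rw [F.comap_toricDivisor_of_notMem k (Finset.notMem_empty _), comap_top]
      refine (Finset.prod_eq_one fun j _ => ?_).symm
      have h1 : (relPoint k A 1 (a j)).ker.comap (V none) = ⊤ :=
        comap_lineAway_ker_relPoint_eq_top (by simp [chartIdx])
          (Finset.dvd_prod_of_mem (fun l => 1 - Polynomial.C (a l) * Polynomial.X)
            (Finset.mem_univ j))
      rw [h1, ← one_eq_top, one_pow]
    | some j =>
      have h1 (l) : specIdeal ((relPoint k A 1 (a l)).ker.comap (V (some j))) =
          Ideal.span {algebraMap (Polynomial A) (B (some j))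
            (Polynomial.X - Polynomial.C (a l))} :=
        specIdeal_comap_lineAway_ker_relPoint 1 (a l) _
      have h2 (l) (hl : l ≠ j) : specIdeal ((relPoint k A 1 (a l)).ker.comap (V (some j))) = 1 := by
        rw [h1, Ideal.one_eq_top, Ideal.span_singleton_eq_top]
        exact isUnit_of_dvd_unit (map_dvd _ (Finset.dvd_prod_of_mem
          (fun l => Polynomial.X - Polynomial.C (a l)) (Finset.mem_erase.2 ⟨hl, Finset.mem_univ l⟩)))
            (IsLocalization.Away.algebraMap_isUnit (chartPoly a (some j)))
      apply specIdeal_injective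
      rw [map_prod]
      simp only [map_pow]
      rw [Finset.prod_eq_single j (fun l _ hl => by rw [h2 l hl, one_pow]) (by simp), h1,
        specIdeal_comap]
      by_cases hρ : ρ.1 ∈ (c j).cone.1
      · obtain ⟨m, hmρ, hm⟩ := F.exists_dual_eq_one hρ
        obtain ⟨u, hu⟩ := hgj j m
        rw [F.specIdeal_comap_toricDivisor k hρ m hmρ hm, Ideal.map_span, Set.image_singleton]
        change Ideal.span {g (some j) _} = _
        rw [hu, Ideal.span_singleton_mul_left_unit u.isUnit, Ideal.span_singleton_pow,
          (c j).apply_latticePoint_eq hmρ hm, Int.toNat_natCast]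
      · rw [F.comap_toricDivisor_of_notMem k hρ, specIdeal_top, Ideal.map_top,
          not_not.1 (mt ((c j).mem_cone ρ).2 hρ), pow_zero, Ideal.one_eq_top]
  · have h1 : relPoint k A 0 (0 : A) w ∈ Set.range (V none) := by
      rw [relPoint_eq_map_line, Scheme.Hom.comp_apply]
      refine line_mem_range_lineAway k A fun h => (PrimeSpectrum.isPrime w).ne_top
        ((Ideal.eq_top_iff_one _).2 ?_)
      have h2 : Polynomial.evalRingHom (0 : A) (chartPoly a none) ∈ w.asIdeal := h
      simpa [chartPoly, Polynomial.eval_prod] using h2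
    obtain ⟨p, hp⟩ := h1
    rw [← hp, ← Scheme.Hom.comp_apply, hev, Scheme.Hom.comp_apply]
    intro h2
    have h3 := F.preimage_toricDivisor_of_notMem k (σ := F.zeroCone) (ρ := ρ)
      (Finset.notMem_empty _)
    have h4 : Spec.map (CommRingCat.ofHom (g none)) p ∈
      (F.toricDivisor k ρ).preimage (F.chartι k F.zeroCone).continuous := h2
    rw [h3] at h4
    exact h4

open ProjLine RationalCurve Scheme.IdealSheafData in
/-- The family of log maps given by rational curves in the torus. -/
def logMapFamily [Algebra.FiniteType k A] (hn : 0 < n) (c : Fin n → F.ContactOrder)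
    (hpos : ∀ j, (c j).IsPositive)
    (hbal : ∑ j, (c j).latticePoint = 0) (a : Fin n → A) (ha : ∀ i j, i ≠ j → IsUnit (a i - a j))
    (θ : Multiplicative (Module.Dual ℤ N) →* Aˣ) {L : Type u} [Field L] [Algebra A L] [Algebra k L]
    [IsScalarTower k A L] (z : L) (hz : ∀ l, z - algebraMap A L (a l) ≠ 0)
    (hzt : Transcendental A z) :
    LogMapFamily (F.toricStructure k) (F.toricDivisor k) (fun j => (c j).mult) where
  W := Spec (.of A)
  str := specStr k A
  isIntegral := inferInstance
  isSeparated := inferInstance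
  locallyOfFiniteType := by
    rw [HasRingHomProperty.Spec_iff (P := @LocallyOfFiniteType)]
    exact (RingHom.finiteType_algebraMap (A := k) (B := A)).2 inferInstance
  quasiCompact := inferInstance
  marking j := relPoint k A 1 (a j)
  marking_fst j := by
    rw [relPoint_fst, Algebra.algebraMap_self, CommRingCat.ofHom_id, Spec.map_id]
  marking_disjoint i j hij := disjoint_range_relPoint k 1 (ha i j hij)
  ev := (exists_ev (k := k) hn c hbal a ha θ z hz hzt).choose
  ev_over := (exists_ev (k := k) hn c hbal a ha θ z hz hzt).choose_spec.2.1
  ev_log := by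
    obtain ⟨-, -, h, -⟩ := (exists_ev (k := k) hn c hbal a ha θ z hz hzt).choose_spec
    refine isLogMorphism_of_preimage_subset fun y hy => ?_
    rw [← Finset.sup_univ_eq_iSup, ← SetLike.mem_coe, Closeds.coe_finset_sup,
      Finset.sup_eq_iSup] at hy
    simp only [Function.comp, Finset.mem_univ, iSup_pos, Set.iSup_eq_iUnion, Set.mem_iUnion] at hy
    obtain ⟨ρ, hρ⟩ := hy
    have h1 := congrArg support (h ρ)
    rw [support_comap, support_vanishingIdeal] at h1
    have h2 : y ∈ (∏ j, (relPoint k A 1 (a j)).ker ^ (c j).mult ρ).support := h1 ▸ hρ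
    rw [mem_support_prod] at h2 ⊢
    obtain ⟨j, hj, hyj⟩ := h2
    refine ⟨j, hj, ?_⟩
    by_cases h0 : (c j).mult ρ = 0
    · rw [h0, pow_zero, one_eq_top, support_top] at hyj
      exact hyj.elim
    · rwa [support_pow _ _ h0] at hyj
  contact ρ := (exists_ev (k := k) hn c hbal a ha θ z hz hzt).choose_spec.2.2.1 ρ
  stable w := by
    left
    obtain ⟨-, -, h, h'⟩ := (exists_ev (k := k) hn c hbal a ha θ z hz hzt).choose_spec
    set ev := (exists_ev (k := k) hn c hbal a ha θ z hz hzt).choose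
    obtain ⟨ρ, hρ⟩ := hpos ⟨0, hn⟩
    have hfst (i : Fin 2) (b : A) :
        pullback.fst (specStr k A) (projLineStructure k) (relPoint k A i b w) = w := by
      rw [← Scheme.Hom.comp_apply, relPoint_fst, Algebra.algebraMap_self, CommRingCat.ofHom_id,
        Spec.map_id]
      rfl
    intro hs
    refine h' w ρ ?_
    rw [hs ⟨relPoint k A 0 (0 : A) w, hfst 0 0, rfl⟩
      ⟨relPoint k A 1 (a ⟨0, hn⟩) w, hfst 1 _, rfl⟩]
    have h1 := congrArg support (h ρ)
    rw [support_comap, support_vanishingIdeal] at h1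
    have h2 : relPoint k A 1 (a ⟨0, hn⟩) w ∈
        (∏ j, (relPoint k A 1 (a j)).ker ^ (c j).mult ρ).support := by
      rw [mem_support_prod]
      refine ⟨_, Finset.mem_univ ⟨0, hn⟩, ?_⟩
      rw [support_pow _ _ hρ]
      exact Scheme.Hom.range_subset_ker_support _ ⟨w, rfl⟩
    rw [← h1] at h2
    exact h2

open ProjLine RationalCurve in
lemma relPoint_logMapFamily_ev [Algebra.FiniteType k A] (hn : 0 < n) (c : Fin n → F.ContactOrder)
    (hpos : ∀ j, (c j).IsPositive)
    (hbal : ∑ j, (c j).latticePoint = 0) (a : Fin n → A) (ha : ∀ i j, i ≠ j → IsUnit (a i - a j))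
    (θ : Multiplicative (Module.Dual ℤ N) →* Aˣ) {L : Type u} [Field L] [Algebra A L] [Algebra k L]
    [IsScalarTower k A L] (z : L) (hz : ∀ l, z - algebraMap A L (a l) ≠ 0)
    (hzt : Transcendental A z) :
    relPoint k A 1 z ≫ (logMapFamily (k := k) hn c hpos hbal a ha θ z hz hzt).ev =
      Spec.map (CommRingCat.ofHom
        (torusPoint k a (fun j => (c j).latticePoint) θ z hz).toRingHom) ≫
          F.chartι k F.zeroCone :=
  (exists_ev (k := k) hn c hbal a ha θ z hz hzt).choose_spec.1

end SmoothFan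

/-! ### Dominance and separability at a generic point -/

section

open TensorProduct

/-- Geometric reducedness descends to subalgebras, and does not depend on the model of the ground
field. -/
lemma Algebra.IsGeometricallyReduced.of_ringEquiv_of_injective {K K' L L' : Type u} [Field K]
    [Field K'] [CommRing L] [CommRing L'] [Algebra K L] [Algebra K' L']
    [Algebra.IsGeometricallyReduced K L] (e : K ≃+* K') (j : L' →+* L)
    (hj : Function.Injective j) (h : ∀ x, j (algebraMap K' L' (e x)) = algebraMap K L x) :
    Algebra.IsGeometricallyReduced K' L' := by
  let : Algebra K K' := e.toRingHom.toAlgebra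
  let : Algebra K L' := ((algebraMap K' L').comp e.toRingHom).toAlgebra
  have : IsScalarTower K K' L' := .of_algebraMap_eq fun _ => rfl
  have : IsScalarTower K K' (AlgebraicClosure K') := inferInstance
  have : Algebra.IsGeometricallyReduced K L' :=
    .of_injective ({ j with commutes' := h } : L' →ₐ[K] L) hj
  have hs : Function.Surjective (algebraMap K K') := e.surjective
  have : Algebra.IsIntegral K K' := Algebra.isIntegral_of_surjective hs
  have : Algebra.IsAlgebraic K (AlgebraicClosure K') := Algebra.IsAlgebraic.trans K K' _
  rw [isGeometricallyReduced_field_iff]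
  have h1 : IsReduced (AlgebraicClosure K' ⊗[K] L') := inferInstance
  have : TensorProduct.CompatibleSMul K K' (AlgebraicClosure K') L' := by
    refine ⟨fun r m n => ?_⟩
    obtain ⟨r, rfl⟩ := hs r
    rw [algebraMap_smul, algebraMap_smul, TensorProduct.smul_tmul]
  exact isReduced_of_injective (Algebra.TensorProduct.equivOfCompatibleSMul K' K K
    (AlgebraicClosure K') L').symm (AlgEquiv.injective _)

end

namespace AlgebraicGeometry

lemma isDominant_specMap_of_injective {R S : Type u} [CommRing R] [CommRing S] (φ : R →+* S)
    (h : Function.Injective φ) : IsDominant (Spec.map (CommRingCat.ofHom φ)) :=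
  ⟨(PrimeSpectrum.denseRange_comap_iff_ker_le_nilRadical _).2
    (((RingHom.injective_iff_ker_eq_bot _).1 h).le.trans bot_le)⟩

/-- A morphism is dominant if it maps a point to a dominant point. -/
lemma isDominant_of_comp_eq {Y X : Scheme.{u}} (f : Y ⟶ X) {R L : Type u} [CommRing R]
    [CommRing L] (t : Spec (.of R) ⟶ X) [IsDominant t] (ξ : Spec (.of L) ⟶ Y) (φ : R →+* L)
    (hφ : Function.Injective φ) (h : ξ ≫ f = Spec.map (CommRingCat.ofHom φ) ≫ t) :
    IsDominant f := by
  have := isDominant_specMap_of_injective φ hφ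
  have : IsDominant (ξ ≫ f) := h ▸ inferInstance
  exact IsDominant.of_comp ξ f

/-- The local ring at the generic point of an affine chart is the fraction field. -/
lemma exists_fractionRing_equiv_stalk {X : Scheme.{u}} {R L : Type u} [CommRing R] [IsDomain R]
    [Field L] (t : Spec (.of R) ⟶ X) [IsOpenImmersion t] (φ : R →+* L)
    (hφ : Function.Injective φ) :
    ∃ e : FractionRing R ≃+* X.presheaf.stalk
        ((Spec.map (CommRingCat.ofHom φ) ≫ t) (IsLocalRing.closedPoint L)),
      ∀ r, (Scheme.stalkClosedPointTo (R := .of L) (Spec.map (CommRingCat.ofHom φ) ≫ t)).hom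
        (e (algebraMap R (FractionRing R) r)) = φ r := by
  let x : PrimeSpectrum R := PrimeSpectrum.comap φ (IsLocalRing.closedPoint L)
  have hx : x.asIdeal = ⊥ := by
    have h1 : x.asIdeal = (IsLocalRing.maximalIdeal L).comap φ := rfl
    rw [h1, IsLocalRing.maximalIdeal_eq_bot]
    exact (RingHom.injective_iff_ker_eq_bot _).1 hφ
  let S := (Spec (.of R)).presheaf.stalk x
  let : Algebra R S := StructureSheaf.stalkAlgebra R x
  have h2 : IsLocalization.AtPrime S x.asIdeal := StructureSheaf.IsLocalization.to_stalk R x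
  have : IsFractionRing R S := by
    have h3 : x.asIdeal.primeCompl = nonZeroDivisors R := by
      ext r
      rw [mem_nonZeroDivisors_iff_ne_zero]
      simp [Ideal.primeCompl, hx]
    unfold IsLocalization.AtPrime at h2
    rwa [h3] at h2
  let e1 : FractionRing R ≃+* S := (FractionRing.algEquiv R S).toRingEquiv
  have h0 (y : ↥(Spec (.of R))) : IsIso (t.stalkMap y) := inferInstance
  have := h0 x
  let e2 : X.presheaf.stalk (t x) ≃+* S := (asIso (t.stalkMap x)).commRingCatIsoToRingEquiv
  refine ⟨e1.trans e2.symm, fun r => ?_⟩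
  have h4 := Scheme.stalkClosedPointTo_comp (R := .of L) (Spec.map (CommRingCat.ofHom φ)) t
  have h5 : StructureSheaf.toStalk R x ≫
      (Spec.map (CommRingCat.ofHom φ)).stalkMap (IsLocalRing.closedPoint L) =
        CommRingCat.ofHom φ ≫ StructureSheaf.toStalk L (IsLocalRing.closedPoint L) :=
    stalkMap_toStalk (CommRingCat.ofHom φ) (IsLocalRing.closedPoint L)
  have h6 : StructureSheaf.toStalk R x ≫
      Scheme.stalkClosedPointTo (R := .of L) (Spec.map (CommRingCat.ofHom φ)) =
        CommRingCat.ofHom φ := by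
    refine (Category.assoc _ _ _).symm.trans ?_
    refine (congrArg (· ≫ (stalkClosedPointIso (.of L)).hom) h5).trans ?_
    refine (Category.assoc _ _ _).trans ?_
    rw [← stalkClosedPointIso_inv (R := .of L)]
    exact (congrArg (CommRingCat.ofHom φ ≫ ·) (stalkClosedPointIso (.of L)).inv_hom_id).trans
      (Category.comp_id _)
  have h7 : e1 (algebraMap R (FractionRing R) r) = StructureSheaf.toStalk R x r :=
    (FractionRing.algEquiv R S).commutes r
  have h8 (y : S) : t.stalkMap x (e2.symm y) = y := e2.apply_symm_apply y
  refine (congrArg (fun g => g.hom (e2.symm (e1 (algebraMap R (FractionRing R) r)))) h4).trans ?_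
  refine (congrArg (Scheme.stalkClosedPointTo (R := .of L)
    (Spec.map (CommRingCat.ofHom φ))).hom ((h8 _).trans h7)).trans ?_
  exact congrArg (fun g => g.hom r) h6

/-- A morphism is dominant and separable if it is so at a generic point with values in a field that
is geometrically reduced over the function field of the target. -/
theorem isDominantSeparable_of_comp_eq {Y X : Scheme.{u}} (f : Y ⟶ X) {B R L : Type u}
    [CommRing B] [IsDomain B] [CommRing R] [IsDomain R] [Field L] (v : Spec (.of B) ⟶ Y)
    [IsOpenImmersion v] [IsDominant v] (t : Spec (.of R) ⟶ X) [IsOpenImmersion t] [IsDominant t]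
    (ψ : B →+* L) (hψ : Function.Injective ψ) (φ : R →+* L) (hφ : Function.Injective φ)
    (h : (Spec.map (CommRingCat.ofHom ψ) ≫ v) ≫ f = Spec.map (CommRingCat.ofHom φ) ≫ t)
    [Algebra (FractionRing R) L] [Algebra.IsGeometricallyReduced (FractionRing R) L]
    (halg : ∀ r, algebraMap (FractionRing R) L (algebraMap R _ r) = φ r) :
    IsDominantSeparable f := by
  refine ⟨isDominant_of_comp_eq f t _ φ hφ h, ?_⟩
  set ξ := Spec.map (CommRingCat.ofHom ψ) ≫ v with hξ
  refine ⟨ξ (IsLocalRing.closedPoint L), ?_, ?_⟩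
  · have := isDominant_specMap_of_injective ψ hψ
    have h1 : IsDominant ξ := inferInstance
    have h2 : Set.range ξ = {ξ (IsLocalRing.closedPoint L)} := by
      ext y
      constructor
      · rintro ⟨p, rfl⟩
        exact congrArg ξ (Subsingleton.elim (α := PrimeSpectrum L) _ _)
      · rintro rfl
        exact ⟨_, rfl⟩
    rw [isGenericPoint_def, ← h2]
    exact h1.denseRange.closure_range
  obtain ⟨e, -⟩ := exists_fractionRing_equiv_stalk v ψ hψ
  have hf : IsField (Y.presheaf.stalk (ξ (IsLocalRing.closedPoint L))) :=
    e.symm.toMulEquiv.isField (Field.toIsField _)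
  have key : ∃ e : FractionRing R ≃+* X.presheaf.stalk ((ξ ≫ f) (IsLocalRing.closedPoint L)),
      ∀ r, (Scheme.stalkClosedPointTo (R := .of L) (ξ ≫ f)).hom
        (e (algebraMap R (FractionRing R) r)) = φ r := by
    rw [h]
    exact exists_fractionRing_equiv_stalk t φ hφ
  obtain ⟨e', he'⟩ := key
  have hf' : IsField (X.presheaf.stalk (f (ξ (IsLocalRing.closedPoint L)))) :=
    e'.symm.toMulEquiv.isField (Field.toIsField _)
  let := hf.toField
  let := hf'.toField
  let : Algebra (X.presheaf.stalk (f (ξ (IsLocalRing.closedPoint L))))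
    (Y.presheaf.stalk (ξ (IsLocalRing.closedPoint L))) :=
      (f.stalkMap (ξ (IsLocalRing.closedPoint L))).hom.toAlgebra
  refine Algebra.IsGeometricallyReduced.of_ringEquiv_of_injective (K := FractionRing R) (L := L) e'
    (Scheme.stalkClosedPointTo (R := .of L) ξ).hom (RingHom.injective _) ?_
  have h3 : ((Scheme.stalkClosedPointTo (R := .of L) (ξ ≫ f)).hom.comp e'.toRingHom) =
      algebraMap (FractionRing R) L :=
    IsLocalization.ringHom_ext (nonZeroDivisors R) (RingHom.ext fun r => (he' r).trans (halg r).symm)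
  intro x
  refine Eq.trans ?_ (congrArg (fun g => g x) h3)
  exact (congrArg (fun g => g.hom (e' x)) (Scheme.stalkClosedPointTo_comp (R := .of L) ξ f)).symm

end AlgebraicGeometry

/-! ### Evaluation at one and at two generic points -/

namespace AlgebraicGeometry

/-- The product of dense open immersions is dense if the structure morphisms are open. -/
lemma isDominant_pullback_map {X Y S X' Y' : Scheme.{u}} (f : X ⟶ S) (g : Y ⟶ S)
    [UniversallyOpen f] [UniversallyOpen g] (f' : X' ⟶ S) (g' : Y' ⟶ S) (i : X' ⟶ X) (j : Y' ⟶ Y)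
    [IsOpenImmersion i] [IsOpenImmersion j] [IsDominant i] [IsDominant j]
    (hi : f' ≫ 𝟙 S = i ≫ f) (hj : g' ≫ 𝟙 S = j ≫ g) :
    IsDominant (pullback.map f' g' f g i j (𝟙 S) hi hj) := by
  constructor
  rw [DenseRange, Scheme.Pullback.range_map]
  have h1 : Dense (pullback.fst f g ⁻¹' Set.range i) :=
    i.denseRange.preimage (pullback.fst f g).isOpenMap
  have h2 : Dense (pullback.snd f g ⁻¹' Set.range j) :=
    j.denseRange.preimage (pullback.snd f g).isOpenMap
  exact h1.inter_of_isOpen_left h2 (i.isOpenEmbedding.isOpen_range.preimage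
    (pullback.fst f g).continuous)

end AlgebraicGeometry

lemma sub_algebraMap_ne_zero_of_transcendental {A L : Type u} [CommRing A] [Nontrivial A]
    [CommRing L] [Algebra A L] {z : L} (hz : Transcendental A z) (a : A) :
    z - algebraMap A L a ≠ 0 :=
  fun h => hz (sub_eq_zero.1 h ▸ isAlgebraic_algebraMap a)

open TensorProduct Polynomial in
lemma Polynomial.lift_aeval_injective {A L : Type u} [CommRing A] [CommRing L] [Algebra A L]
    {z w : L} (h : AlgebraicIndependent A ![z, w]) :
    Function.Injective (Algebra.TensorProduct.lift (aeval z : A[X] →ₐ[A] L)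
      (aeval w : A[X] →ₐ[A] L) (fun _ _ => .all _ _)) := by
  set ψ := Algebra.TensorProduct.lift (aeval z : A[X] →ₐ[A] L)
      (aeval w : A[X] →ₐ[A] L) (fun _ _ => .all _ _)
  let s : MvPolynomial (Fin 2) A →ₐ[A] A[X] ⊗[A] A[X] :=
    MvPolynomial.aeval ![X ⊗ₜ 1, 1 ⊗ₜ X]
  have hl : (s.comp (aeval (MvPolynomial.X 0) : A[X] →ₐ[A] _)) =
      Algebra.TensorProduct.includeLeft := by
    ext; simp [s]
  have hr : (s.comp (aeval (MvPolynomial.X 1) : A[X] →ₐ[A] _)) =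
      Algebra.TensorProduct.includeRight := by
    ext; simp [s]
  have hs : Function.Surjective s := by
    intro x
    induction x using TensorProduct.induction_on with
    | zero => exact ⟨0, map_zero _⟩
    | tmul p q =>
      refine ⟨aeval (MvPolynomial.X 0) p * aeval (MvPolynomial.X 1) q, ?_⟩
      rw [map_mul]
      refine (congrArg₂ (· * ·) (DFunLike.congr_fun hl p) (DFunLike.congr_fun hr q)).trans ?_
      simp
    | add x y hx hy =>
      obtain ⟨x, rfl⟩ := hx
      obtain ⟨y, rfl⟩ := hy
      exact ⟨x + y, map_add _ _ _⟩
  have hψ : ψ.comp s = MvPolynomial.aeval ![z, w] := by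
    refine MvPolynomial.algHom_ext fun i => ?_
    fin_cases i <;> simp [s, ψ]
  refine Function.Injective.of_comp_right (g := s) ?_ hs
  rw [← AlgHom.coe_comp, hψ]
  exact h

open ProjLine TensorProduct in
lemma ProjLine.exists_isDominant_pullback_proj {k : Type u} [Field k] {A : Type u} [CommRing A]
    [IsDomain A] [Algebra k A] : ∃ v : Spec (.of (Polynomial A ⊗[A] Polynomial A)) ⟶
      pullback (pullback.fst (specStr k A) (projLineStructure k))
        (pullback.fst (specStr k A) (projLineStructure k)),
    IsOpenImmersion v ∧ IsDominant v ∧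
    v ≫ pullback.fst _ _ = Spec.map (CommRingCat.ofHom
      (Algebra.TensorProduct.includeLeft (R := A) (S := A) :
        Polynomial A →ₐ[A] Polynomial A ⊗[A] Polynomial A).toRingHom) ≫ line k A 1 ∧
    v ≫ pullback.snd _ _ = Spec.map (CommRingCat.ofHom
      (Algebra.TensorProduct.includeRight (R := A) :
        Polynomial A →ₐ[A] Polynomial A ⊗[A] Polynomial A).toRingHom) ≫ line k A 1 := by
  have h0 : Spec.map (CommRingCat.ofHom (algebraMap A (Polynomial A))) ≫ 𝟙 _ =
      line k A 1 ≫ pullback.fst (specStr k A) (projLineStructure k) := by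
    rw [Category.comp_id, relPoint_fst]
  have : IsDominant (line k A 1) := ⟨dense_range_line k A 1⟩
  have := isDominant_pullback_map (pullback.fst (specStr k A) (projLineStructure k))
    (pullback.fst (specStr k A) (projLineStructure k)) _ _ (line k A 1) (line k A 1) h0 h0
  refine ⟨(pullbackSpecIso A (Polynomial A) (Polynomial A)).inv ≫ pullback.map _ _
    (pullback.fst (specStr k A) (projLineStructure k))
    (pullback.fst (specStr k A) (projLineStructure k)) (line k A 1) (line k A 1) (𝟙 _) h0 h0,
    inferInstance, inferInstance, ?_, ?_⟩
  · rw [Category.assoc, pullback.lift_fst, pullbackSpecIso_inv_fst_assoc]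
    rfl
  · rw [Category.assoc, pullback.lift_snd, pullbackSpecIso_inv_snd_assoc]
    rfl

namespace SmoothFan

section

variable {N : Type} [AddCommGroup N] (F : SmoothFan N) (k : Type u) [Field k]

/-- The open torus of the toric variety. -/
def torusι : Spec (.of (ChartRing k (∅ : Finset N))) ⟶ F.toricVariety k := F.chartι k F.zeroCone

instance isOpenImmersion_torusι : IsOpenImmersion (F.torusι k) :=
  F.isOpenImmersion_chartι k F.zeroCone

instance isDominant_torusι [Module.Free ℤ N] : IsDominant (F.torusι k) :=
  F.isDominant_chartι_zeroCone k

lemma torusι_toricStructure : F.torusι k ≫ F.toricStructure k =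
    Spec.map (CommRingCat.ofHom (algebraMap k (ChartRing k (∅ : Finset N)))) :=
  F.chartι_toricStructure k F.zeroCone

end

variable {N : Type} [AddCommGroup N] {F : SmoothFan N} [Module.Free ℤ N]
  {k : Type u} [Field k] {A : Type u} [CommRing A] [IsDomain A] [Algebra k A]
  [Algebra.FiniteType k A] {n : ℕ} (hn : 0 < n) (c : Fin n → F.ContactOrder)
  (hpos : ∀ j, (c j).IsPositive) (hbal : ∑ j, (c j).latticePoint = 0) (a : Fin n → A)
  (ha : ∀ i j, i ≠ j → IsUnit (a i - a j)) (θ : Multiplicative (Module.Dual ℤ N) →* Aˣ)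

lemma transcendental_fractionRing_X (A : Type u) [CommRing A] [IsDomain A] :
    Transcendental A (algebraMap (Polynomial A) (FractionRing (Polynomial A)) Polynomial.X) := by
  rw [transcendental_algebraMap_iff (IsFractionRing.injective _ _)]
  exact Polynomial.transcendental_X A

variable (k) in
/-- The family of log maps given by the rational curves in the torus with vanishing orders given by
the contact orders `c` at the points `a`, and with leading coefficients `θ`. -/
def curveFamily : LogMapFamily (F.toricStructure k) (F.toricDivisor k) (fun j => (c j).mult) :=
  logMapFamily (k := k) hn c hpos hbal a ha θ
    (algebraMap (Polynomial A) (FractionRing (Polynomial A)) Polynomial.X)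
    (fun _ => sub_algebraMap_ne_zero_of_transcendental (transcendental_fractionRing_X A) _)
    (transcendental_fractionRing_X A)

variable {L : Type u} [Field L] [Algebra A L] [Algebra k L] [IsScalarTower k A L] {z w : L}

variable (k) in
/-- The point of the torus that is the value at a transcendental element of the rational curve. -/
abbrev curvePoint (hz : Transcendental A z) : ChartRing k (∅ : Finset N) →ₐ[k] L :=
  RationalCurve.torusPoint k a (fun j => (c j).latticePoint) θ z
    (fun _ => sub_algebraMap_ne_zero_of_transcendental hz _)

open ProjLine in
lemma relPoint_curveFamily_ev (hz : Transcendental A z) :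
    relPoint k A 1 z ≫ (curveFamily k hn c hpos hbal a ha θ).ev =
      Spec.map (CommRingCat.ofHom (curvePoint k c a θ hz).toRingHom) ≫ F.torusι k := by
  have h1 : Function.Injective (Polynomial.aeval z : Polynomial A →ₐ[A] L) :=
    transcendental_iff_injective.1 hz
  obtain ⟨φ, h2⟩ : ∃ φ : FractionRing (Polynomial A) →ₐ[A] L,
      φ (algebraMap (Polynomial A) (FractionRing (Polynomial A)) Polynomial.X) = z :=
    ⟨IsFractionRing.liftAlgHom h1, by simp⟩
  have h3 := map_relPoint k A φ 1
    (algebraMap (Polynomial A) (FractionRing (Polynomial A)) Polynomial.X)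
  have h4 : relPoint k A 1 (algebraMap (Polynomial A) (FractionRing (Polynomial A)) Polynomial.X) ≫
      (curveFamily k hn c hpos hbal a ha θ).ev = Spec.map (CommRingCat.ofHom
        (curvePoint k c a θ (transcendental_fractionRing_X A)).toRingHom) ≫ F.torusι k :=
    relPoint_logMapFamily_ev (k := k) hn c hpos hbal a ha θ _ _ _
  subst h2
  rw [← h3]
  refine (Category.assoc _ _ _).trans ((congrArg (_ ≫ ·) h4).trans ?_)
  rw [← Category.assoc, ← Spec.map_comp, ← CommRingCat.ofHom_comp]
  congr 3
  exact RationalCurve.map_torusPoint a _ θ φ _ _ _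

lemma isDominant_curveFamily_ev (hz : Transcendental A z)
    (h : Function.Injective (curvePoint k c a θ hz)) :
    IsDominant (curveFamily k hn c hpos hbal a ha θ).ev :=
  isDominant_of_comp_eq _ (F.torusι k) _ (curvePoint k c a θ hz).toRingHom h
    (relPoint_curveFamily_ev hn c hpos hbal a ha θ hz)

open ProjLine in
lemma isDominantSeparable_curveFamily_ev (hz : Transcendental A z)
    (h : Function.Injective (curvePoint k c a θ hz))
    [Algebra (FractionRing (ChartRing k (∅ : Finset N))) L]
    [Algebra.IsGeometricallyReduced (FractionRing (ChartRing k (∅ : Finset N))) L]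
    (halg : ∀ r, algebraMap (FractionRing (ChartRing k (∅ : Finset N))) L (algebraMap _ _ r) =
      curvePoint k c a θ hz r) :
    IsDominantSeparable (curveFamily k hn c hpos hbal a ha θ).ev := by
  have : IsDominant (line k A 1) := ⟨dense_range_line k A 1⟩
  have : IsDomain (ChartRing k (∅ : Finset N)) := h.isDomain _
  have h1 := map_relPoint k A (Polynomial.aeval z : Polynomial A →ₐ[A] L) 1 Polynomial.X
  rw [Polynomial.aeval_X] at h1
  refine isDominantSeparable_of_comp_eq (Y := pullback (specStr k A) (projLineStructure k)) _
    (line k A 1) (F.torusι k)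
    (Polynomial.aeval z : Polynomial A →ₐ[A] L).toRingHom (transcendental_iff_injective.1 hz)
    (curvePoint k c a θ hz).toRingHom h ?_ halg
  refine Eq.trans ?_ (relPoint_curveFamily_ev hn c hpos hbal a ha θ hz)
  exact congrArg (· ≫ (curveFamily k hn c hpos hbal a ha θ).ev) h1

open TensorProduct in
variable (F k) in
lemma exists_isDominant_pullback_toricStructure :
    ∃ t : Spec (.of (ChartRing k (∅ : Finset N) ⊗[k] ChartRing k (∅ : Finset N))) ⟶
      pullback (F.toricStructure k) (F.toricStructure k),
    IsOpenImmersion t ∧ IsDominant t ∧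
    t ≫ pullback.fst _ _ = Spec.map (CommRingCat.ofHom
      (Algebra.TensorProduct.includeLeft (R := k) (S := k) : ChartRing k (∅ : Finset N) →ₐ[k]
        ChartRing k (∅ : Finset N) ⊗[k] ChartRing k (∅ : Finset N)).toRingHom) ≫
          F.torusι k ∧
    t ≫ pullback.snd _ _ = Spec.map (CommRingCat.ofHom
      (Algebra.TensorProduct.includeRight (R := k) : ChartRing k (∅ : Finset N) →ₐ[k]
        ChartRing k (∅ : Finset N) ⊗[k] ChartRing k (∅ : Finset N)).toRingHom) ≫
          F.torusι k := by
  have h0 : Spec.map (CommRingCat.ofHom (algebraMap k (ChartRing k (∅ : Finset N)))) ≫ 𝟙 _ =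
      F.torusι k ≫ F.toricStructure k := by
    rw [Category.comp_id, torusι_toricStructure]
  have : Subsingleton (Spec (.of k)) := inferInstanceAs (Subsingleton (PrimeSpectrum k))
  have := isDominant_pullback_map (F.toricStructure k) (F.toricStructure k) _ _
    (F.torusι k) (F.torusι k) h0 h0
  refine ⟨(pullbackSpecIso k (ChartRing k (∅ : Finset N)) (ChartRing k (∅ : Finset N))).inv ≫
    pullback.map _ _ (F.toricStructure k) (F.toricStructure k)
    (F.torusι k) (F.torusι k) (𝟙 _) h0 h0,
    inferInstance, inferInstance, ?_, ?_⟩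
  · rw [Category.assoc, pullback.lift_fst, pullbackSpecIso_inv_fst_assoc]
    rfl
  · rw [Category.assoc, pullback.lift_snd, pullbackSpecIso_inv_snd_assoc]
    rfl

open TensorProduct in
variable (k) in
/-- The pair of points of the torus that are the values at two elements of the rational curve. -/
abbrev curvePoints (hz : Transcendental A z) (hw : Transcendental A w) :
    ChartRing k (∅ : Finset N) ⊗[k] ChartRing k (∅ : Finset N) →ₐ[k] L :=
  Algebra.TensorProduct.lift (curvePoint k c a θ hz) (curvePoint k c a θ hw)
    (fun _ _ => .all _ _)

open ProjLine TensorProduct in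
lemma exists_curveFamily_ev₂_eq (hz : Transcendental A z) (hw : Transcendental A w) :
    ∃ (v : Spec (.of (Polynomial A ⊗[A] Polynomial A)) ⟶
        pullback (pullback.fst (specStr k A) (projLineStructure k))
          (pullback.fst (specStr k A) (projLineStructure k)))
      (t : Spec (.of (ChartRing k (∅ : Finset N) ⊗[k] ChartRing k (∅ : Finset N))) ⟶
        pullback (F.toricStructure k) (F.toricStructure k)),
      IsOpenImmersion v ∧ IsDominant v ∧ IsOpenImmersion t ∧ IsDominant t ∧
      (Spec.map (CommRingCat.ofHom (Algebra.TensorProduct.lift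
        (Polynomial.aeval z : Polynomial A →ₐ[A] L) (Polynomial.aeval w : Polynomial A →ₐ[A] L)
          (fun _ _ => .all _ _)).toRingHom) ≫ v) ≫ (curveFamily k hn c hpos hbal a ha θ).ev₂ =
        Spec.map (CommRingCat.ofHom (curvePoints k c a θ hz hw).toRingHom) ≫ t := by
  obtain ⟨v, hv, hv', hv1, hv2⟩ := exists_isDominant_pullback_proj (k := k) (A := A)
  obtain ⟨t, ht, ht', ht1, ht2⟩ := exists_isDominant_pullback_toricStructure F k
  refine ⟨v, t, hv, hv', ht, ht', ?_⟩
  have hl := map_relPoint k A (Polynomial.aeval z : Polynomial A →ₐ[A] L) 1 Polynomial.X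
  have hr := map_relPoint k A (Polynomial.aeval w : Polynomial A →ₐ[A] L) 1 Polynomial.X
  rw [Polynomial.aeval_X] at hl hr
  have el := relPoint_curveFamily_ev (k := k) hn c hpos hbal a ha θ hz
  have er := relPoint_curveFamily_ev (k := k) hn c hpos hbal a ha θ hw
  set f := curveFamily k hn c hpos hbal a ha θ
  set ψ := Algebra.TensorProduct.lift
        (Polynomial.aeval z : Polynomial A →ₐ[A] L) (Polynomial.aeval w : Polynomial A →ₐ[A] L)
          (fun _ _ => .all _ _)
  have e1 : f.ev₂ ≫ pullback.fst _ _ = pullback.fst f.proj f.proj ≫ f.ev := pullback.lift_fst _ _ _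
  have e2 : f.ev₂ ≫ pullback.snd _ _ = pullback.snd f.proj f.proj ≫ f.ev := pullback.lift_snd _ _ _
  have k1 : (Spec.map (CommRingCat.ofHom ψ.toRingHom) ≫ v) ≫ pullback.fst f.proj f.proj =
      relPoint k A 1 z := by
    refine (Category.assoc _ _ _).trans ((congrArg (_ ≫ ·) hv1).trans ?_)
    rw [← hl, ← Category.assoc, ← Spec.map_comp, ← CommRingCat.ofHom_comp]
    congr 3
    ext <;> simp [ψ]
  have k2 : (Spec.map (CommRingCat.ofHom ψ.toRingHom) ≫ v) ≫ pullback.snd f.proj f.proj =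
      relPoint k A 1 w := by
    refine (Category.assoc _ _ _).trans ((congrArg (_ ≫ ·) hv2).trans ?_)
    rw [← hr, ← Category.assoc, ← Spec.map_comp, ← CommRingCat.ofHom_comp]
    congr 3
    ext <;> simp [ψ]
  refine pullback.hom_ext ?_ ?_
  · refine (Category.assoc _ _ _).trans ((congrArg (_ ≫ ·) e1).trans ?_)
    refine (Category.assoc _ _ _).symm.trans ((congrArg (· ≫ f.ev) k1).trans (el.trans ?_))
    rw [Category.assoc, ht1, ← Category.assoc, ← Spec.map_comp, ← CommRingCat.ofHom_comp]
    congr 3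
    refine RingHom.ext fun r => ?_
    exact (by simp : curvePoint k c a θ hz r = curvePoints k c a θ hz hw (r ⊗ₜ 1))
  · refine (Category.assoc _ _ _).trans ((congrArg (_ ≫ ·) e2).trans ?_)
    refine (Category.assoc _ _ _).symm.trans ((congrArg (· ≫ f.ev) k2).trans (er.trans ?_))
    rw [Category.assoc, ht2, ← Category.assoc, ← Spec.map_comp, ← CommRingCat.ofHom_comp]
    congr 3
    refine RingHom.ext fun r => ?_
    exact (by simp : curvePoint k c a θ hw r = curvePoints k c a θ hz hw (1 ⊗ₜ r))

lemma isDominant_curveFamily_ev₂ (hz : Transcendental A z) (hw : Transcendental A w)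
    (h : Function.Injective (curvePoints k c a θ hz hw)) :
    IsDominant (curveFamily k hn c hpos hbal a ha θ).ev₂ := by
  obtain ⟨v, t, -, -, -, ht, h1⟩ := exists_curveFamily_ev₂_eq (k := k) hn c hpos hbal a ha θ hz hw
  exact isDominant_of_comp_eq _ t _ (curvePoints k c a θ hz hw).toRingHom h h1

open TensorProduct in
lemma isDominantSeparable_curveFamily_ev₂ (hz : Transcendental A z) (hw : Transcendental A w)
    (hzw : AlgebraicIndependent A ![z, w])
    (h : Function.Injective (curvePoints k c a θ hz hw))
    [Algebra (FractionRing (ChartRing k (∅ : Finset N) ⊗[k] ChartRing k (∅ : Finset N))) L]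
    [Algebra.IsGeometricallyReduced
      (FractionRing (ChartRing k (∅ : Finset N) ⊗[k] ChartRing k (∅ : Finset N))) L]
    (halg : ∀ r, algebraMap
      (FractionRing (ChartRing k (∅ : Finset N) ⊗[k] ChartRing k (∅ : Finset N))) L
        (algebraMap _ _ r) = curvePoints k c a θ hz hw r) :
    IsDominantSeparable (curveFamily k hn c hpos hbal a ha θ).ev₂ := by
  obtain ⟨v, t, hv, hv', ht, ht', h1⟩ := exists_curveFamily_ev₂_eq (k := k) hn c hpos hbal a ha θ hz hw
  have h2 := Polynomial.lift_aeval_injective hzw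
  have : IsDomain (Polynomial A ⊗[A] Polynomial A) := h2.isDomain _
  have : IsDomain (ChartRing k (∅ : Finset N) ⊗[k] ChartRing k (∅ : Finset N)) := h.isDomain _
  exact isDominantSeparable_of_comp_eq
    (Y := pullback (pullback.fst (ProjLine.specStr k A) (projLineStructure k))
      (pullback.fst (ProjLine.specStr k A) (projLineStructure k))) _ v t _ h2 (curvePoints k c a θ hz hw).toRingHom h h1 halg

end SmoothFan

/-! ### Coordinates on the torus -/

section

variable {k Λ ι : Type*} [Field k] [AddCommMonoid Λ] (β : (ι →₀ ℕ) →+ Λ)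

/-- A subfield that contains the images of the variables of a Laurent polynomial ring contains the
images of all Laurent polynomials. -/
lemma AddMonoidAlgebra.algHom_mem_of_forall_mem {L : Type*} [Field L] [Algebra k L]
    (hneg : ∀ c, ∃ m, m + β c = 0) (hgen : ∀ m, ∃ c c', m + β c = β c')
    (Φ : AddMonoidAlgebra k Λ →ₐ[k] L) (S : IntermediateField k L)
    (h : ∀ i, Φ (.single (β (Finsupp.single i 1)) 1) ∈ S) (f : AddMonoidAlgebra k Λ) : Φ f ∈ S := by
  have hmul (m m' : Λ) : Φ (.single (m + m') 1) = Φ (.single m 1) * Φ (.single m' 1) := by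
    rw [← map_mul, AddMonoidAlgebra.single_mul_single, one_mul]
  have hβ (c : ι →₀ ℕ) : Φ (.single (β c) 1) ∈ S := by
    induction c using Finsupp.induction_linear with
    | zero =>
      rw [map_zero, ← AddMonoidAlgebra.one_def, map_one]
      exact S.one_mem
    | add f g hf hg =>
      rw [map_add, hmul]
      exact S.mul_mem hf hg
    | single i n =>
      have h1 : Finsupp.single i n = n • Finsupp.single i 1 := by simp
      rw [h1, map_nsmul]
      have h2 := AddMonoidAlgebra.single_pow (β (Finsupp.single i 1)) (1 : k) n
      rw [one_pow] at h2
      rw [← h2, map_pow]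
      exact pow_mem (h i) n
  induction f using AddMonoidAlgebra.induction_on with
  | of m =>
    obtain ⟨c, c', hc⟩ := hgen m
    obtain ⟨m', hm'⟩ := hneg c
    have h1 : Φ (.single (β c) 1) ≠ 0 := fun h0 => by
      have h2 := hmul m' (β c)
      rw [hm', h0, mul_zero, ← AddMonoidAlgebra.one_def, map_one] at h2
      exact one_ne_zero h2
    have h3 := hmul m (β c)
    rw [hc] at h3
    have h4 : Φ (.single m 1) = Φ (.single (β c') 1) / Φ (.single (β c) 1) := by
      rw [h3, mul_div_cancel_right₀ _ h1]
    exact (congrArg (· ∈ S) h4).mpr (S.div_mem (hβ c') (hβ c))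
  | add x y hx hy =>
    rw [map_add]
    exact S.add_mem hx hy
  | smul r x hx =>
    rw [map_smul]
    exact S.smul_mem hx

lemma IntermediateField.eq_top_of_isFractionRing {R K : Type*} [CommRing R] [Field K]
    [Algebra k K] [Algebra R K] [IsFractionRing R K] (S : IntermediateField k K)
    (h : ∀ r, algebraMap R K r ∈ S) : S = ⊤ := by
  refine eq_top_iff.2 fun x _ => ?_
  obtain ⟨a, b, -, rfl⟩ := IsFractionRing.div_surjective (A := R) x
  exact S.div_mem (h a) (h b)

open TensorProduct in
variable (k Λ) in
/-- The Laurent polynomials in two sets of variables. -/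
def AddMonoidAlgebra.prodToTensor :
    AddMonoidAlgebra k (Λ × Λ) →ₐ[k] AddMonoidAlgebra k Λ ⊗[k] AddMonoidAlgebra k Λ :=
  AddMonoidAlgebra.lift k _ (Λ × Λ)
    { toFun m := .single m.toAdd.1 1 ⊗ₜ .single m.toAdd.2 1
      map_one' := rfl
      map_mul' m m' := by
        simp [Algebra.TensorProduct.tmul_mul_tmul, AddMonoidAlgebra.single_mul_single] }

lemma AddMonoidAlgebra.prodToTensor_single (m : Λ × Λ) :
    AddMonoidAlgebra.prodToTensor k Λ (.single m 1) = .single m.1 1 ⊗ₜ .single m.2 1 := by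
  rw [prodToTensor, AddMonoidAlgebra.lift_single, one_smul]
  rfl

open TensorProduct in
lemma AddMonoidAlgebra.prodToTensor_surjective :
    Function.Surjective (AddMonoidAlgebra.prodToTensor k Λ) := by
  rw [← AlgHom.range_eq_top, eq_top_iff]
  rintro x -
  induction x using TensorProduct.induction_on with
  | zero => exact zero_mem _
  | add x y hx hy => exact add_mem hx hy
  | tmul f g =>
    induction f using AddMonoidAlgebra.induction_on with
    | of m =>
      induction g using AddMonoidAlgebra.induction_on with
      | of m' => exact ⟨.single (m, m') 1, prodToTensor_single _⟩
      | add x y hx hy => rw [tmul_add]; exact add_mem hx hy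
      | smul r x hx => rw [tmul_smul]; exact Subalgebra.smul_mem _ hx r
    | add x y hx hy => rw [add_tmul]; exact add_mem hx hy
    | smul r x hx => rw [← smul_tmul']; exact Subalgebra.smul_mem _ hx r

end

namespace SmoothFan

variable {N : Type} [AddCommGroup N] {ι : Type} (b : Module.Basis ι ℤ N)

lemma mem_dualMonoid_empty (m : Module.Dual ℤ N) : m ∈ dualMonoid (∅ : Finset N) :=
  fun _ hv => absurd hv (Finset.notMem_empty _)

/-- The monomials in the coordinates of the torus that belong to a basis. -/
def coordMonomial : (ι →₀ ℕ) →+ dualMonoid (∅ : Finset N) :=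
  Finsupp.liftAddHom fun i => multiplesHom _ ⟨b.coord i, mem_dualMonoid_empty _⟩

lemma coordMonomial_single (i : ι) :
    coordMonomial b (Finsupp.single i 1) = ⟨b.coord i, mem_dualMonoid_empty _⟩ := by
  simp [coordMonomial]

lemma coordMonomial_apply (c : ι →₀ ℕ) (i : ι) : (coordMonomial b c).1 (b i) = c i := by
  classical
  induction c using Finsupp.induction_linear with
  | zero => simp
  | add f g hf hg =>
    rw [map_add, Finsupp.add_apply, Nat.cast_add, ← hf, ← hg]
    rfl
  | single j n =>
    have h1 : Finsupp.single j n = n • Finsupp.single j 1 := by simp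
    rw [h1, map_nsmul, coordMonomial_single]
    change (n • b.coord j) (b i) = _
    simp [Finsupp.single_apply, eq_comm]

lemma exists_add_coordMonomial_eq_zero (c : ι →₀ ℕ) : ∃ m, m + coordMonomial b c = 0 :=
  ⟨⟨-(coordMonomial b c).1, mem_dualMonoid_empty _⟩, Subtype.ext (neg_add_cancel _)⟩

lemma exists_add_coordMonomial_eq [Fintype ι] (m : dualMonoid (∅ : Finset N)) :
    ∃ c c', m + coordMonomial b c = coordMonomial b c' := by
  refine ⟨Finsupp.equivFunOnFinite.symm fun i => (-m.1 (b i)).toNat,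
    Finsupp.equivFunOnFinite.symm fun i => (m.1 (b i)).toNat, Subtype.ext (b.ext fun i => ?_)⟩
  change m.1 (b i) + (coordMonomial b _).1 (b i) = _
  rw [coordMonomial_apply, coordMonomial_apply, Finsupp.equivFunOnFinite_symm_apply_apply,
    Finsupp.equivFunOnFinite_symm_apply_apply]
  omega

/-- The monomials in the coordinates of the product of two copies of the torus. -/
def coordMonomial₂ :
    (ι ⊕ ι →₀ ℕ) →+ dualMonoid (∅ : Finset N) × dualMonoid (∅ : Finset N) :=
  ((coordMonomial b).prodMap (coordMonomial b)).comp
    Finsupp.sumFinsuppAddEquivProdFinsupp.toAddMonoidHom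

lemma exists_add_coordMonomial₂_eq_zero (c : ι ⊕ ι →₀ ℕ) : ∃ m, m + coordMonomial₂ b c = 0 := by
  obtain ⟨m, hm⟩ := exists_add_coordMonomial_eq_zero b (Finsupp.sumFinsuppAddEquivProdFinsupp c).1
  obtain ⟨m', hm'⟩ :=
    exists_add_coordMonomial_eq_zero b (Finsupp.sumFinsuppAddEquivProdFinsupp c).2
  exact ⟨(m, m'), Prod.ext hm hm'⟩

lemma exists_add_coordMonomial₂_eq [Fintype ι]
    (m : dualMonoid (∅ : Finset N) × dualMonoid (∅ : Finset N)) :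
    ∃ c c', m + coordMonomial₂ b c = coordMonomial₂ b c' := by
  obtain ⟨c, c', h⟩ := exists_add_coordMonomial_eq b m.1
  obtain ⟨d, d', h'⟩ := exists_add_coordMonomial_eq b m.2
  refine ⟨Finsupp.sumFinsuppAddEquivProdFinsupp.symm (c, d),
    Finsupp.sumFinsuppAddEquivProdFinsupp.symm (c', d'), ?_⟩
  change m + (coordMonomial b).prodMap (coordMonomial b) (Finsupp.sumFinsuppAddEquivProdFinsupp _) =
    (coordMonomial b).prodMap (coordMonomial b) (Finsupp.sumFinsuppAddEquivProdFinsupp _)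
  rw [AddEquiv.apply_symm_apply, AddEquiv.apply_symm_apply]
  exact Prod.ext h h'

variable (k : Type u) [Field k]

/-- The coordinates of the torus that belong to a basis of the lattice. -/
def coordFun (i : ι) : ChartRing k (∅ : Finset N) :=
  .single ⟨b.coord i, mem_dualMonoid_empty _⟩ 1

open TensorProduct in
/-- The coordinates of the product of two copies of the torus. -/
def coordFun₂ : ι ⊕ ι → ChartRing k (∅ : Finset N) ⊗[k] ChartRing k (∅ : Finset N) :=
  Sum.elim (fun i => coordFun b k i ⊗ₜ 1) (fun i => 1 ⊗ₜ coordFun b k i)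

lemma prodToTensor_coordMonomial₂ (i : ι ⊕ ι) :
    AddMonoidAlgebra.prodToTensor k (dualMonoid (∅ : Finset N))
      (.single (coordMonomial₂ b (Finsupp.single i 1)) 1) = coordFun₂ b k i := by
  have h : coordMonomial₂ b (Finsupp.single i 1) =
      Sum.elim (fun i => (⟨b.coord i, mem_dualMonoid_empty _⟩, 0))
        (fun i => (0, ⟨b.coord i, mem_dualMonoid_empty _⟩)) i := by
    cases i with
    | inl i =>
      refine Prod.ext ?_ ?_
      · refine Eq.trans ?_ (coordMonomial_single b i)
        refine congrArg (coordMonomial b) ?_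
        ext; simp
      · refine Eq.trans ?_ (map_zero (coordMonomial b))
        refine congrArg (coordMonomial b) ?_
        ext; simp
    | inr i =>
      refine Prod.ext ?_ ?_
      · refine Eq.trans ?_ (map_zero (coordMonomial b))
        refine congrArg (coordMonomial b) ?_
        ext; simp
      · refine Eq.trans ?_ (coordMonomial_single b i)
        refine congrArg (coordMonomial b) ?_
        ext; simp
  rw [AddMonoidAlgebra.prodToTensor_single, h]
  cases i <;> rfl

variable {k} {L : Type*} [Field L] [Algebra k L]

variable [Fintype ι]

lemma injective_of_algebraicIndependent_coordFun (Φ : ChartRing k (∅ : Finset N) →ₐ[k] L)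
    (h : AlgebraicIndependent k fun i => Φ (coordFun b k i)) : Function.Injective Φ := by
  refine AddMonoidAlgebra.algHom_injective_of_algebraicIndependent (coordMonomial b)
    (exists_add_coordMonomial_eq_zero b) (exists_add_coordMonomial_eq b) Φ ?_
  simp only [coordMonomial_single]
  exact h

open TensorProduct in
lemma injective_of_algebraicIndependent_coordFun₂
    (Φ : ChartRing k (∅ : Finset N) ⊗[k] ChartRing k (∅ : Finset N) →ₐ[k] L)
    (h : AlgebraicIndependent k fun i => Φ (coordFun₂ b k i)) : Function.Injective Φ := by
  refine Function.Injective.of_comp_right (g := AddMonoidAlgebra.prodToTensor k _) ?_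
    AddMonoidAlgebra.prodToTensor_surjective
  rw [← AlgHom.coe_comp]
  refine AddMonoidAlgebra.algHom_injective_of_algebraicIndependent (coordMonomial₂ b)
    (exists_add_coordMonomial₂_eq_zero b) (exists_add_coordMonomial₂_eq b) _ ?_
  simpa only [AlgHom.comp_apply, prodToTensor_coordMonomial₂] using h

variable (k) in
lemma adjoin_coordFun_eq_top [IsDomain (ChartRing k (∅ : Finset N))] :
    IntermediateField.adjoin k (Set.range fun i =>
      algebraMap _ (FractionRing (ChartRing k (∅ : Finset N))) (coordFun b k i)) = ⊤ := by
  refine IntermediateField.eq_top_of_isFractionRing (R := ChartRing k (∅ : Finset N)) _ ?_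
  refine AddMonoidAlgebra.algHom_mem_of_forall_mem (coordMonomial b)
    (exists_add_coordMonomial_eq_zero b) (exists_add_coordMonomial_eq b)
    (IsScalarTower.toAlgHom k _ (FractionRing (ChartRing k (∅ : Finset N)))) _ fun i => ?_
  rw [coordMonomial_single]
  exact IntermediateField.subset_adjoin _ _ ⟨i, rfl⟩

open TensorProduct in
variable (k) in
lemma adjoin_coordFun₂_eq_top
    [IsDomain (ChartRing k (∅ : Finset N) ⊗[k] ChartRing k (∅ : Finset N))] :
    IntermediateField.adjoin k (Set.range fun i =>
      algebraMap _ (FractionRing (ChartRing k (∅ : Finset N) ⊗[k] ChartRing k (∅ : Finset N)))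
        (coordFun₂ b k i)) = ⊤ := by
  refine IntermediateField.eq_top_of_isFractionRing
    (R := ChartRing k (∅ : Finset N) ⊗[k] ChartRing k (∅ : Finset N)) _ fun r => ?_
  obtain ⟨f, rfl⟩ := AddMonoidAlgebra.prodToTensor_surjective r
  refine AddMonoidAlgebra.algHom_mem_of_forall_mem (coordMonomial₂ b)
    (exists_add_coordMonomial₂_eq_zero b) (exists_add_coordMonomial₂_eq b)
    ((IsScalarTower.toAlgHom k _ (FractionRing
      (ChartRing k (∅ : Finset N) ⊗[k] ChartRing k (∅ : Finset N)))).comp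
        (AddMonoidAlgebra.prodToTensor k _)) _ (fun i => ?_) f
  rw [AlgHom.comp_apply, prodToTensor_coordMonomial₂]
  exact IntermediateField.subset_adjoin _ _ ⟨i, rfl⟩

end SmoothFan

/-! ### Closures of subfields -/

section

variable {k G L : Type*} [Field k] [Field G] [Field L] [Algebra k G] [Algebra k L] [Algebra G L]
  [IsScalarTower k G L]

lemma isAlgebraic_of_restrictScalars_algebraicClosure_eq_top
    (h : (algebraicClosure G L).restrictScalars k = ⊤) : Algebra.IsAlgebraic G L :=
  ⟨fun x => mem_algebraicClosure_iff'.1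
    (show x ∈ (algebraicClosure G L).restrictScalars k from h ▸ trivial) |>.isAlgebraic⟩

lemma isSeparable_of_restrictScalars_separableClosure_eq_top
    (h : (separableClosure G L).restrictScalars k = ⊤) : Algebra.IsSeparable G L :=
  ⟨fun x => mem_separableClosure_iff.1
    (show x ∈ (separableClosure G L).restrictScalars k from h ▸ trivial)⟩

lemma mem_algebraicClosure_of_pow_mem {q : ℕ} (hq : q ≠ 0) {s : L}
    (h : s ^ q ∈ algebraicClosure G L) : s ∈ algebraicClosure G L := by
  rw [mem_algebraicClosure_iff'] at h ⊢
  exact h.of_pow (Nat.pos_of_ne_zero hq)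

lemma mem_separableClosure_of_pow_mem {q : ℕ} (hq : (q : G) ≠ 0) {s : L} (hs : s ≠ 0)
    (h : s ^ q ∈ separableClosure G L) : s ∈ separableClosure G L := by
  have hq' : (q : separableClosure G L) ≠ 0 := by
    rw [← map_natCast (algebraMap G (separableClosure G L))]
    exact (map_ne_zero _).2 hq
  rw [mem_separableClosure_iff]
  exact IsSeparable.of_algebra_isSeparable_of_isSeparable G
    (isSeparable_of_pow_mem hq' hs ⟨⟨_, h⟩, rfl⟩)

end

/-! ### Function fields of the families of curves -/

namespace SmoothFan

variable {N : Type} [AddCommGroup N] {F : SmoothFan N}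
  {ι : Type} (b : Module.Basis ι ℤ N)
  {k : Type u} [Field k] {A : Type u} [CommRing A] [IsDomain A] [Algebra k A]
  {n : ℕ} (c : Fin n → F.ContactOrder) (a : Fin n → A)
  (θ : Multiplicative (Module.Dual ℤ N) →* Aˣ)
  {L : Type u} [Field L] [Algebra A L] [Algebra k L] [IsScalarTower k A L] {z w : L}

lemma curvePoint_coordFun (hz : Transcendental A z) (i : ι) :
    curvePoint k c a θ hz (coordFun b k i) = algebraMap A L (θ (.ofAdd (b.coord i))) *
      ∏ l, (z - algebraMap A L (a l)) ^ b.coord i (c l).latticePoint := by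
  rw [coordFun, RationalCurve.torusPoint_single, map_one, one_mul]

lemma algebraMap_units_ne_zero {A L : Type*} [CommRing A] [Field L] [Algebra A L] (x : Aˣ) : algebraMap A L x ≠ 0 :=
  (x.isUnit.map (algebraMap A L)).ne_zero

section TwoPoints

variable [Fintype ι] [DecidableEq ι] {e : ι ↪ Fin n} {q : ℕ} {μ : ι → ι → ℤ} {ι' : Type*} [Finite ι']
  {u : ι' → L}

lemma eq_top_of_curvePoints_mem (hz : Transcendental A z) (hw : Transcendental A w) (hzw : z ≠ w)
    (hconst : ∀ j ∉ Set.range e, ∃ r : k, a j = algebraMap k A r)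
    (htop : IntermediateField.adjoin k
      (Set.range (fun i => algebraMap A L (θ (.ofAdd (b.coord i)))) ∪
        Set.range (fun i => algebraMap A L (a (e i))) ∪ {z, w}) = ⊤)
    (hμ : ∀ i l, ∑ i', μ i i' * b.coord i' (c (e l)).latticePoint = if i = l then (q : ℤ) else 0)
    (S : IntermediateField k L) (hzS : z ∈ S) (hwS : w ∈ S)
    (hS : ∀ i, curvePoints k c a θ hz hw (coordFun₂ b k i) ∈ S)
    (hq : ∀ s : L, s ≠ 0 → s ^ q ∈ S → s ∈ S) : S = ⊤ := by
  refine eq_top_of_two_points S e (fun j => algebraMap A L (a j))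
    (fun i => algebraMap A L (θ (.ofAdd (b.coord i)))) z w (fun j hj => ?_)
    (fun j => sub_algebraMap_ne_zero_of_transcendental hz _)
    (fun j => sub_algebraMap_ne_zero_of_transcendental hw _) hzw hzS hwS
    (fun i => algebraMap_units_ne_zero _) (fun i j => b.coord i (c j).latticePoint)
    (fun i => ?_) (fun i => ?_) q μ hμ hq htop
  · obtain ⟨r, hr⟩ := hconst j hj
    rw [hr, ← IsScalarTower.algebraMap_apply]
    exact S.algebraMap_mem r
  · have := hS (.inl i)
    simpa [coordFun₂, curvePoint_coordFun] using this
  · have := hS (.inr i)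
    simpa [coordFun₂, curvePoint_coordFun] using this

theorem curvePoints_injective (hz : Transcendental A z) (hw : Transcendental A w) (hzw : z ≠ w)
    (hconst : ∀ j ∉ Set.range e, ∃ r : k, a j = algebraMap k A r)
    (htop : IntermediateField.adjoin k
      (Set.range (fun i => algebraMap A L (θ (.ofAdd (b.coord i)))) ∪
        Set.range (fun i => algebraMap A L (a (e i))) ∪ {z, w}) = ⊤)
    (hμ : ∀ i l, ∑ i', μ i i' * b.coord i' (c (e l)).latticePoint = if i = l then (q : ℤ) else 0)
    (hu : IsTranscendenceBasis k u) (hcard : Nat.card ((ι ⊕ ι) ⊕ Fin 2) = Nat.card ι')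
    (hq : q ≠ 0) : Function.Injective (curvePoints k c a θ hz hw) := by
  let x : (ι ⊕ ι) ⊕ Fin 2 → L :=
    Sum.elim (fun i => curvePoints k c a θ hz hw (coordFun₂ b k i)) ![z, w]
  let G := IntermediateField.adjoin k (Set.range x)
  have hG (i) : x i ∈ (algebraicClosure G L).restrictScalars k :=
    (algebraicClosure G L).algebraMap_mem ⟨x i, IntermediateField.subset_adjoin _ _ ⟨i, rfl⟩⟩
  have h1 := eq_top_of_curvePoints_mem b c a θ hz hw hzw hconst htop hμ
    ((algebraicClosure G L).restrictScalars k) (hG (.inr 0)) (hG (.inr 1)) (fun i => hG (.inl i))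
    (fun s _ hs => mem_algebraicClosure_of_pow_mem hq hs)
  have : Algebra.IsAlgebraic G L := isAlgebraic_of_restrictScalars_algebraicClosure_eq_top h1
  have h2 : AlgebraicIndependent k x := hu.algebraicIndependent_of_card_le hcard.le
  exact injective_of_algebraicIndependent_coordFun₂ b _
    (h2.comp Sum.inl Sum.inl_injective)

variable [Module.Free ℤ N] [Algebra.FiniteType k A] (hn : 0 < n) (hpos : ∀ j, (c j).IsPositive)
  (hbal : ∑ j, (c j).latticePoint = 0) (ha : ∀ i j, i ≠ j → IsUnit (a i - a j))

open TensorProduct in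
theorem isDominantSeparable_curveFamily_ev₂_of_ne_zero [Algebra.EssFiniteType k L]
    (hz : Transcendental A z) (hw : Transcendental A w)
    (hzw : AlgebraicIndependent A ![z, w])
    (hconst : ∀ j ∉ Set.range e, ∃ r : k, a j = algebraMap k A r)
    (htop : IntermediateField.adjoin k
      (Set.range (fun i => algebraMap A L (θ (.ofAdd (b.coord i)))) ∪
        Set.range (fun i => algebraMap A L (a (e i))) ∪ {z, w}) = ⊤)
    (hμ : ∀ i l, ∑ i', μ i i' * b.coord i' (c (e l)).latticePoint = if i = l then (q : ℤ) else 0)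
    (hu : IsTranscendenceBasis k u) (hcard : Nat.card ((ι ⊕ ι) ⊕ Fin 2) = Nat.card ι')
    (hq : (q : k) ≠ 0) :
    IsDominantSeparable (curveFamily k hn c hpos hbal a ha θ).ev₂ := by
  have hne : z ≠ w := fun h => by simpa using hzw.injective (a₁ := 0) (a₂ := 1) h
  have hinj := curvePoints_injective b c a θ hz hw hne hconst htop hμ hu hcard
    (fun h => hq (by rw [h, Nat.cast_zero]))
  let R := ChartRing k (∅ : Finset N) ⊗[k] ChartRing k (∅ : Finset N)
  have : IsDomain R := hinj.isDomain (curvePoints k c a θ hz hw)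
  let K := FractionRing R
  let Φ : K →ₐ[k] L := IsFractionRing.liftAlgHom hinj
  have hΦ (r : R) : Φ (algebraMap R K r) = curvePoints k c a θ hz hw r :=
    IsFractionRing.lift_algebraMap hinj r
  let : Algebra K L := Φ.toRingHom.toAlgebra
  have : IsScalarTower k K L := .of_algebraMap_eq fun r => (Φ.commutes r).symm
  have : Algebra.EssFiniteType K L := .of_comp k K L
  let G := IntermediateField.adjoin K (Set.range ![z, w])
  have : IsScalarTower k G L := .of_algebraMap_eq fun r => rfl
  have hG (y : L) (hy : y ∈ G) : y ∈ (separableClosure G L).restrictScalars k :=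
    (separableClosure G L).algebraMap_mem ⟨y, hy⟩
  have hyG (i) : ![z, w] i ∈ G := IntermediateField.subset_adjoin _ _ ⟨i, rfl⟩
  have h1 := eq_top_of_curvePoints_mem b c a θ hz hw hne hconst htop hμ
    ((separableClosure G L).restrictScalars k) (hG _ (hyG 0)) (hG _ (hyG 1))
    (fun i => hG _ (hΦ (coordFun₂ b k i) ▸ G.algebraMap_mem _))
    (fun s h0 hs => mem_separableClosure_of_pow_mem (q := q) (by
      rw [← map_natCast (algebraMap k G)]
      exact (map_ne_zero _).2 hq) h0 hs)
  have : Algebra.IsSeparable G L := isSeparable_of_restrictScalars_separableClosure_eq_top h1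
  have := isGeometricallyReduced_of_card_eq (K := K) hu (adjoin_coordFun₂_eq_top b k)
    (y := ![z, w]) (by rw [← hcard, Nat.card_sum (α := ι ⊕ ι)])
  exact isDominantSeparable_curveFamily_ev₂ hn c hpos hbal a ha θ hz hw hzw hinj hΦ

end TwoPoints

section OnePoint

variable {ι' : Type*} [Finite ι'] {u : ι' → L} (a₀ : Fin n → k) (i₀ : ι)

lemma eq_top_of_curvePoint_mem (hz : Transcendental A z)
    (htop : IntermediateField.adjoin k
      (Set.range (fun i => algebraMap A L (θ (.ofAdd (b.coord i)))) ∪ {z}) = ⊤)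
    (S : IntermediateField k L) (hzS : z ∈ S)
    (hS : ∀ i, curvePoint k c (fun j => algebraMap k A (a₀ j)) θ hz (coordFun b k i) ∈ S) :
    S = ⊤ := by
  rw [eq_top_iff, ← htop, IntermediateField.adjoin_le_iff]
  rintro y (⟨i, rfl⟩ | rfl)
  · have h1 := hS i
    rw [curvePoint_coordFun] at h1
    have h2 : ∏ l, (z - algebraMap A L (algebraMap k A (a₀ l))) ^ b.coord i (c l).latticePoint ≠ 0 :=
      Finset.prod_ne_zero_iff.2 fun l _ =>
        zpow_ne_zero _ (sub_algebraMap_ne_zero_of_transcendental hz _)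
    have h3 : ∏ l, (z - algebraMap A L (algebraMap k A (a₀ l))) ^ b.coord i (c l).latticePoint ∈ S :=
      S.prod_mem fun l _ => zpow_mem (S.sub_mem hzS (by
        rw [← IsScalarTower.algebraMap_apply]
        exact S.algebraMap_mem _)) _
    have h4 := S.div_mem h1 h3
    rwa [mul_div_cancel_right₀ _ h2] at h4
  · exact hzS

variable [Fintype ι]

theorem curvePoint_injective (ha₀ : Function.Injective a₀) (hz : Transcendental A z)
    (htop : IntermediateField.adjoin k
      (Set.range (fun i => algebraMap A L (θ (.ofAdd (b.coord i)))) ∪ {z}) = ⊤)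
    (hθ : θ (.ofAdd (b.coord i₀)) = 1) {j₀ : Fin n}
    (hj₀ : b.coord i₀ (c j₀).latticePoint ≠ 0)
    (hu : IsTranscendenceBasis k u) (hcard : Nat.card ι = Nat.card ι') :
    Function.Injective (curvePoint k c (fun j => algebraMap k A (a₀ j)) θ hz) := by
  let x : ι → L := fun i => curvePoint k c (fun j => algebraMap k A (a₀ j)) θ hz (coordFun b k i)
  let G := IntermediateField.adjoin k (Set.range x)
  have hG (i) : x i ∈ G := IntermediateField.subset_adjoin _ _ ⟨i, rfl⟩
  have hxz : algebraMap G L ⟨x i₀, hG i₀⟩ =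
      ∏ j, (z - algebraMap G L (algebraMap k G (a₀ j))) ^ b.coord i₀ (c j).latticePoint := by
    refine (curvePoint_coordFun b c _ θ hz i₀).trans ?_
    rw [hθ, Units.val_one, map_one, one_mul]
    refine Finset.prod_congr rfl fun j _ => ?_
    rw [← IsScalarTower.algebraMap_apply k A L, ← IsScalarTower.algebraMap_apply k G L]
  have hzG : IsAlgebraic G z := isAlgebraic_of_prod_zpow_eq
    ((algebraMap k G).injective.comp ha₀) (fun j => by
      rw [Function.comp_apply, ← IsScalarTower.algebraMap_apply, IsScalarTower.algebraMap_apply k A L]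
      exact sub_algebraMap_ne_zero_of_transcendental hz _) hxz ⟨j₀, hj₀⟩
  have h1 := eq_top_of_curvePoint_mem b c θ a₀ hz htop
    ((algebraicClosure G L).restrictScalars k) (mem_algebraicClosure_iff'.2 hzG.isIntegral)
    (fun i => (algebraicClosure G L).algebraMap_mem ⟨x i, hG i⟩)
  have : Algebra.IsAlgebraic G L := isAlgebraic_of_restrictScalars_algebraicClosure_eq_top h1
  exact injective_of_algebraicIndependent_coordFun b _
    (hu.algebraicIndependent_of_card_le hcard.le)

variable [Module.Free ℤ N] [Algebra.FiniteType k A] (hn : 0 < n) (hpos : ∀ j, (c j).IsPositive)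
  (hbal : ∑ j, (c j).latticePoint = 0)
  (ha : ∀ i j, i ≠ j → IsUnit (algebraMap k A (a₀ i) - algebraMap k A (a₀ j)))

theorem isDominantSeparable_curveFamily_ev_of_ne_zero [Algebra.EssFiniteType k L]
    (ha₀ : Function.Injective a₀) (hz : Transcendental A z)
    (htop : IntermediateField.adjoin k
      (Set.range (fun i => algebraMap A L (θ (.ofAdd (b.coord i)))) ∪ {z}) = ⊤)
    (hθ : θ (.ofAdd (b.coord i₀)) = 1) {j₀ : Fin n}
    (hj₀ : (b.coord i₀ (c j₀).latticePoint : k) ≠ 0)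
    (hu : IsTranscendenceBasis k u) (hcard : Nat.card ι = Nat.card ι') :
    IsDominantSeparable
      (curveFamily k hn c hpos hbal (fun j => algebraMap k A (a₀ j)) ha θ).ev := by
  have hinj := curvePoint_injective b c θ a₀ i₀ ha₀ hz htop hθ (j₀ := j₀)
    (fun h => hj₀ (by rw [h, Int.cast_zero])) hu hcard
  let R := ChartRing k (∅ : Finset N)
  have : IsDomain R := hinj.isDomain (curvePoint k c _ θ hz)
  let K := FractionRing R
  let Φ : K →ₐ[k] L := IsFractionRing.liftAlgHom hinj
  have hΦ (r : R) : Φ (algebraMap R K r) = curvePoint k c _ θ hz r :=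
    IsFractionRing.lift_algebraMap hinj r
  let : Algebra K L := Φ.toRingHom.toAlgebra
  have : IsScalarTower k K L := .of_algebraMap_eq fun r => (Φ.commutes r).symm
  have : Algebra.EssFiniteType K L := .of_comp k K L
  let G := IntermediateField.adjoin K (Set.range (Fin.elim0 : Fin 0 → L))
  have : IsScalarTower k G L := .of_algebraMap_eq fun r => rfl
  have hxz : algebraMap G L (algebraMap K G (algebraMap R K (coordFun b k i₀))) =
      ∏ j, (z - algebraMap G L (algebraMap k G (a₀ j))) ^ b.coord i₀ (c j).latticePoint := by
    rw [← IsScalarTower.algebraMap_apply K G L]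
    refine (hΦ _).trans ((curvePoint_coordFun b c _ θ hz i₀).trans ?_)
    rw [hθ, Units.val_one, map_one, one_mul]
    refine Finset.prod_congr rfl fun j _ => ?_
    rw [← IsScalarTower.algebraMap_apply k A L, ← IsScalarTower.algebraMap_apply k G L]
  have hzk : Transcendental k z := fun h => hz (h.extendScalars (algebraMap k A).injective)
  have hzG : IsSeparable G z := isSeparable_of_prod_zpow_eq (fun j => by
      rw [← IsScalarTower.algebraMap_apply, IsScalarTower.algebraMap_apply k A L]
      exact sub_algebraMap_ne_zero_of_transcendental hz _) hxz (by
      have := sum_div_sub_ne_zero ha₀ hzk (m := fun j => b.coord i₀ (c j).latticePoint) hj₀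
      simpa only [← IsScalarTower.algebraMap_apply k G L] using this)
  have h1 := eq_top_of_curvePoint_mem b c θ a₀ hz htop
    ((separableClosure G L).restrictScalars k) (mem_separableClosure_iff.2 hzG)
    (fun i => hΦ (coordFun b k i) ▸
      (separableClosure G L).algebraMap_mem ⟨_, G.algebraMap_mem (algebraMap R K (coordFun b k i))⟩)
  have : Algebra.IsSeparable G L := isSeparable_of_restrictScalars_separableClosure_eq_top h1
  have := isGeometricallyReduced_of_card_eq (K := K) hu (adjoin_coordFun_eq_top b k)
    (y := (Fin.elim0 : Fin 0 → L)) (by rw [← hcard, Nat.card_fin, add_zero])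
  exact isDominantSeparable_curveFamily_ev hn c hpos hbal _ ha θ hz hinj hΦ

end OnePoint

end SmoothFan

/-! ### Purely transcendental function fields -/

section

open scoped IntermediateField.algebraAdjoinAdjoin in
/-- Independent variables stay independent over a ring of functions in the other variables. -/
lemma AlgebraicIndependent.of_sumElim_of_forall_mem {k A L ι κ : Type*} [Field k] [CommRing A]
    [Field L] [Algebra k L] [Algebra A L] {x : ι → L} {y : κ → L}
    (h : AlgebraicIndependent k (Sum.elim y x)) (hA : Function.Injective (algebraMap A L))
    (hx : ∀ a, algebraMap A L a ∈ IntermediateField.adjoin k (Set.range x)) :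
    AlgebraicIndependent A y := by
  have h1 := (AlgebraicIndependent.sumElim_iff.1 h).2
  let E := IntermediateField.adjoin k (Set.range x)
  have : Algebra.IsAlgebraic (Algebra.adjoin k (Set.range x)) E :=
    IsLocalization.isAlgebraic _ (nonZeroDivisors _)
  have h2 : AlgebraicIndependent E y := h1.extendScalars E
  let : Algebra A E := ((algebraMap A L).codRestrict E hx).toAlgebra
  have : IsScalarTower A E L := .of_algebraMap_eq fun _ => rfl
  exact h2.restrictScalars (R := A) fun a a' haa => hA (congrArg (algebraMap E L) haa)

variable {k : Type*} [Field k] {σ : Type*}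

lemma IntermediateField.eq_top_of_forall_X_mem
    (S : IntermediateField k (FractionRing (MvPolynomial σ k)))
    (h : ∀ i, algebraMap (MvPolynomial σ k) _ (MvPolynomial.X i) ∈ S) : S = ⊤ := by
  refine S.eq_top_of_isFractionRing (R := MvPolynomial σ k) fun r => ?_
  induction r using MvPolynomial.induction_on with
  | C r =>
    have h1 : algebraMap (MvPolynomial σ k) (FractionRing (MvPolynomial σ k)) (MvPolynomial.C r) =
        algebraMap k _ r := (IsScalarTower.algebraMap_apply k (MvPolynomial σ k) _ r).symm
    exact h1 ▸ S.algebraMap_mem r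
  | add p q hp hq => rw [map_add]; exact S.add_mem hp hq
  | mul_X p i hp => rw [map_mul]; exact S.mul_mem hp (h i)

variable (k σ) in
lemma isTranscendenceBasis_fractionRing_X : IsTranscendenceBasis k fun i : σ =>
    algebraMap (MvPolynomial σ k) (FractionRing (MvPolynomial σ k)) (MvPolynomial.X i) :=
  have : Algebra.IsAlgebraic (MvPolynomial σ k) (FractionRing (MvPolynomial σ k)) :=
    IsLocalization.isAlgebraic _ (nonZeroDivisors _)
  (IsTranscendenceBasis.mvPolynomial σ k).algebraMap_comp

end

/-! ### Minors of lattice vectors -/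

section Minors

variable {N : Type*} [AddCommGroup N] {ι : Type*} [Fintype ι] [DecidableEq ι]
  (b : Module.Basis ι ℤ N) {n : ℕ} (v : Fin n → N)

/-- If the index of the lattice generated by `v` is not zero in a field, then some maximal minor of
`v` is not zero in that field. -/
lemma exists_det_ne_zero (E : Type*) [Field E]
    (h : (Nat.card (N ⧸ Submodule.span ℤ (Set.range v)) : E) ≠ 0) :
    ∃ e : ι ↪ Fin n, ((Matrix.of fun i l => b.coord i (v (e l))).det : E) ≠ 0 := by
  set Λ := Submodule.span ℤ (Set.range v)
  let T : N →+ (ι → E) :=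
    { toFun x i := (b.coord i x : E)
      map_zero' := by ext; simp
      map_add' x y := by ext; simp }
  let S : Submodule E (ι → E) := Submodule.span E (Set.range (T ∘ v))
  have hT (x) (hx : x ∈ Λ) : T x ∈ S := by
    induction hx using Submodule.span_induction with
    | mem x hx =>
      obtain ⟨j, rfl⟩ := hx
      exact Submodule.subset_span ⟨j, rfl⟩
    | zero => rw [map_zero]; exact S.zero_mem
    | add x y _ _ hx hy => rw [map_add]; exact S.add_mem hx hy
    | smul r x _ hx => rw [map_zsmul]; exact zsmul_mem hx r
  have hS : S = ⊤ := by
    rw [eq_top_iff, ← (Pi.basisFun E ι).span_eq, Submodule.span_le]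
    rintro - ⟨i, rfl⟩
    have h1 : Nat.card (N ⧸ Λ) • b i ∈ Λ := by
      rw [← Submodule.Quotient.mk_eq_zero, Submodule.Quotient.mk_smul]
      exact card_nsmul_eq_zero'
    have h2 := hT _ h1
    have h3 : T (b i) = Pi.basisFun E ι i := by
      ext i'
      simp [T, Finsupp.single_apply, Pi.single_apply, eq_comm]
    rw [map_nsmul, h3, ← Nat.cast_smul_eq_nsmul E] at h2
    exact (S.smul_mem_iff h).1 h2
  obtain ⟨κ, f, hf, hspan, hli⟩ := exists_linearIndependent' E (T ∘ v)
  have : Finite κ := Finite.of_injective f hf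
  have := Fintype.ofFinite κ
  let B : Module.Basis κ E (ι → E) := .mk hli (by rw [hspan]; exact hS.ge)
  let g : ι ≃ κ := (Pi.basisFun E ι).indexEquiv B
  refine ⟨g.toEmbedding.trans ⟨f, hf⟩, ?_⟩
  have h4 : LinearIndependent E (Matrix.of fun i l => (b.coord i (v (f (g l))) : E)).col :=
    hli.comp g g.injective
  rw [Matrix.linearIndependent_cols_iff_isUnit, Matrix.isUnit_iff_isUnit_det] at h4
  have h5 := RingHom.map_det (Int.castRingHom E) (Matrix.of fun i l => b.coord i (v (f (g l))))
  intro h6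
  refine h4.ne_zero ?_
  refine Eq.trans ?_ (h5.symm.trans h6)
  rfl

/-- The adjugate of a minor, up to a sign. -/
lemma exists_mul_eq_natAbs_det (M : Matrix ι ι ℤ) :
    ∃ μ : ι → ι → ℤ, ∀ i l, ∑ i', μ i i' * M i' l = if i = l then (M.det.natAbs : ℤ) else 0 := by
  refine ⟨fun i i' => M.det.sign * M.adjugate i i', fun i l => ?_⟩
  have h := congrFun (congrFun M.adjugate_mul i) l
  rw [Matrix.mul_apply, Matrix.smul_apply, Matrix.one_apply] at h
  simp_rw [mul_assoc, ← Finset.mul_sum, h]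
  split_ifs
  · rw [smul_eq_mul, mul_one, Int.sign_mul_self_eq_natAbs]
  · simp

end Minors

/-! ### The families of curves -/

namespace SmoothFan

variable {N : Type} [AddCommGroup N] {ι : Type} [Fintype ι] (b : Module.Basis ι ℤ N)

/-- The homomorphism on the character lattice with prescribed values on a dual basis. -/
def latticeCharacter {U : Type*} [CommGroup U] (τ : ι → U) :
    Multiplicative (Module.Dual ℤ N) →* U where
  toFun m := ∏ i, τ i ^ m.toAdd (b i)
  map_one' := by simp
  map_mul' m m' := by simp [zpow_add, Finset.prod_mul_distrib]

lemma latticeCharacter_coord {U : Type*} [CommGroup U] (τ : ι → U) (i : ι) :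
    latticeCharacter b τ (.ofAdd (b.coord i)) = τ i := by
  classical
  change ∏ i', τ i' ^ b.coord i (b i') = _
  rw [Finset.prod_eq_single i]
  · simp
  · intro i' _ h
    simp [h]
  · simp

variable [Module.Free ℤ N] {F : SmoothFan N} {k : Type u} [Field k] {n : ℕ}

/-- The curves that move through two general points, if the contact orders generate a lattice of full
rank: the leading coefficients and the positions of a maximal independent set of markings vary. -/
theorem exists_family_isDominant_ev₂ [DecidableEq ι] [Infinite k]
    (hn : 0 < n) (c : Fin n → F.ContactOrder) (hpos : ∀ j, (c j).IsPositive)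
    (hbal : ∑ j, (c j).latticePoint = 0)
    {e : ι ↪ Fin n} {q : ℕ} {μ : ι → ι → ℤ}
    (hμ : ∀ i l, ∑ i', μ i i' * b.coord i' (c (e l)).latticePoint = if i = l then (q : ℤ) else 0)
    (hq : q ≠ 0) :
    ∃ f : LogMapFamily (F.toricStructure k) (F.toricDivisor k) (fun j => (c j).mult),
      IsDominant f.ev₂ ∧ ((q : k) ≠ 0 → IsDominantSeparable f.ev₂) := by
  let L := FractionRing (MvPolynomial (Fin 2 ⊕ (ι ⊕ ι)) k)
  let u : Fin 2 ⊕ (ι ⊕ ι) → L := fun i =>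
    algebraMap (MvPolynomial (Fin 2 ⊕ (ι ⊕ ι)) k) _ (MvPolynomial.X i)
  have hu : IsTranscendenceBasis k u := isTranscendenceBasis_fractionRing_X k _
  let z := u (.inl 0)
  let w := u (.inl 1)
  let t : ι → L := fun i => u (.inr (.inl i))
  let p : ι → L := fun i => u (.inr (.inr i))
  have hzw : ![z, w] = u ∘ Sum.inl := by
    ext i; fin_cases i <;> rfl
  let a₀ : Fin n → k := (Infinite.natEmbedding k) ∘ Fin.val
  have ha₀ : Function.Injective a₀ := (Infinite.natEmbedding k).injective.comp Fin.val_injective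
  let α : Fin n → L := Function.extend e p fun j => algebraMap k L (a₀ j)
  have hαe (i) : α (e i) = p i := e.injective.extend_apply _ _ _
  have hα0 (j) (hj : j ∉ Set.range e) : α j = algebraMap k L (a₀ j) :=
    Function.extend_apply' _ _ _ hj
  have hpr (i : ι) (r : k) : p i ≠ algebraMap k L r := fun h =>
    hu.1.transcendental (.inr (.inr i)) (h ▸ isAlgebraic_algebraMap r : IsAlgebraic k (p i))
  have hα : Function.Injective α := by
    intro j j' h
    by_cases hj : j ∈ Set.range e <;> by_cases hj' : j' ∈ Set.range e
    · obtain ⟨i, rfl⟩ := hj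
      obtain ⟨i', rfl⟩ := hj'
      rw [hαe, hαe] at h
      have := hu.1.injective h
      simp only [Sum.inr.injEq] at this
      rw [this]
    · obtain ⟨i, rfl⟩ := hj
      rw [hαe, hα0 _ hj'] at h
      exact (hpr _ _ h).elim
    · obtain ⟨i, rfl⟩ := hj'
      rw [hαe, hα0 _ hj] at h
      exact (hpr _ _ h.symm).elim
    · rw [hα0 _ hj, hα0 _ hj'] at h
      exact ha₀ ((algebraMap k L).injective h)
  let s : Set L := Set.range t ∪ Set.range (fun i => (t i)⁻¹) ∪ Set.range α ∪
    Set.range fun i : Fin n × Fin n => (α i.1 - α i.2)⁻¹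
  have hs : s.Finite := (((Set.finite_range _).union (Set.finite_range _)).union
    (Set.finite_range _)).union (Set.finite_range _)
  let A := Algebra.adjoin k s
  have : Algebra.FiniteType k A := by
    rw [← Subalgebra.fg_iff_finiteType, show A = Algebra.adjoin k (hs.toFinset : Set L) by simp [A]]
    exact Subalgebra.fg_adjoin_finset _
  have hA {y : L} (hy : y ∈ s) : y ∈ A := Algebra.subset_adjoin hy
  let E := IntermediateField.adjoin k (Set.range (u ∘ Sum.inr))
  have huE (i) : u (.inr i) ∈ E := IntermediateField.subset_adjoin _ _ ⟨i, rfl⟩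
  have hαE (j) : α j ∈ E := by
    by_cases hj : j ∈ Set.range e
    · obtain ⟨i, rfl⟩ := hj
      exact hαe i ▸ huE _
    · exact hα0 j hj ▸ E.algebraMap_mem _
  have hAE (y : A) : algebraMap A L y ∈ E := by
    have h1 : A ≤ E.toSubalgebra := by
      refine Algebra.adjoin_le ?_
      rintro y (((⟨i, rfl⟩ | ⟨i, rfl⟩) | ⟨j, rfl⟩) | ⟨j, rfl⟩)
      · exact huE _
      · exact E.inv_mem (huE _)
      · exact hαE j
      · exact E.inv_mem (E.sub_mem (hαE _) (hαE _))
    exact h1 y.2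
  have hind : AlgebraicIndependent A ![z, w] := by
    rw [hzw]
    refine AlgebraicIndependent.of_sumElim_of_forall_mem (x := u ∘ Sum.inr) ?_
      Subtype.val_injective hAE
    rw [Sum.elim_comp_inl_inr]
    exact hu.1
  have hz : Transcendental A z := hind.transcendental 0
  have hw : Transcendental A w := hind.transcendental 1
  have ht0 (i) : t i ≠ 0 := hu.1.ne_zero _
  let τ : ι → Aˣ := fun i =>
    ⟨⟨t i, hA (.inl (.inl (.inl ⟨i, rfl⟩)))⟩, ⟨(t i)⁻¹, hA (.inl (.inl (.inr ⟨i, rfl⟩)))⟩,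
      Subtype.ext (mul_inv_cancel₀ (ht0 i)), Subtype.ext (inv_mul_cancel₀ (ht0 i))⟩
  let a : Fin n → A := fun j => ⟨α j, hA (.inl (.inr ⟨j, rfl⟩))⟩
  have ha : ∀ i j, i ≠ j → IsUnit (a i - a j) := fun i j hij =>
    .of_mul_eq_one ⟨(α i - α j)⁻¹, hA (.inr ⟨(i, j), rfl⟩)⟩
      (Subtype.ext (mul_inv_cancel₀ (sub_ne_zero.2 (hα.ne hij))))
  let θ := latticeCharacter b τ
  have hθ (i) : algebraMap A L (θ (.ofAdd (b.coord i))) = t i :=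
    congrArg (fun x : Aˣ => algebraMap A L x) (latticeCharacter_coord b τ i)
  have hconst : ∀ j ∉ Set.range e, ∃ r : k, a j = algebraMap k A r := fun j hj =>
    ⟨a₀ j, Subtype.ext (hα0 j hj)⟩
  have htop : IntermediateField.adjoin k
      (Set.range (fun i => algebraMap A L (θ (.ofAdd (b.coord i)))) ∪
        Set.range (fun i => algebraMap A L (a (e i))) ∪ {z, w}) = ⊤ := by
    refine IntermediateField.eq_top_of_forall_X_mem _ fun i => IntermediateField.subset_adjoin _ _ ?_
    rcases i with i | i | i
    · right
      fin_cases i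
      · exact .inl rfl
      · exact .inr rfl
    · exact .inl (.inl ⟨i, hθ i⟩)
    · exact .inl (.inr ⟨i, hαe i⟩)
  have hcard : Nat.card ((ι ⊕ ι) ⊕ Fin 2) = Nat.card (Fin 2 ⊕ (ι ⊕ ι)) :=
    Nat.card_congr (Equiv.sumComm _ _)
  refine ⟨curveFamily k hn c hpos hbal a ha θ, ?_, fun hqk => ?_⟩
  · exact isDominant_curveFamily_ev₂ hn c hpos hbal a ha θ hz hw
      (curvePoints_injective b c a θ hz hw
        (fun h => by simpa using hind.injective (a₁ := 0) (a₂ := 1) h) hconst htop hμ hu hcard hq)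
  · exact isDominantSeparable_curveFamily_ev₂_of_ne_zero b c a θ hn hpos hbal ha hz hw hind hconst
      htop hμ hu hcard hqk

instance finiteType_chartRing_empty [Module.Finite ℤ N] :
    Algebra.FiniteType k (ChartRing k (∅ : Finset N)) := by
  have : AddMonoid.FG (Module.Dual ℤ N) :=
    AddGroup.fg_iff_addMonoid_fg.1 (Module.Finite.iff_addGroup_fg.1 inferInstance)
  let g : Module.Dual ℤ N →+ dualMonoid (∅ : Finset N) :=
    { toFun m := ⟨m, mem_dualMonoid_empty m⟩
      map_zero' := rfl
      map_add' _ _ := rfl }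
  have : AddMonoid.FG (dualMonoid (∅ : Finset N)) :=
    AddMonoid.fg_of_surjective g fun m => ⟨m.1, rfl⟩
  exact AddMonoidAlgebra.finiteType_of_fg k _

/-- The curves that sweep out the toric variety: all leading coefficients but one vary. -/
theorem exists_family_isDominant_ev [Module.Finite ℤ N] [Infinite k]
    (hn : 0 < n) (c : Fin n → F.ContactOrder) (hpos : ∀ j, (c j).IsPositive)
    (hbal : ∑ j, (c j).latticePoint = 0)
    (i₀ : ι) {j₀ : Fin n}
    (hj₀ : b.coord i₀ (c j₀).latticePoint ≠ 0) :
    ∃ f : LogMapFamily (F.toricStructure k) (F.toricDivisor k) (fun j => (c j).mult),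
      topologicalKrullDim f.W + 1 = topologicalKrullDim (F.toricVariety k) ∧ IsDominant f.ev ∧
        ((b.coord i₀ (c j₀).latticePoint : k) ≠ 0 → IsDominantSeparable f.ev) := by
  classical
  let I := {i : ι // i ≠ i₀}
  let L := FractionRing (MvPolynomial (Unit ⊕ I) k)
  let u : Unit ⊕ I → L := fun i => algebraMap (MvPolynomial (Unit ⊕ I) k) _ (MvPolynomial.X i)
  have hu : IsTranscendenceBasis k u := isTranscendenceBasis_fractionRing_X k _
  let z := u (.inl ())
  let N' := I → ℤ
  let b' : Module.Basis I ℤ N' := Pi.basisFun ℤ I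
  let A := ChartRing k (∅ : Finset N')
  let t : I → Lˣ := fun i => .mk0 (u (.inr i)) (hu.1.ne_zero _)
  let Ψ : A →ₐ[k] L := AddMonoidAlgebra.lift k L _ ((Units.coeHom L).comp
    ((latticeCharacter b' t).comp (AddMonoidHom.toMultiplicative
      (dualMonoid (∅ : Finset N')).subtype)))
  have hΨ (i) : Ψ (coordFun b' k i) = u (.inr i) := by
    refine (AddMonoidAlgebra.lift_single _ _ _).trans ((one_smul _ _).trans ?_)
    exact congrArg Units.val (latticeCharacter_coord b' t i)
  have hΨi : Function.Injective Ψ := by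
    refine injective_of_algebraicIndependent_coordFun b' Ψ ?_
    simp only [hΨ]
    exact hu.1.comp _ Sum.inr_injective
  have : IsDomain A := hΨi.isDomain Ψ
  let : Algebra A L := Ψ.toRingHom.toAlgebra
  have : IsScalarTower k A L := .of_algebraMap_eq fun r => (Ψ.commutes r).symm
  have hind : AlgebraicIndependent A (u ∘ Sum.inl) := by
    refine AlgebraicIndependent.of_sumElim_of_forall_mem (k := k) (x := u ∘ Sum.inr) ?_ hΨi
      fun f => ?_
    · rw [Sum.elim_comp_inl_inr]
      exact hu.1
    · refine AddMonoidAlgebra.algHom_mem_of_forall_mem (coordMonomial b')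
        (exists_add_coordMonomial_eq_zero b') (exists_add_coordMonomial_eq b') Ψ _ (fun i => ?_) f
      rw [coordMonomial_single]
      exact (hΨ i).symm ▸ IntermediateField.subset_adjoin _ _ ⟨i, rfl⟩
  have hz : Transcendental A z := hind.transcendental ()
  let τ : ι → Aˣ := fun i => if h : i = i₀ then 1 else
    ⟨coordFun b' k ⟨i, h⟩, .single ⟨-b'.coord ⟨i, h⟩, mem_dualMonoid_empty _⟩ 1, by
      rw [coordFun, AddMonoidAlgebra.single_mul_single, AddMonoidAlgebra.one_def, one_mul]
      exact congrArg (AddMonoidAlgebra.single · 1) (Subtype.ext (add_neg_cancel _)), by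
      rw [coordFun, AddMonoidAlgebra.single_mul_single, AddMonoidAlgebra.one_def, one_mul]
      exact congrArg (AddMonoidAlgebra.single · 1) (Subtype.ext (neg_add_cancel _))⟩
  let θ := latticeCharacter b τ
  have hθ₀ : θ (.ofAdd (b.coord i₀)) = 1 := (latticeCharacter_coord b τ i₀).trans (dif_pos rfl)
  have hθ (i : I) : algebraMap A L (θ (.ofAdd (b.coord i.1))) = u (.inr i) := by
    refine (congrArg (fun x : Aˣ => algebraMap A L x) ((latticeCharacter_coord b τ i.1).trans
      (dif_neg i.2))).trans (hΨ i)
  have htop : IntermediateField.adjoin k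
      (Set.range (fun i => algebraMap A L (θ (.ofAdd (b.coord i)))) ∪ {z}) = ⊤ := by
    refine IntermediateField.eq_top_of_forall_X_mem _ fun i => IntermediateField.subset_adjoin _ _ ?_
    rcases i with i | i
    · exact .inr rfl
    · exact .inl ⟨i.1, hθ i⟩
  let a₀ : Fin n → k := (Infinite.natEmbedding k) ∘ Fin.val
  have ha₀ : Function.Injective a₀ := (Infinite.natEmbedding k).injective.comp Fin.val_injective
  have ha : ∀ i j, i ≠ j → IsUnit (algebraMap k A (a₀ i) - algebraMap k A (a₀ j)) :=
    fun i j hij => by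
      rw [← map_sub]
      exact (sub_ne_zero.2 (ha₀.ne hij)).isUnit.map _
  have hI : Fintype.card I + 1 = Fintype.card ι := by
    have := Fintype.card_pos_iff.2 ⟨i₀⟩
    rw [Fintype.card_subtype_compl, Fintype.card_subtype_eq]
    omega
  have hcard : Nat.card ι = Nat.card (Unit ⊕ I) := by
    rw [Nat.card_sum, Nat.card_eq_fintype_card, Nat.card_eq_fintype_card, Nat.card_eq_fintype_card,
      Fintype.card_unit, ← hI, add_comm]
  refine ⟨curveFamily k hn c hpos hbal (fun j => algebraMap k A (a₀ j)) ha θ, ?_, ?_, fun hk => ?_⟩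
  · rw [topologicalKrullDim_toricVariety, Module.finrank_eq_card_basis b, ← hI]
    have h1 : topologicalKrullDim (PrimeSpectrum A) = Fintype.card I := by
      rw [PrimeSpectrum.topologicalKrullDim_eq_ringKrullDim, ringKrullDim_chartRing_empty,
        Module.finrank_eq_card_basis b']
    refine (congrArg (· + 1) h1).trans ?_
    push_cast
    rfl
  · exact isDominant_curveFamily_ev hn c hpos hbal _ ha θ hz
      (curvePoint_injective b c θ a₀ i₀ ha₀ hz htop hθ₀ hj₀ hu hcard)
  · exact isDominantSeparable_curveFamily_ev_of_ne_zero b c θ a₀ i₀ hn hpos hbal ha ha₀ hz htop hθ₀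
      hk hu hcard

end SmoothFan

end

theorem theorem7p1 {k : Type u} [Field k] [IsAlgClosed k]
    {N : Type} [AddCommGroup N] [Module.Free ℤ N] [Module.Finite ℤ N] (F : SmoothFan N)
    {n : ℕ} (hn : 0 < n) (c : Fin n → F.ContactOrder) (hpos : ∀ j, (c j).IsPositive)
    (hbal : ∑ j, (c j).latticePoint = 0) :
    (IsLogUniruled (F.toricStructure k) (F.toricDivisor k) (fun j => (c j).mult) ∧
      ((∃ j ρ, ¬ ringChar k ∣ (c j).mult ρ) →
        IsSeparablyLogUniruled (F.toricStructure k) (F.toricDivisor k) (fun j => (c j).mult))) ∧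
    (Module.finrank ℤ (Submodule.span ℤ (Set.range fun j => (c j).latticePoint)) =
        Module.finrank ℤ N →
      IsLogRationallyConnected (F.toricStructure k) (F.toricDivisor k) (fun j => (c j).mult)) ∧
    (Module.finrank ℤ (Submodule.span ℤ (Set.range fun j => (c j).latticePoint)) =
        Module.finrank ℤ N →
      (∀ p : ℕ, p.Prime → CharP k p →
        ∀ x : N ⧸ Submodule.span ℤ (Set.range fun j => (c j).latticePoint), p • x = 0 → x = 0) →
      IsSeparablyLogRationallyConnected (F.toricStructure k) (F.toricDivisor k)
        (fun j => (c j).mult)) := by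
  classical
  have : Infinite k := IsAlgClosed.instInfinite
  have hΛ (h : Module.finrank ℤ (Submodule.span ℤ (Set.range fun j => (c j).latticePoint)) =
      Module.finrank ℤ N) :
      Nat.card (N ⧸ Submodule.span ℤ (Set.range fun j => (c j).latticePoint)) ≠ 0 := by
    have := Submodule.finiteQuotientOfFreeOfRankEq _ h
    exact Nat.card_pos.ne'
  have key₁ (j : Fin n) (ρ : F.Ray) (hρ : (c j).mult ρ ≠ 0) :
      ∃ f : LogMapFamily (F.toricStructure k) (F.toricDivisor k) (fun j => (c j).mult),
        topologicalKrullDim f.W + 1 = topologicalKrullDim (F.toricVariety k) ∧ IsDominant f.ev ∧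
          (((c j).mult ρ : k) ≠ 0 → IsDominantSeparable f.ev) := by
    obtain ⟨ι, b, hb⟩ := F.smooth (c j).cone.1 (c j).cone.2
    have := Module.Finite.finite_basis b
    have := Fintype.ofFinite ι
    obtain ⟨i, hi⟩ := hb (((c j).mem_cone ρ).2 hρ)
    have h1 : b.coord i (c j).latticePoint = (c j).mult ρ := by
      refine (c j).apply_latticePoint_eq (by rw [← hi]; simp) fun v hv hvρ => ?_
      obtain ⟨i', rfl⟩ := hb hv
      have h2 : i' ≠ i := fun h => hvρ (h ▸ hi)
      simp [h2]
    obtain ⟨f, hf, hf', hf''⟩ := SmoothFan.exists_family_isDominant_ev (k := k) b hn c hpos hbal i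
      (j₀ := j) (by rw [h1]; exact_mod_cast hρ)
    refine ⟨f, hf, hf', fun h => hf'' ?_⟩
    rw [h1]
    exact_mod_cast h
  have key₂ (E : Type u) [Field E]
      (hE : (Nat.card (N ⧸ Submodule.span ℤ (Set.range fun j => (c j).latticePoint)) : E) ≠ 0) :
      ∃ (q : ℕ) (f : LogMapFamily (F.toricStructure k) (F.toricDivisor k) (fun j => (c j).mult)),
        (q : E) ≠ 0 ∧ IsDominant f.ev₂ ∧ ((q : k) ≠ 0 → IsDominantSeparable f.ev₂) := by
    let b := Module.Free.chooseBasis ℤ N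
    obtain ⟨e, he⟩ := exists_det_ne_zero b (fun j => (c j).latticePoint) E hE
    set M := Matrix.of fun i l => b.coord i (c (e l)).latticePoint
    have hM : (M.det.natAbs : E) ≠ 0 := by
      rw [Nat.cast_natAbs]
      rcases abs_choice M.det with h | h <;> rw [h]
      · exact he
      · simpa using he
    obtain ⟨μ, hμ⟩ := exists_mul_eq_natAbs_det M
    obtain ⟨f, hf⟩ := SmoothFan.exists_family_isDominant_ev₂ (k := k) b hn c hpos hbal hμ
      (fun h => hM (by rw [h, Nat.cast_zero]))
    exact ⟨_, f, hM, hf⟩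
  refine ⟨⟨?_, ?_⟩, fun h => ?_, fun h htor => ?_⟩
  · obtain ⟨ρ, hρ⟩ := hpos ⟨0, hn⟩
    obtain ⟨f, hf, hf', -⟩ := key₁ _ ρ hρ
    exact ⟨f, hf, hf'⟩
  · rintro ⟨j, ρ, hρ⟩
    have h1 : ((c j).mult ρ : k) ≠ 0 := fun h0 => hρ ((ringChar.spec k _).1 h0)
    obtain ⟨f, hf, -, hf'⟩ := key₁ j ρ fun h0 => h1 (by rw [h0, Nat.cast_zero])
    exact ⟨f, hf, hf' h1⟩
  · have : CharZero (ULift.{u} ℚ) :=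
      ⟨fun _ _ h => Nat.cast_injective (R := ℚ) (congrArg ULift.down h)⟩
    obtain ⟨q, f, -, hf, -⟩ := key₂ (ULift.{u} ℚ) (Nat.cast_ne_zero.2 (hΛ h))
    exact ⟨f, hf⟩
  · obtain ⟨q, f, hq, -, hf⟩ := key₂ k (fun h0 => by
      have hp := (CharP.cast_eq_zero_iff k (ringChar k) _).1 h0
      have hp0 : ringChar k ≠ 0 := fun h1 => hΛ h (Nat.eq_zero_of_zero_dvd (h1 ▸ hp))
      have hprime : (ringChar k).Prime := (CharP.char_is_prime_or_zero k _).resolve_right hp0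
      have := Submodule.finiteQuotientOfFreeOfRankEq _ h
      have := Fact.mk hprime
      obtain ⟨x, hx⟩ := exists_prime_addOrderOf_dvd_card' (ringChar k) hp
      have hx0 := htor _ hprime inferInstance x (hx ▸ addOrderOf_nsmul_eq_zero x)
      rw [hx0, addOrderOf_zero] at hx
      exact hprime.one_lt.ne hx)
    exact ⟨f, hf hq⟩
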